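/- Let $F$ be a Finsler metric on a finite-dimensional smooth manifold $M$ ($F:TM\to[0,\infty)$, smooth off the null section, zero exactly on the null section, positively $1$-homogeneous, with positive-definite fundamental tensor $g_w(u,v)=\frac12\frac{\partial^2}{\partial t\,\partial s}F(w+su+tv)^2|_{s=t=0}$). On $TM\setminus 0$, with projection $\pi$ to $M$, let $i_w(u)=\frac{d}{dt}|_{t=0}(w+tu)$, let $C(w)=i_w(w)$ be the canonical field and $J(X)=i_w(d\pi X)$, for $X\in T_w(TM\setminus0)$, the almost-tangent structure. Let $S$ be the geodesic spray of $F$: $dE=\omega_F(S,\cdot)$, where $E=F^2/2$ and $\omega_F$ is the pullback of the canonical symplectic form $\sum dq^i\wedge dp_i$ of $T^*M$ by $w\mapsto g_w(w,\cdot)$. Let $\Gamma_S=-[S,J]$, i.e. $\Gamma_S(X)=J[S,X]-[S,JX]$, with horizontal and vertical projections $H=\frac12(1+\Gamma_S)$ and $V=\frac12(1-\Gamma_S)$. A *lift* of $\Gamma_S$ is a linear connection $\nabla$ on the vertical bundle over $TM\setminus 0$ such that $\nabla_XC=X$ for $X$ vertical and the kernel of $X\mapsto\nabla_XC$ is the horizontal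 distribution $\ker(\Gamma_S-1)$. Put $T(X,Y)=\nabla_XJ(Y)-\nabla_YJ(X)-J[X,Y]$ and $\mathscr C_\flat(X,Y,Z)=g\bigl(T(JX,Y),JZ\bigr)$, where $g$ is transported to the vertical bundle by $i_w$. Let $\mathrm C_w(u,v,z)=\frac14\frac{\partial^3}{\partial r\,\partial s\,\partial t}F(w+ru+sv+tz)^2|_{r=s=t=0}$ be the Cartan tensor and $\mathrm C'_w=(D^W_W\mathrm C_W)|_{\pi(w)}$, where $W$ is any nowhere null vector field around $\pi(w)$ with $W(\pi(w))=w$ whose integral curve through $\pi(w)$ is a geodesic of $S$, and $D^w_uV=i_w^{-1}\nabla^*_{u^{\mathfrak h}}V^{\mathfrak v}$ is formed with horizontal and vertical lifts and the Berwald connection $\nabla^*$ of $S$, given by $\nabla^*_{JX}JY=J[JX,Y]$, $\nabla^*_{HX}JY=V[HX,JY]$. Both tensors are regarded as tensors on the vertical bundle via $i_w$. For $\varepsilon\in\{1,-1\}$ consider the conditions (for all $X,Y,Z$) - (T2) $T(HX,HY)=0$; (T3) $T(X,Y)=0$; - (M3) $(\nabla_Xg)(\cdot,\cdot)=2\mathrm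 C(VX,\cdot,\cdot)$; - (M4)$_\varepsilon$ $(\nabla_Xg)(\cdot,\cdot)=2\varepsilon\,\mathrm C'(JX,\cdot,\cdot)$; - (M5)$_\varepsilon$ $(\nabla_Xg)(\cdot,\cdot)=2\mathrm C(VX,\cdot,\cdot)+2\varepsilon\,\mathrm C'(JX,\cdot,\cdot)$; - (M6) $\nabla g=0$; (M7) $\mathscr C_\flat(X,Y,Z)=\mathscr C_\flat(X,Z,Y)$. **Theorem.** For each of the following sets of conditions (and, in (1) and (4), each $\varepsilon\in\{1,-1\}$) there is one and only one lift $\nabla$ of $\Gamma_S$ satisfying it: 1. (T3) and (M5)$_\varepsilon$; 2. (T2), (M6) and (M7); 3. (T3) and (M3); 4. (T2), (M4)$_\varepsilon$ and (M7). Moreover, a linear connection on the vertical bundle is the Berwald connection $\nabla^*$ of $S$ if and only if it is a lift of $\Gamma_S$ satisfying (T3) and (M5)$_{-1}$. The connections determined by (2), (3) and (4) with $\varepsilon=-1$ are called, respectively, the Cartan, Chern–Rund and Hashiguchi connections of $F$. -/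

import Mathlib

open Bundle Set Filter
open scoped Manifold ContDiff Topology

noncomputable section

namespace FinslerLifts

variable {E : Type*} [NormedAddCommGroup E] [NormedSpace ℝ E]
  {M : Type*} [TopologicalSpace M] [ChartedSpace E M] [IsManifold 𝓘(ℝ, E) ∞ M]

/-! ### The slit tangent bundle and its tangent vectors -/

/-- The total space `TM` of the tangent bundle of `M`. -/
abbrev TM (E : Type*) [NormedAddCommGroup E] [NormedSpace ℝ E]
    (M : Type*) [TopologicalSpace M] [ChartedSpace E M] : Type _ :=
  TangentBundle 𝓘(ℝ, E) M

/-- The tangent space `T_x M`. -/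
abbrev TangM (E : Type*) [NormedAddCommGroup E] [NormedSpace ℝ E]
    {M : Type*} [TopologicalSpace M] [ChartedSpace E M] (x : M) : Type _ :=
  TangentSpace 𝓘(ℝ, E) x

/-- The tangent space `T_w (TM)`. -/
abbrev TTM (w : TM E M) : Type _ :=
  TangentSpace 𝓘(ℝ, E).tangent w

/-- Vector fields on the slit tangent bundle `TM \ 0`. Such a field is represented by a function on
all of `TM`; its values on the null section are irrelevant and never used. -/
abbrev Field (E : Type*) [NormedAddCommGroup E] [NormedSpace ℝ E]
    (M : Type*) [TopologicalSpace M] [ChartedSpace E M] [IsManifold 𝓘(ℝ, E) ∞ M] : Type _ :=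
  (w : TM E M) → TTM w

/-- The slit tangent bundle `TM \ 0`, an open subset of `TM`. -/
def slit (E : Type*) [NormedAddCommGroup E] [NormedSpace ℝ E]
    (M : Type*) [TopologicalSpace M] [ChartedSpace E M] : Set (TM E M) :=
  {w | w.2 ≠ 0}

/-- The vector field `X` is smooth on `TM \ 0`, i.e. `X ∈ 𝔛(TM \ 0)`. -/
def SmoothField (X : Field E M) : Prop :=
  ContMDiffOn 𝓘(ℝ, E).tangent 𝓘(ℝ, E).tangent.tangent ∞
    (fun w => (⟨w, X w⟩ : TangentBundle 𝓘(ℝ, E).tangent (TM E M))) (slit E M)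

/-- The differential `dπ(w) : T_w (TM) → T_{π(w)} M` of the projection. -/
def dproj (w : TM E M) : TTM w →L[ℝ] TangM E w.1 :=
  mfderiv 𝓘(ℝ, E).tangent 𝓘(ℝ, E) (fun p : TM E M => p.1) w

/-- The vertical lift `i_w(u) = (d/dt)|_{t=0} (w + t u)`. -/
def vlift (w : TM E M) (u : TangM E w.1) : TTM w :=
  mfderiv 𝓘(ℝ, ℝ) 𝓘(ℝ, E).tangent (fun t : ℝ => (⟨w.1, w.2 + t • u⟩ : TM E M)) 0 (1 : ℝ)

/-- The inverse `i_w⁻¹` of the vertical lift (used on vertical vectors only). -/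
def vdrop (w : TM E M) : TTM w → TangM E w.1 :=
  Function.invFun (vlift w)

/-- Smooth vertical vector fields on `TM \ 0`, i.e. smooth sections of the vertical bundle. -/
def SmoothVertical (Y : Field E M) : Prop :=
  SmoothField Y ∧ ∀ w ∈ slit E M, dproj w (Y w) = 0

/-- The canonical vector field `C(w) = i_w(w)`. -/
def canonicalField : Field E M := fun w => vlift w w.2

/-- The almost-tangent structure `J`. -/
def almostTangent (X : Field E M) : Field E M := fun w => vlift w (dproj w (X w))

/-- The Lie bracket of vector fields on `TM \ 0`. -/
def bracket (X Y : Field E M) : Field E M :=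
  VectorField.mlieBracket 𝓘(ℝ, E).tangent X Y

/-- The derivative `X f` of a function along a vector field on `TM \ 0`. -/
def dirDeriv (X : Field E M) (f : TM E M → ℝ) (w : TM E M) : ℝ :=
  mfderiv 𝓘(ℝ, E).tangent 𝓘(ℝ, ℝ) f w (X w)

/-! ### Finsler metrics -/

/-- `g_w(u, v) = 1/2 ∂²/∂t∂s F(w + s u + t v)²` at `s = t = 0`. -/
def fundTensor (F : TM E M → ℝ) (w : TM E M) (u v : TangM E w.1) : ℝ :=
  (1 / 2) * deriv (fun t : ℝ => deriv (fun s : ℝ => F ⟨w.1, w.2 + s • u + t • v⟩ ^ 2) 0) 0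

/-- The Cartan tensor `C_w(u, v, z) = 1/4 ∂³/∂r∂s∂t F(w + r u + s v + t z)²` at
`r = s = t = 0`. -/
def cartanTensor (F : TM E M → ℝ) (w : TM E M) (u v z : TangM E w.1) : ℝ :=
  (1 / 4) * deriv (fun r : ℝ => deriv (fun s : ℝ => deriv (fun t : ℝ =>
    F ⟨w.1, w.2 + r • u + s • v + t • z⟩ ^ 2) 0) 0) 0

/-- `F : TM → [0, ∞)` is a Finsler metric on `M`. -/
structure IsFinslerMetric (F : TM E M → ℝ) : Prop where
  nonneg : ∀ w, 0 ≤ F w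
  smooth : ContMDiffOn 𝓘(ℝ, E).tangent 𝓘(ℝ, ℝ) ∞ F (slit E M)
  eq_zero_iff : ∀ w, F w = 0 ↔ w.2 = 0
  homogeneous : ∀ (w : TM E M) (c : ℝ), 0 < c → F ⟨w.1, c • w.2⟩ = c * F w
  posDef : ∀ w ∈ slit E M, ∀ u : TangM E w.1, u ≠ 0 → 0 < fundTensor F w u u

/-- The pullback by the Legendre transformation `w ↦ g_w(w, ·)` of the tautological 1-form
of `T*M`, evaluated on a vector field: `θ_F(X)(w) = g_w(w, dπ(X))`. -/
def legendreForm (F : TM E M → ℝ) (X : Field E M) (w : TM E M) : ℝ :=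
  fundTensor F w w.2 (dproj w (X w))

/-- The symplectic form `ω_F = -dθ_F` on `TM \ 0`, the pullback by the Legendre transformation of
the canonical symplectic form `∑ dqⁱ ∧ dpᵢ` of `T*M`, evaluated on vector fields. -/
def symplecticForm (F : TM E M → ℝ) (X Y : Field E M) (w : TM E M) : ℝ :=
  -(dirDeriv X (legendreForm F Y) w - dirDeriv Y (legendreForm F X) w
    - legendreForm F (bracket X Y) w)

/-- `S` is the geodesic spray of `F`: the smooth vector field on `TM \ 0` given by
`dE = ω_F(S, ·)`, where `E = F² / 2`. -/
def IsGeodesicSpray (F : TM E M → ℝ) (S : Field E M) : Prop :=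
  SmoothField S ∧ ∀ Y : Field E M, SmoothField Y → ∀ w ∈ slit E M,
    dirDeriv Y (fun p => F p ^ 2 / 2) w = symplecticForm F S Y w

/-! ### The canonical connection of a spray -/

/-- The canonical connection `Γ_S = -[S, J]`, minus the Lie derivative of the tensor field `J`
along `S`: `Γ_S(X) = J[S, X] - [S, J X]`. It is tensorial; its value on a tangent vector `ξ` is
computed by means of a local extension of `ξ` to a vector field. -/
def canonicalConnection (S : Field E M) (w : TM E M) (ξ : TTM w) : TTM w :=
  almostTangent (bracket S (FiberBundle.extend (E × E) ξ)) w
    - bracket S (almostTangent (FiberBundle.extend (E × E) ξ)) w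

/-- A tangent vector of `TM \ 0` is horizontal if it is fixed by `Γ_S`. -/
def IsHorizontal (S : Field E M) (w : TM E M) (ξ : TTM w) : Prop :=
  canonicalConnection S w ξ = ξ

/-- The horizontal projection `(1 + Γ_S) / 2`. -/
def hproj (S : Field E M) (X : Field E M) : Field E M :=
  fun w => (1 / 2 : ℝ) • (X w + canonicalConnection S w (X w))

/-- The vertical projection `(1 - Γ_S) / 2`. -/
def vproj (S : Field E M) (X : Field E M) : Field E M :=
  fun w => (1 / 2 : ℝ) • (X w - canonicalConnection S w (X w))

/-! ### Linear connections on the vertical bundle -/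

/-- An operator `∇ : (X, Y) ↦ ∇_X Y` is a linear connection on the vertical bundle over
`TM \ 0`: for `X` a smooth vector field and `Y` a smooth vertical vector field on `TM \ 0` it
gives a smooth vertical vector field, it is additive in `X` and `Y`, linear over smooth
functions in `X`, and it satisfies the Leibniz rule in `Y`. Fields and functions are only compared
on `TM \ 0`. -/
structure IsLinearConnection (D : Field E M → Field E M → Field E M) : Prop where
  smooth : ∀ X Y, SmoothField X → SmoothVertical Y → SmoothVertical (D X Y)
  add_left : ∀ X X' Y, SmoothField X → SmoothField X' → SmoothVertical Y →
    ∀ w ∈ slit E M, D (X + X') Y w = D X Y w + D X' Y w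
  add_right : ∀ X Y Y', SmoothField X → SmoothVertical Y → SmoothVertical Y' →
    ∀ w ∈ slit E M, D X (Y + Y') w = D X Y w + D X Y' w
  smul_left : ∀ (f : TM E M → ℝ) (X X' Y : Field E M),
    ContMDiffOn 𝓘(ℝ, E).tangent 𝓘(ℝ, ℝ) ∞ f (slit E M) →
    SmoothField X → SmoothField X' → SmoothVertical Y →
    (∀ w ∈ slit E M, X' w = f w • X w) →
    ∀ w ∈ slit E M, D X' Y w = f w • D X Y w
  leibniz : ∀ (f : TM E M → ℝ) (X Y Y' : Field E M),
    ContMDiffOn 𝓘(ℝ, E).tangent 𝓘(ℝ, ℝ) ∞ f (slit E M) →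
    SmoothField X → SmoothVertical Y → SmoothVertical Y' →
    (∀ w ∈ slit E M, Y' w = f w • Y w) →
    ∀ w ∈ slit E M, D X Y' w = f w • D X Y w + dirDeriv X f w • Y w

/-- `∇` is a lift of `Γ_S`: it is a linear connection on the vertical bundle which is
almost-projectable (`∇_X C = X` for `X` vertical), and the kernel of `X ↦ ∇_X C` is the
horizontal distribution of `Γ_S`. -/
structure IsLift (S : Field E M) (D : Field E M → Field E M → Field E M) : Prop where
  isLinearConnection : IsLinearConnection D
  almostProjectable : ∀ X, SmoothVertical X → ∀ w ∈ slit E M, D X canonicalField w = X w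
  ker_eq : ∀ X, SmoothField X → ∀ w ∈ slit E M,
    (D X canonicalField w = 0 ↔ IsHorizontal S w (X w))

/-- The torsion `T(X, Y) = ∇_X J(Y) - ∇_Y J(X) - J[X, Y]`. -/
def torsion (D : Field E M → Field E M → Field E M) (X Y : Field E M) : Field E M :=
  fun w => D X (almostTangent Y) w - D Y (almostTangent X) w - almostTangent (bracket X Y) w

/-- `T(H X, H Y) = 0` for all `X`, `Y`. -/
def T2 (S : Field E M) (D : Field E M → Field E M → Field E M) : Prop :=
  ∀ X Y, SmoothField X → SmoothField Y → ∀ w ∈ slit E M,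
    torsion D (hproj S X) (hproj S Y) w = 0

/-- `T(X, Y) = 0` for all `X`, `Y`. -/
def T3 (D : Field E M → Field E M → Field E M) : Prop :=
  ∀ X Y, SmoothField X → SmoothField Y → ∀ w ∈ slit E M, torsion D X Y w = 0

/-- The Riemannian metric `g` on the vertical bundle induced by the fundamental tensor. -/
def vertMetric (F : TM E M → ℝ) (Y Z : Field E M) (w : TM E M) : ℝ :=
  fundTensor F w (vdrop w (Y w)) (vdrop w (Z w))

/-- `(∇_X g)(Y, Z) = X g(Y, Z) - g(∇_X Y, Z) - g(Y, ∇_X Z)`. -/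
def nablaMetric (F : TM E M → ℝ) (D : Field E M → Field E M → Field E M)
    (X Y Z : Field E M) (w : TM E M) : ℝ :=
  dirDeriv X (vertMetric F Y Z) w - vertMetric F (D X Y) Z w - vertMetric F Y (D X Z) w

/-- `𝒞_♭(X, Y, Z) = g(𝒞(X, Y), J(Z))`, where `𝒞(X, Y) = T(J(X), Y)`. -/
def cFlat (F : TM E M → ℝ) (D : Field E M → Field E M → Field E M)
    (X Y Z : Field E M) (w : TM E M) : ℝ :=
  vertMetric F (torsion D (almostTangent X) Y) (almostTangent Z) w

/-! ### The Berwald connection and the derivative of the Cartan tensor along geodesics -/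

/-- `∇` is the Berwald connection of `S`: `∇_{J(X)} J(Y) = J[J(X), Y]` and
`∇_{H X} J(Y) = V[H X, J(Y)]`. -/
def IsBerwald (S : Field E M) (D : Field E M → Field E M → Field E M) : Prop :=
  ∀ X Y, SmoothField X → SmoothField Y → ∀ w ∈ slit E M,
    D (almostTangent X) (almostTangent Y) w = almostTangent (bracket (almostTangent X) Y) w ∧
    D (hproj S X) (almostTangent Y) w = vproj S (bracket (hproj S X) (almostTangent Y)) w

/-- The vertical lift of a vector field on (an open subset of) `M`. -/
def vliftField (V : (x : M) → TangM E x) : Field E M := fun w => vlift w (V w.1)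

/-- The horizontal lift of a vector field on (an open subset of) `M`: the horizontal part of any
field over `U`. -/
def hliftField (S : Field E M) (U : (x : M) → TangM E x) : Field E M :=
  hproj S (fun w => Function.invFun (dproj w) (U w.1))

/-- `D^w_u V = i_w⁻¹ ∇_{u^h} V^v` for `u = U(π(w))`, where `∇` is the Berwald connection of
`S`, for which `∇_{U^h} V^v = V[U^h, V^v]`. -/
def affineDeriv (S : Field E M) (w : TM E M) (U V : (x : M) → TangM E x) : TangM E w.1 :=
  vdrop w (vproj S (bracket (hliftField S U) (vliftField V)) w)

/-- `W` is a nowhere null smooth vector field defined around `π(w)`, with value `w` at `π(w)`,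
whose integral curve `γ` through `π(w)` is a geodesic of `S`, i.e. its velocity curve
`t ↦ W(γ(t))` is an integral curve of `S`. -/
def IsGeodesicExtension (S : Field E M) (w : TM E M) (W : (x : M) → TangM E x) : Prop :=
  (∃ O : Set M, IsOpen O ∧ w.1 ∈ O ∧ (∀ x ∈ O, W x ≠ 0) ∧
    ContMDiffOn 𝓘(ℝ, E) 𝓘(ℝ, E).tangent ∞ (fun x => (⟨x, W x⟩ : TM E M)) O) ∧
  W w.1 = w.2 ∧
  ∃ γ : ℝ → M, γ 0 = w.1 ∧ IsMIntegralCurveAt γ W 0 ∧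
    IsMIntegralCurveAt (fun t => (⟨γ t, W (γ t)⟩ : TM E M)) S 0

/-- `(D^W_W C_W)(U, V, Z)` at the point `π(w)`, where `W(π(w)) = w`:
`W(C_W(U, V, Z)) - C_W(D^W_W U, V, Z) - C_W(U, D^W_W V, Z) - C_W(U, V, D^W_W Z)`. -/
def cartanDeriv (F : TM E M → ℝ) (S : Field E M) (w : TM E M)
    (W U V Z : (x : M) → TangM E x) : ℝ :=
  (show ℝ from
      mfderiv 𝓘(ℝ, E) 𝓘(ℝ, ℝ) (fun x => cartanTensor F ⟨x, W x⟩ (U x) (V x) (Z x)) w.1 (W w.1))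
    - cartanTensor F w (affineDeriv S w W U) (V w.1) (Z w.1)
    - cartanTensor F w (U w.1) (affineDeriv S w W V) (Z w.1)
    - cartanTensor F w (U w.1) (V w.1) (affineDeriv S w W Z)

/-- `C'_w(u, v, z) = (D^W_W C_W)(u, v, z)` at `π(w)`, where `W` is any nowhere null vector field
around `π(w)` with `W(π(w)) = w` whose integral curve through `π(w)` is a geodesic. The
vectors `u`, `v`, `z` are extended locally to vector fields. -/
def cartanPrime (F : TM E M → ℝ) (S : Field E M) (w : TM E M) (u v z : TangM E w.1) : ℝ :=
  cartanDeriv F S w (Classical.epsilon (IsGeodesicExtension S w))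
    (FiberBundle.extend E u) (FiberBundle.extend E v) (FiberBundle.extend E z)

/-! ### The metric conditions -/

/-- The Cartan tensor as a tensor field on the vertical bundle. -/
def vertCartan (F : TM E M → ℝ) (X Y Z : Field E M) (w : TM E M) : ℝ :=
  cartanTensor F w (vdrop w (X w)) (vdrop w (Y w)) (vdrop w (Z w))

/-- The tensor `C'` as a tensor field on the vertical bundle. -/
def vertCartanPrime (F : TM E M → ℝ) (S : Field E M) (X Y Z : Field E M) (w : TM E M) : ℝ :=
  cartanPrime F S w (vdrop w (X w)) (vdrop w (Y w)) (vdrop w (Z w))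

/-- `(∇_X g)(·, ·) = 2 C(V X, ·, ·)`. -/
def M3 (F : TM E M → ℝ) (S : Field E M) (D : Field E M → Field E M → Field E M) : Prop :=
  ∀ X Y Z, SmoothField X → SmoothVertical Y → SmoothVertical Z → ∀ w ∈ slit E M,
    nablaMetric F D X Y Z w = 2 * vertCartan F (vproj S X) Y Z w

/-- `(∇_X g)(·, ·) = 2 ε C'(J(X), ·, ·)`, with a sign `ε`. -/
def M4 (ε : ℝ) (F : TM E M → ℝ) (S : Field E M)
    (D : Field E M → Field E M → Field E M) : Prop :=
  ∀ X Y Z, SmoothField X → SmoothVertical Y → SmoothVertical Z → ∀ w ∈ slit E M,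
    nablaMetric F D X Y Z w = 2 * ε * vertCartanPrime F S (almostTangent X) Y Z w

/-- `(∇_X g)(·, ·) = 2 C(V X, ·, ·) + 2 ε C'(J(X), ·, ·)`, with a sign `ε`. -/
def M5 (ε : ℝ) (F : TM E M → ℝ) (S : Field E M)
    (D : Field E M → Field E M → Field E M) : Prop :=
  ∀ X Y Z, SmoothField X → SmoothVertical Y → SmoothVertical Z → ∀ w ∈ slit E M,
    nablaMetric F D X Y Z w
      = 2 * vertCartan F (vproj S X) Y Z w
        + 2 * ε * vertCartanPrime F S (almostTangent X) Y Z w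

/-- `∇ g = 0`. -/
def M6 (F : TM E M → ℝ) (D : Field E M → Field E M → Field E M) : Prop :=
  ∀ X Y Z, SmoothField X → SmoothVertical Y → SmoothVertical Z → ∀ w ∈ slit E M,
    nablaMetric F D X Y Z w = 0

/-- `𝒞_♭(X, Y, Z) = 𝒞_♭(X, Z, Y)` for all `X`, `Y`, `Z`. -/
def M7 (F : TM E M → ℝ) (D : Field E M → Field E M → Field E M) : Prop :=
  ∀ X Y Z, SmoothField X → SmoothField Y → SmoothField Z → ∀ w ∈ slit E M,
    cFlat F D X Y Z w = cFlat F D X Z Y w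

/-- There is one, and only one, lift of `Γ_S` with the property `P`. Two connections on the
vertical bundle are the same if they agree on `TM \ 0` for all smooth `X` and all smooth
vertical `Y`. -/
def ExistsUniqueLift (S : Field E M)
    (P : (Field E M → Field E M → Field E M) → Prop) : Prop :=
  (∃ D, IsLift S D ∧ P D) ∧
  ∀ D D', IsLift S D → P D → IsLift S D' → P D' →
    ∀ X Y, SmoothField X → SmoothVertical Y → ∀ w ∈ slit E M, D X Y w = D' X Y w

end FinslerLifts

end

/-! Everything is computed in charts. There the energy is a Lagrangian `L(x, y)`, the metric is `g =
∂²L/∂y²`, the spray is `(y, s)`, and the nonlinear connection is `N = -½ ∂s/∂y`. The horizontal and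
vertical parts of `(a, b)` are `(a, -N a)` and `(0, b + N a)`. The Berwald connection `∇*` has the
symmetric Christoffel symbols `Γ = ∂N/∂y`, so it is torsion free.

The key identity is `∇*g = 2 C(V·) - 2 C'(J·)` (`IsLocalSpray.fderiv_locMetric_eq`). It comes from
differentiating along the fibre the fact that `g` is parallel along the spray
(`IsLocalSpray.fderiv_locMetric_spray`). That fact is the symmetrised fibre derivative of the
Euler-Lagrange equation.

Existence. Add to `∇*` the `g`-dual `A` of `κ C(V X, Y, ·) + μ C'(J X, Y, ·)` (`finslerConn κ μ`).
Both tensors are totally symmetric and vanish on `C(w) = i_w(w)`. Hence every member of the family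
is a lift, its torsion is the antisymmetrisation of `A`, and `∇g = (2 - 2κ) C - (2 + 2μ) C'`
(`nablaMetric_finslerConn`). Condition (T2) and (M7) always hold, and (T3) holds for `κ = 0`. Each
metric condition is met by solving for `κ` and `μ`; `κ = μ = 0` is the Berwald connection.

Uniqueness. Each metric condition prescribes `∇g`, so the difference `B` of two solutions is
`g`-skew in its last two slots. Along horizontal vectors the torsion condition makes `B` symmetric
in its first two slots, hence zero, as for the Levi-Civita connection (`eq_on_horizontal`). Along
vertical vectors either (T3) gives `∇_{JX} JY` explicitly, because `J² = 0`
(`eq_on_vertical_of_t3`), or (M7) makes `B(JX, ·)` `g`-symmetric as well as skew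
(`eq_on_vertical_of_m7`).

The tensor `C'` is defined by a choice of geodesic field. Such a field exists
(`exists_isGeodesicExtension`), and the result is a chart expression independent of the choice
(`cartanPrime_eq`). -/

noncomputable section

namespace FinslerLifts

/-! ### Sprays of Lagrangians on an open subset of `E × E` -/

section LocalCalculus

variable {E : Type*} [NormedAddCommGroup E] [NormedSpace ℝ E]

/-- The Hessian of a Lagrangian in the fibre directions. -/
def locMetric (L : E × E → ℝ) (p : E × E) (u : E) : E →L[ℝ] ℝ :=
  (fderiv ℝ (fderiv ℝ L) p (0, u)).comp (ContinuousLinearMap.inr ℝ E E)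

/-- The Cartan tensor of a Lagrangian. -/
def locCartan (L : E × E → ℝ) (p : E × E) (u v : E) : E →L[ℝ] ℝ :=
  (1 / 2 : ℝ) • (fderiv ℝ (fderiv ℝ (fderiv ℝ L)) p (0, u) (0, v)).comp
    (ContinuousLinearMap.inr ℝ E E)

/-- The coefficients of the nonlinear connection of a spray `(y, s)`. -/
def locNonlin (s : E × E → E) (p : E × E) : E →L[ℝ] E :=
  (-(1 / 2 : ℝ)) • (fderiv ℝ s p).comp (ContinuousLinearMap.inr ℝ E E)

/-- The Christoffel symbols of the Berwald connection of a spray `(y, s)`. -/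
def locChris (s : E × E → E) (p : E × E) (a c : E) : E :=
  fderiv ℝ (locNonlin s) p (0, c) a

/-- The derivative of the Cartan tensor along the spray `(y, s)`. -/
def locLandsberg (L : E × E → ℝ) (s : E × E → E) (p : E × E) (u v : E) : E →L[ℝ] ℝ :=
  fderiv ℝ (fun q => locCartan L q u v) p (p.2, s p)
    - locCartan L p (locNonlin s p u) v - locCartan L p u (locNonlin s p v)
    - (locCartan L p u v).comp (locNonlin s p)

/-- `L` is a quadratically homogeneous Lagrangian with positive definite fibre Hessian on the open
set `Ω`. -/
structure IsLocalLagrangian (Ω : Set (E × E)) (L : E × E → ℝ) : Prop where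
  isOpen : IsOpen Ω
  contDiffAt_lagrangian : ∀ p ∈ Ω, ContDiffAt ℝ ∞ L p
  euler : ∀ p ∈ Ω, fderiv ℝ L p (0, p.2) = 2 * L p
  posDef : ∀ p ∈ Ω, ∀ u, u ≠ 0 → 0 < locMetric L p u u

/-- `(y, s)` is the spray of the Lagrangian `L` on the open set `Ω`. -/
structure IsLocalSpray (Ω : Set (E × E)) (L : E × E → ℝ) (s : E × E → E) : Prop
    extends IsLocalLagrangian Ω L where
  contDiffAt_spray : ∀ p ∈ Ω, ContDiffAt ℝ ∞ s p
  spray : ∀ p ∈ Ω, ∀ u, fderiv ℝ (fderiv ℝ L) p (p.2, s p) (0, u) = fderiv ℝ L p (u, 0)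

variable {G : Type*} [NormedAddCommGroup G] [NormedSpace ℝ G]

theorem contDiffAt_fderiv {H : Type*} [NormedAddCommGroup H] [NormedSpace ℝ H] {f : H → G} {p : H}
    (hf : ContDiffAt ℝ ∞ f p) : ContDiffAt ℝ ∞ (fderiv ℝ f) p :=
  hf.fderiv_right le_rfl

theorem differentiableAt_of_contDiffAt {H : Type*} [NormedAddCommGroup H] [NormedSpace ℝ H]
    {f : H → G} {p : H} (hf : ContDiffAt ℝ ∞ f p) : DifferentiableAt ℝ f p :=
  hf.differentiableAt (by simp)

theorem fderiv_clm_apply_apply {H K : Type*} [NormedAddCommGroup H] [NormedSpace ℝ H]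
    [NormedAddCommGroup K] [NormedSpace ℝ K] {A : H → K →L[ℝ] G} {b : H → K} {p : H}
    (hA : DifferentiableAt ℝ A p) (hb : DifferentiableAt ℝ b p) (ζ : H) :
    fderiv ℝ (fun q => A q (b q)) p ζ = fderiv ℝ A p ζ (b p) + A p (fderiv ℝ b p ζ) := by
  rw [fderiv_clm_apply hA hb]
  simp [add_comm]

theorem second_fderiv_symm {H : Type*} [NormedAddCommGroup H] [NormedSpace ℝ H] {f : H → G} {p : H}
    (hf : ContDiffAt ℝ ∞ f p) (ξ η : H) :
    fderiv ℝ (fderiv ℝ f) p ξ η = fderiv ℝ (fderiv ℝ f) p η ξ :=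
  (hf.isSymmSndFDerivAt (by
    rw [minSmoothness_of_isRCLikeNormedField]; exact WithTop.coe_le_coe.2 le_top)) ξ η

theorem fderiv_eq_of_eqOn {H : Type*} [NormedAddCommGroup H] [NormedSpace ℝ H] {f h : H → G}
    {Ω : Set H} (hΩ : IsOpen Ω) (hfh : ∀ q ∈ Ω, f q = h q) {p : H} (hp : p ∈ Ω) :
    fderiv ℝ f p = fderiv ℝ h p :=
  Filter.EventuallyEq.fderiv_eq (by filter_upwards [hΩ.mem_nhds hp] with q hq using hfh q hq)

theorem fderiv_vertical_snd (p ζ : E × E) :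
    fderiv ℝ (fun q : E × E => ((0 : E), q.2)) p ζ = (0, ζ.2) := by
  have : (fun q : E × E => ((0 : E), q.2)) =
      ((ContinuousLinearMap.inr ℝ E E).comp (ContinuousLinearMap.snd ℝ E E)) := by
    ext <;> simp
  rw [this, ContinuousLinearMap.fderiv]
  simp

theorem differentiableAt_vertical_snd (p : E × E) :
    DifferentiableAt ℝ (fun q : E × E => ((0 : E), q.2)) p := by fun_prop

variable {Ω : Set (E × E)} {L : E × E → ℝ} {s : E × E → E}

theorem locMetric_apply (p : E × E) (u v : E) :
    locMetric L p u v = fderiv ℝ (fderiv ℝ L) p (0, u) (0, v) := rfl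

theorem locCartan_apply (p : E × E) (u v z : E) :
    locCartan L p u v z =
      1 / 2 * fderiv ℝ (fderiv ℝ (fderiv ℝ L)) p (0, u) (0, v) (0, z) := rfl

theorem locNonlin_apply (p : E × E) (a : E) :
    locNonlin s p a = (-(1 / 2 : ℝ)) • fderiv ℝ s p (0, a) := rfl

theorem locLandsberg_apply (p : E × E) (u v z : E) :
    locLandsberg L s p u v z = fderiv ℝ (fun q => locCartan L q u v) p (p.2, s p) z
        - locCartan L p (locNonlin s p u) v z - locCartan L p u (locNonlin s p v) z
        - locCartan L p u v (locNonlin s p z) := rfl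

theorem contDiffAt_locNonlin {p : E × E} (hs : ContDiffAt ℝ ∞ s p) :
    ContDiffAt ℝ ∞ (locNonlin s) p :=
  ((contDiffAt_fderiv hs).clm_comp
    (contDiffAt_const (c := ContinuousLinearMap.inr ℝ E E))).const_smul (-(1 / 2 : ℝ))

theorem fderiv_locNonlin {p : E × E} (hs : ContDiffAt ℝ ∞ s p) (ζ : E × E) (a : E) :
    fderiv ℝ (locNonlin s) p ζ a = (-(1 / 2 : ℝ)) • fderiv ℝ (fderiv ℝ s) p ζ (0, a) := by
  have h1 := (contDiffAt_fderiv hs)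
  have h := differentiableAt_of_contDiffAt (contDiffAt_locNonlin hs)
  have h2 : fderiv ℝ (fun q => locNonlin s q a) p ζ = fderiv ℝ (locNonlin s) p ζ a := by
    rw [fderiv_clm_apply_apply h (differentiableAt_const a)]; simp
  have h3 : (fun q => locNonlin s q a) = fun q => (-(1 / 2 : ℝ)) • fderiv ℝ s q (0, a) := rfl
  rw [← h2, h3, fderiv_fun_const_smul
    ((differentiableAt_of_contDiffAt h1).clm_apply (differentiableAt_const _))]
  rw [smul_apply, fderiv_clm_apply_apply (differentiableAt_of_contDiffAt h1)
    (differentiableAt_const _)]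
  simp

theorem locChris_eq {p : E × E} (hs : ContDiffAt ℝ ∞ s p) (a c : E) :
    locChris s p a c = (-(1 / 2 : ℝ)) • fderiv ℝ (fderiv ℝ s) p (0, c) (0, a) :=
  fderiv_locNonlin hs _ _

theorem locChris_symm {p : E × E} (hs : ContDiffAt ℝ ∞ s p) (a c : E) :
    locChris s p a c = locChris s p c a := by
  rw [locChris_eq hs, locChris_eq hs, second_fderiv_symm hs]

theorem locMetric_symm {p : E × E} (hL : ContDiffAt ℝ ∞ L p) (u v : E) :
    locMetric L p u v = locMetric L p v u :=
  second_fderiv_symm hL _ _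

/-- Symmetry of the second derivative holds on all of `Ω`, so it may be differentiated once more. -/
theorem third_fderiv_symm_right {H : Type*} [NormedAddCommGroup H] [NormedSpace ℝ H] {f : H → G}
    {Ω : Set H} (hΩ : IsOpen Ω) (hf : ∀ q ∈ Ω, ContDiffAt ℝ ∞ f q) {p : H} (hp : p ∈ Ω)
    (ζ ξ η : H) :
    fderiv ℝ (fderiv ℝ (fderiv ℝ f)) p ζ ξ η = fderiv ℝ (fderiv ℝ (fderiv ℝ f)) p ζ η ξ := by
  have key : ∀ a b : H, fderiv ℝ (fun q => fderiv ℝ (fderiv ℝ f) q a b) p ζ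
      = fderiv ℝ (fderiv ℝ (fderiv ℝ f)) p ζ a b := by
    intro a b
    have h2 := differentiableAt_of_contDiffAt (contDiffAt_fderiv (contDiffAt_fderiv (hf p hp)))
    rw [fderiv_clm_apply_apply (h2.clm_apply (differentiableAt_const _)) (differentiableAt_const _),
      fderiv_clm_apply_apply h2 (differentiableAt_const _)]
    simp
  rw [← key, ← key, fderiv_eq_of_eqOn hΩ (fun q hq => second_fderiv_symm (hf q hq) ξ η) hp]


theorem fderiv_locMetric {p : E × E} (hL : ContDiffAt ℝ ∞ L p) (u v : E) (ζ : E × E) :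
    fderiv ℝ (fun q => locMetric L q u v) p ζ
      = fderiv ℝ (fderiv ℝ (fderiv ℝ L)) p ζ (0, u) (0, v) := by
  have h2 := differentiableAt_of_contDiffAt (contDiffAt_fderiv (contDiffAt_fderiv hL))
  simp only [locMetric_apply]
  rw [fderiv_clm_apply_apply (h2.clm_apply (differentiableAt_const _)) (differentiableAt_const _),
    fderiv_clm_apply_apply h2 (differentiableAt_const _)]
  simp

theorem contDiffAt_locMetric_apply {p : E × E} (hL : ContDiffAt ℝ ∞ L p) (u v : E) :
    ContDiffAt ℝ ∞ (fun q => locMetric L q u v) p := by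
  have h2 := contDiffAt_fderiv (contDiffAt_fderiv hL)
  exact (h2.clm_apply contDiffAt_const).clm_apply contDiffAt_const

theorem contDiffAt_locCartan {p : E × E} (hL : ContDiffAt ℝ ∞ L p) {u v : E × E → E}
    (hu : ContDiffAt ℝ ∞ u p) (hv : ContDiffAt ℝ ∞ v p) :
    ContDiffAt ℝ ∞ (fun q => locCartan L q (u q) (v q)) p := by
  have h3 := contDiffAt_fderiv (contDiffAt_fderiv (contDiffAt_fderiv hL))
  exact (((h3.clm_apply (contDiffAt_const.prodMk hu)).clm_apply
    (contDiffAt_const.prodMk hv)).clm_comp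
    (contDiffAt_const (c := ContinuousLinearMap.inr ℝ E E))).const_smul (1 / 2 : ℝ)

theorem locCartan_eq_fderiv {p : E × E} (hL : ContDiffAt ℝ ∞ L p) (z u v : E) :
    locCartan L p z u v = 1 / 2 * fderiv ℝ (fun q => locMetric L q u v) p (0, z) := by
  rw [fderiv_locMetric hL, locCartan_apply]

namespace IsLocalLagrangian

/-- Euler's relation differentiated along `ξ`. For `ξ` in the base direction it says that base
derivatives of `L` are again 2-homogeneous; for `ξ` in the fibre it gives `g(u, y) = ∂_u L`. -/
theorem fderiv_euler (h : IsLocalLagrangian Ω L) {p : E × E} (hp : p ∈ Ω) (ξ : E × E) :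
    fderiv ℝ (fderiv ℝ L) p ξ (0, p.2) + fderiv ℝ L p (0, ξ.2) = 2 * fderiv ℝ L p ξ := by
  have h1 := differentiableAt_of_contDiffAt (contDiffAt_fderiv (h.contDiffAt_lagrangian p hp))
  have h0 := differentiableAt_of_contDiffAt (h.contDiffAt_lagrangian p hp)
  have := congrArg (fun T => T ξ) (fderiv_eq_of_eqOn h.isOpen h.euler hp)
  rw [fderiv_clm_apply_apply h1 (differentiableAt_vertical_snd p), fderiv_vertical_snd,
    fderiv_const_mul h0] at this
  simpa using this

theorem fderiv_fderiv_fst_snd (h : IsLocalLagrangian Ω L) {p : E × E} (hp : p ∈ Ω) (u : E) :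
    fderiv ℝ (fderiv ℝ L) p (u, 0) (0, p.2) = 2 * fderiv ℝ L p (u, 0) := by
  have := h.fderiv_euler hp (u, 0)
  simpa [show ((0 : E), (0 : E)) = 0 from rfl] using this

theorem locMetric_snd (h : IsLocalLagrangian Ω L) {p : E × E} (hp : p ∈ Ω) (u : E) :
    locMetric L p u p.2 = fderiv ℝ L p (0, u) := by
  have := h.fderiv_euler hp (0, u)
  rw [locMetric_apply]
  linarith

theorem eq_of_locMetric_eq (h : IsLocalLagrangian Ω L) {p : E × E} (hp : p ∈ Ω) {a b : E}
    (hab : ∀ u, locMetric L p a u = locMetric L p b u) : a = b := by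
  by_contra hne
  have := h.posDef p hp (a - b) (sub_ne_zero.2 hne)
  have e : ∀ u, locMetric L p (a - b) u = locMetric L p a u - locMetric L p b u := by
    intro u
    rw [locMetric_apply, locMetric_apply, locMetric_apply, ← sub_apply, ← map_sub]
    simp
  rw [e, hab, sub_self] at this
  exact lt_irrefl _ this

end IsLocalLagrangian

/-! ### Identities for a spray: homogeneity, derivative of the metric, symmetries of `C` and `C'`.
-/

namespace IsLocalSpray

/-- The derivative of `g(u, y) = ∂_u L`. -/
theorem fderiv_locMetric_snd (h : IsLocalSpray Ω L s) {p : E × E} (hp : p ∈ Ω) (u : E)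
    (ζ : E × E) :
    fderiv ℝ (fun q => locMetric L q u p.2) p ζ + locMetric L p u ζ.2
      = fderiv ℝ (fderiv ℝ L) p ζ (0, u) := by
  have hL := h.contDiffAt_lagrangian p hp
  have h1 := contDiffAt_fderiv hL
  have h2 := differentiableAt_of_contDiffAt (contDiffAt_fderiv h1)
  have := congrArg (fun T => T ζ) (fderiv_eq_of_eqOn h.isOpen
    (fun q hq => h.locMetric_snd hq u) hp)
  simp only [locMetric_apply] at this
  rw [fderiv_clm_apply_apply (h2.clm_apply (differentiableAt_const _))
    (differentiableAt_vertical_snd p), fderiv_vertical_snd,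
    fderiv_clm_apply_apply h2 (differentiableAt_const _),
    fderiv_clm_apply_apply (differentiableAt_of_contDiffAt h1) (differentiableAt_const _)] at this
  rw [fderiv_locMetric hL, locMetric_apply]
  simpa using this

theorem locCartan_symm_right (h : IsLocalSpray Ω L s) {p : E × E} (hp : p ∈ Ω) (u v z : E) :
    locCartan L p u v z = locCartan L p u z v := by
  rw [locCartan_apply, locCartan_apply,
    third_fderiv_symm_right h.isOpen h.contDiffAt_lagrangian hp]

theorem locCartan_symm_left (h : IsLocalSpray Ω L s) {p : E × E} (hp : p ∈ Ω) (u v z : E) :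
    locCartan L p u v z = locCartan L p v u z := by
  rw [locCartan_apply, locCartan_apply,
    second_fderiv_symm (contDiffAt_fderiv (h.contDiffAt_lagrangian p hp))]

/-- Differentiating `g(v, y) = ∂_v L` along the fibre, the term from the moving `y` already accounts
for the right-hand side, so `∂_u g(v, ·)` vanishes on `y`. -/
theorem locCartan_snd (h : IsLocalSpray Ω L s) {p : E × E} (hp : p ∈ Ω) (u v : E) :
    locCartan L p u v p.2 = 0 := by
  have hL := h.contDiffAt_lagrangian p hp
  have := h.fderiv_locMetric_snd hp v (0, u)
  rw [locCartan_eq_fderiv hL]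
  rw [locMetric_symm hL, locMetric_apply] at this
  linarith

/-- This is the bracket of the constant vertical field `v` with the spray. It is the source of every
`N` obtained by differentiating an identity along the spray. -/
theorem fderiv_spray_field (h : IsLocalSpray Ω L s) {p : E × E} (hp : p ∈ Ω) (v : E) :
    fderiv ℝ (fun q : E × E => (q.2, s q)) p (0, v) = (v, (-2 : ℝ) • locNonlin s p v) := by
  have hs := differentiableAt_of_contDiffAt (h.contDiffAt_spray p hp)
  have := (hasFDerivAt_snd (𝕜 := ℝ) (p := p)).prodMk hs.hasFDerivAt
  rw [this.fderiv, locNonlin_apply, smul_smul]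
  norm_num

theorem contDiffAt_spray_field (h : IsLocalSpray Ω L s) {p : E × E} (hp : p ∈ Ω) :
    ContDiffAt ℝ ∞ (fun q : E × E => (q.2, s q)) p :=
  contDiffAt_snd.prodMk (h.contDiffAt_spray p hp)

/-- The fibre derivative of the Euler-Lagrange equation. -/
theorem fderiv_spray (h : IsLocalSpray Ω L s) {p : E × E} (hp : p ∈ Ω) (u v : E) :
    fderiv ℝ (fun q => locMetric L q u v) p (p.2, s p) + fderiv ℝ (fderiv ℝ L) p (v, 0) (0, u)
      - 2 * locMetric L p (locNonlin s p v) u = fderiv ℝ (fderiv ℝ L) p (0, v) (u, 0) := by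
  have hL := h.contDiffAt_lagrangian p hp
  have h1 := contDiffAt_fderiv hL
  have h2 := differentiableAt_of_contDiffAt (contDiffAt_fderiv h1)
  have hS := differentiableAt_of_contDiffAt (h.contDiffAt_spray_field hp)
  have := congrArg (fun T => T (0, v)) (fderiv_eq_of_eqOn h.isOpen
    (fun q hq => h.spray q hq u) hp)
  rw [fderiv_clm_apply_apply (h2.clm_apply hS) (differentiableAt_const _),
    fderiv_clm_apply_apply h2 hS, h.fderiv_spray_field hp,
    fderiv_clm_apply_apply (differentiableAt_of_contDiffAt h1) (differentiableAt_const _)] at this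
  -- The base part produces a mixed second derivative of `L`, the fibre part the metric term `-2 g(N
  -- v, u)`.
  have e : ((v, (-2 : ℝ) • locNonlin s p v) : E × E) =
    (v, 0) + (-2 : ℝ) • ((0 : E), locNonlin s p v) := by simp
  rw [e, map_add, map_smul] at this
  rw [fderiv_locMetric hL, locMetric_apply]
  rw [second_fderiv_symm h1] at this
  simp only [add_apply, smul_apply, fderiv_fun_const, Pi.zero_apply, zero_apply, map_zero,
    add_zero, smul_eq_mul] at this
  rw [third_fderiv_symm_right h.isOpen h.contDiffAt_lagrangian hp]
  linarith

/-- The covariant derivative of the metric along the spray vanishes. -/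
theorem fderiv_locMetric_spray (h : IsLocalSpray Ω L s) {p : E × E} (hp : p ∈ Ω) (u v : E) :
    fderiv ℝ (fun q => locMetric L q u v) p (p.2, s p)
      = locMetric L p (locNonlin s p u) v + locMetric L p u (locNonlin s p v) := by
  have hL := h.contDiffAt_lagrangian p hp
  -- The mixed base-fibre derivatives of `L` are skew under exchange of `u` and `v`, so they cancel
  -- when the two instances are added.
  have e1 := h.fderiv_spray hp u v
  have e2 := h.fderiv_spray hp v u
  have e3 : fderiv ℝ (fun q => locMetric L q v u) p = fderiv ℝ (fun q => locMetric L q u v) p :=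
    fderiv_eq_of_eqOn h.isOpen (fun q hq => locMetric_symm (h.contDiffAt_lagrangian q hq) v u) hp
  rw [e3] at e2
  have e4 := second_fderiv_symm hL (v, 0) (0, u)
  have e5 := second_fderiv_symm hL (u, 0) (0, v)
  have e6 := locMetric_symm hL u (locNonlin s p v)
  linarith

/-- This is Euler's relation `∂_y s = 2 s`. The 2-homogeneity of the spray is inherited from `L`:
compare the Euler-Lagrange equation with its own fibre derivative in the direction `y`, and use
nondegeneracy of `g`. -/
theorem locNonlin_snd (h : IsLocalSpray Ω L s) {p : E × E} (hp : p ∈ Ω) :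
    locNonlin s p p.2 = -s p := by
  refine h.eq_of_locMetric_eq hp fun u => ?_
  have hL := h.contDiffAt_lagrangian p hp
  have e1 := h.fderiv_spray hp u p.2
  have e2 := h.fderiv_locMetric_snd hp u (p.2, s p)
  rw [h.spray p hp] at e2
  have e3 := second_fderiv_symm hL (0, p.2) (u, 0)
  rw [h.fderiv_fderiv_fst_snd hp] at e3
  have e4 := h.spray p hp u
  have e5 : ((p.2, s p) : E × E) = (p.2, 0) + (0, s p) := by simp
  rw [e5, map_add, add_apply, ← locMetric_apply] at e4
  have e6 : locMetric L p (-s p) u = - locMetric L p (s p) u := by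
    rw [locMetric_apply, locMetric_apply, ← neg_apply, ← map_neg]
    simp
  rw [e6]
  have e7 := locMetric_symm hL u (s p)
  simp only at e2
  linarith

/-- The fibre derivative of `N y = -s` reads `Γ(y, v) + N v = 2 N v`. This is what turns `∇*_X C`
into the vertical part of `X`, and the Christoffel term of `D^W_W` into `N`. -/
theorem locChris_snd (h : IsLocalSpray Ω L s) {p : E × E} (hp : p ∈ Ω) (v : E) :
    locChris s p p.2 v = locNonlin s p v := by
  have hs := h.contDiffAt_spray p hp
  have := congrArg (fun T => T (0, v)) (fderiv_eq_of_eqOn h.isOpen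
    (fun q hq => h.locNonlin_snd hq) hp)
  rw [fderiv_clm_apply_apply (differentiableAt_of_contDiffAt (contDiffAt_locNonlin hs))
    differentiableAt_snd, fderiv_snd] at this
  have e : fderiv ℝ (fun q => -s q) p (0, v) = (2 : ℝ) • locNonlin s p v := by
    rw [fderiv_fun_neg, neg_apply, locNonlin_apply, smul_smul]
    norm_num
  rw [e, two_smul] at this
  exact add_right_cancel this

theorem locChris_snd_right (h : IsLocalSpray Ω L s) {p : E × E} (hp : p ∈ Ω) (v : E) :
    locChris s p v p.2 = locNonlin s p v := by
  rw [locChris_symm (h.contDiffAt_spray p hp), h.locChris_snd hp]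

theorem fderiv_locCartan_apply (h : IsLocalSpray Ω L s) {p : E × E} (hp : p ∈ Ω) (u v z : E)
    (ζ : E × E) :
    fderiv ℝ (fun q => locCartan L q u v) p ζ z
      = fderiv ℝ (fun q => locCartan L q u v z) p ζ := by
  rw [fderiv_clm_apply_apply (differentiableAt_of_contDiffAt (contDiffAt_locCartan
    (h.contDiffAt_lagrangian p hp) contDiffAt_const contDiffAt_const)) (differentiableAt_const _)]
  simp

/-- Exchange the two derivatives and use that the fibre derivative of the metric is `2 C`. -/
theorem fderiv_fderiv_locMetric (h : IsLocalSpray Ω L s) {p : E × E} (hp : p ∈ Ω) (z u v : E) :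
    fderiv ℝ (fderiv ℝ (fun q => locMetric L q u v)) p (0, z) (p.2, s p)
      = 2 * fderiv ℝ (fun q => locCartan L q z u) p (p.2, s p) v := by
  have hL := h.contDiffAt_lagrangian p hp
  have hm := contDiffAt_locMetric_apply hL u v
  rw [h.fderiv_locCartan_apply hp, second_fderiv_symm hm]
  have e : ∀ q ∈ Ω, fderiv ℝ (fun q => locMetric L q u v) q (0, z) = 2 * locCartan L q z u v := by
    intro q hq
    rw [locCartan_eq_fderiv (h.contDiffAt_lagrangian q hq)]
    ring
  have := congrArg (fun T => T (p.2, s p)) (fderiv_eq_of_eqOn h.isOpen e hp)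
  have hc := differentiableAt_of_contDiffAt ((contDiffAt_locCartan
    hL (contDiffAt_const (c := z)) (contDiffAt_const (c := u))).clm_apply
      (contDiffAt_const (c := v)))
  rw [fderiv_clm_apply_apply (differentiableAt_of_contDiffAt (contDiffAt_fderiv hm))
    (differentiableAt_const _), fderiv_const_mul hc] at this
  simpa using this

theorem fderiv_locMetric_locNonlin (h : IsLocalSpray Ω L s) {p : E × E} (hp : p ∈ Ω)
    (z u v : E) :
    fderiv ℝ (fun q => locMetric L q v (locNonlin s q u)) p (0, z)
      = 2 * locCartan L p z v (locNonlin s p u) + locMetric L p v (locChris s p u z) := by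
  have hL := h.contDiffAt_lagrangian p hp
  have h2 := contDiffAt_fderiv (contDiffAt_fderiv hL)
  have hN := differentiableAt_of_contDiffAt (contDiffAt_locNonlin (h.contDiffAt_spray p hp))
  have hNu := hN.clm_apply (differentiableAt_const u)
  have h3 : DifferentiableAt ℝ (fun q => ((0 : E), locNonlin s q u)) p :=
    (differentiableAt_const 0).prodMk hNu
  have e3 : fderiv ℝ (fun q => ((0 : E), locNonlin s q u)) p (0, z)
      = (0, locChris s p u z) := by
    rw [((hasFDerivAt_const (0 : E) p).prodMk hNu.hasFDerivAt).fderiv]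
    simp only [ContinuousLinearMap.prod_apply, zero_apply, Prod.mk.injEq, true_and]
    rw [fderiv_clm_apply_apply hN (differentiableAt_const _)]
    simp [locChris]
  simp only [locMetric_apply]
  rw [fderiv_clm_apply_apply (differentiableAt_of_contDiffAt (h2.clm_apply contDiffAt_const)) h3,
    fderiv_clm_apply_apply (differentiableAt_of_contDiffAt h2) (differentiableAt_const _), e3,
    locCartan_apply]
  simp

/-- The covariant derivative of the metric with respect to the Berwald connection. -/
theorem fderiv_locMetric_eq (h : IsLocalSpray Ω L s) {p : E × E} (hp : p ∈ Ω) (ξ : E × E)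
    (u v : E) :
    fderiv ℝ (fun q => locMetric L q u v) p ξ
      = locMetric L p (locChris s p ξ.1 u) v + locMetric L p u (locChris s p ξ.1 v)
        + 2 * locCartan L p (ξ.2 + locNonlin s p ξ.1) u v - 2 * locLandsberg L s p ξ.1 u v := by
  obtain ⟨z, b⟩ := ξ
  have hL := h.contDiffAt_lagrangian p hp
  have hs := h.contDiffAt_spray p hp
  have hS := differentiableAt_of_contDiffAt (h.contDiffAt_spray_field hp)
  have hm := contDiffAt_locMetric_apply hL u v
  have hm1 := differentiableAt_of_contDiffAt (contDiffAt_fderiv hm)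
  -- Parallelism of the metric along the spray, now to be differentiated in the fibre direction `z`.
  have e : ∀ q ∈ Ω, fderiv ℝ (fun q => locMetric L q u v) q (q.2, s q)
      = locMetric L q v (locNonlin s q u) + locMetric L q u (locNonlin s q v) := by
    intro q hq
    rw [h.fderiv_locMetric_spray hq, locMetric_symm (h.contDiffAt_lagrangian q hq) v]
  have hd : ∀ u v, DifferentiableAt ℝ (fun q => locMetric L q v (locNonlin s q u)) p := fun u v =>
    (((differentiableAt_of_contDiffAt (contDiffAt_fderiv (contDiffAt_fderiv hL))).clm_apply
      (differentiableAt_const _)).clm_apply ((differentiableAt_const 0).prodMk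
        ((differentiableAt_of_contDiffAt (contDiffAt_locNonlin hs)).clm_apply
          (differentiableAt_const u))))
  have e1 := congrArg (fun T => T (0, z)) (fderiv_eq_of_eqOn h.isOpen e hp)
  rw [fderiv_clm_apply_apply hm1 hS, h.fderiv_fderiv_locMetric hp, h.fderiv_spray_field hp,
    fderiv_fun_add (hd u v) (hd v u), add_apply, h.fderiv_locMetric_locNonlin hp,
    h.fderiv_locMetric_locNonlin hp] at e1
  -- The bracket of `∂_z` with the spray is `ξ`, minus the vertical part of `ξ`, minus one more `N
  -- z`. The last term is the `N`-correction in the third slot of `C'`.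
  have e2 : ((z, (-2 : ℝ) • locNonlin s p z) : E × E)
      = (z, b) - (0, b + locNonlin s p z) - (0, locNonlin s p z) := by
    ext
    · simp
    · simp only [Prod.snd_sub]; module
  have e3 := locCartan_eq_fderiv hL (b + locNonlin s p z) u v
  have e4 := locCartan_eq_fderiv hL (locNonlin s p z) u v
  rw [e2, map_sub, map_sub] at e1
  have e5 := locChris_symm hs u z
  have e6 := locChris_symm hs v z
  have e7 := locMetric_symm hL v (locChris s p z u)
  have e8 := h.locCartan_symm_right hp z v (locNonlin s p u)
  rw [e5, e6] at e1
  rw [locLandsberg_apply]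
  linarith

theorem locLandsberg_symm_left (h : IsLocalSpray Ω L s) {p : E × E} (hp : p ∈ Ω) (u v z : E) :
    locLandsberg L s p u v z = locLandsberg L s p v u z := by
  rw [locLandsberg_apply, locLandsberg_apply, h.locCartan_symm_left hp u v,
    h.locCartan_symm_left hp (locNonlin s p u) v, h.locCartan_symm_left hp (locNonlin s p v) u,
    h.fderiv_locCartan_apply hp, h.fderiv_locCartan_apply hp,
    fderiv_eq_of_eqOn h.isOpen (fun q hq => h.locCartan_symm_left hq u v z) hp]
  ring

theorem locLandsberg_symm_right (h : IsLocalSpray Ω L s) {p : E × E} (hp : p ∈ Ω) (u v z : E) :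
    locLandsberg L s p u v z = locLandsberg L s p u z v := by
  rw [locLandsberg_apply, locLandsberg_apply, h.locCartan_symm_right hp (locNonlin s p u) v,
    h.locCartan_symm_right hp u (locNonlin s p v), h.locCartan_symm_right hp u v,
    h.fderiv_locCartan_apply hp, h.fderiv_locCartan_apply hp,
    fderiv_eq_of_eqOn h.isOpen (fun q hq => h.locCartan_symm_right hq u v z) hp]
  ring

/-- Differentiate `C(u, v, y) = 0` along the spray. The term `C(u, v, s)` from the moving `y`
cancels the correction `C(u, v, N y)`, since `N y = -s`. -/
theorem locLandsberg_snd (h : IsLocalSpray Ω L s) {p : E × E} (hp : p ∈ Ω) (u v : E) :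
    locLandsberg L s p u v p.2 = 0 := by
  have hc := differentiableAt_of_contDiffAt (contDiffAt_locCartan
    (h.contDiffAt_lagrangian p hp) (contDiffAt_const (c := u)) (contDiffAt_const (c := v)))
  have := congrArg (fun T => T (p.2, s p)) (fderiv_eq_of_eqOn h.isOpen
    (fun q hq => h.locCartan_snd hq u v) hp)
  rw [fderiv_clm_apply_apply hc differentiableAt_snd, fderiv_snd] at this
  rw [locLandsberg_apply, h.locCartan_snd hp, h.locCartan_snd hp, h.locNonlin_snd hp, map_neg]
  simp at this
  linarith

end IsLocalSpray

end LocalCalculus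

/-! ### Multilinearity and smoothness of the local tensors; the difference tensor. -/

section LocalTensors

variable {E : Type*} [NormedAddCommGroup E] [NormedSpace ℝ E]
  {H : Type*} [NormedAddCommGroup H] [NormedSpace ℝ H]
  {Ω : Set (E × E)} {L : E × E → ℝ} {s : E × E → E}

theorem locCartan_add_left (p : E × E) (u u' v : E) :
    locCartan L p (u + u') v = locCartan L p u v + locCartan L p u' v := by
  ext z
  simp only [locCartan_apply, add_apply]
  rw [show ((0 : E), u + u') = (0, u) + (0, u') by simp, ContinuousLinearMap.map_add,
    add_apply, add_apply]
  ring

theorem locCartan_smul_left (p : E × E) (c : ℝ) (u v : E) :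
    locCartan L p (c • u) v = c • locCartan L p u v := by
  ext z
  simp only [locCartan_apply, smul_apply, smul_eq_mul]
  rw [show ((0 : E), c • u) = c • (0, u) by simp, ContinuousLinearMap.map_smul, smul_apply,
    smul_apply, smul_eq_mul]
  ring

theorem locCartan_add_right (p : E × E) (u v v' : E) :
    locCartan L p u (v + v') = locCartan L p u v + locCartan L p u v' := by
  ext z
  simp only [locCartan_apply, add_apply]
  rw [show ((0 : E), v + v') = (0, v) + (0, v') by simp, map_add, add_apply]
  ring

theorem locCartan_smul_right (p : E × E) (c : ℝ) (u v : E) :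
    locCartan L p u (c • v) = c • locCartan L p u v := by
  ext z
  simp only [locCartan_apply, smul_apply, smul_eq_mul]
  rw [show ((0 : E), c • v) = c • (0, v) by simp, map_smul, smul_apply, smul_eq_mul]
  ring

theorem contDiffAt_locCartan_comp {x : H} {b : H → E × E} {u v : H → E}
    (hL : ContDiffAt ℝ ∞ L (b x)) (hb : ContDiffAt ℝ ∞ b x)
    (hu : ContDiffAt ℝ ∞ u x) (hv : ContDiffAt ℝ ∞ v x) :
    ContDiffAt ℝ ∞ (fun q => locCartan L (b q) (u q) (v q)) x := by
  have h3 := (contDiffAt_fderiv (contDiffAt_fderiv (contDiffAt_fderiv hL))).comp x hb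
  exact (((h3.clm_apply (contDiffAt_const.prodMk hu)).clm_apply
    (contDiffAt_const.prodMk hv)).clm_comp
    (contDiffAt_const (c := ContinuousLinearMap.inr ℝ E E))).const_smul (1 / 2 : ℝ)

theorem contDiffAt_locLandsberg {p : E × E} (hL : ContDiffAt ℝ ∞ L p) (hs : ContDiffAt ℝ ∞ s p)
    {u v : E × E → E} (hu : ContDiffAt ℝ ∞ u p) (hv : ContDiffAt ℝ ∞ v p) :
    ContDiffAt ℝ ∞ (fun q => locLandsberg L s q (u q) (v q)) p := by
  have hN := contDiffAt_locNonlin hs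
  have h1 : ContDiffAt ℝ ∞
      (fun q => fderiv ℝ (fun q' => locCartan L q' (u q) (v q)) q (q.2, s q)) p := by
    refine ContDiffAt.clm_apply ?_ (contDiffAt_snd.prodMk hs)
    -- The vectors `u q` and `v q` are frozen while the base point `q'` is differentiated, so joint
    -- smoothness in the pair `(q, q')` is needed.
    refine ContDiffAt.fderiv (n := ∞) (f := fun q q' => locCartan L q' (u q) (v q)) (g := id)
      ?_ contDiffAt_id le_rfl
    exact contDiffAt_locCartan_comp (x := (p, p)) (b := Prod.snd) (u := fun z => u z.1)
      (v := fun z => v z.1) hL contDiffAt_snd (hu.comp (p, p) contDiffAt_fst)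
        (hv.comp (p, p) contDiffAt_fst)
  exact ((h1.sub (contDiffAt_locCartan hL (hN.clm_apply hu) hv)).sub
    (contDiffAt_locCartan hL hu (hN.clm_apply hv))).sub ((contDiffAt_locCartan hL hu hv).clm_comp hN)

theorem contDiffAt_locChris {p : E × E} (hs : ContDiffAt ℝ ∞ s p)
    {u v : E × E → E} (hu : ContDiffAt ℝ ∞ u p) (hv : ContDiffAt ℝ ∞ v p) :
    ContDiffAt ℝ ∞ (fun q => locChris s q (u q) (v q)) p :=
  ((contDiffAt_fderiv (contDiffAt_locNonlin hs)).clm_apply (contDiffAt_const.prodMk hv)).clm_apply hu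

theorem locChris_add_left (p : E × E) (a a' c : E) :
    locChris s p (a + a') c = locChris s p a c + locChris s p a' c :=
  map_add _ _ _

theorem locChris_smul_left (p : E × E) (r : ℝ) (a c : E) :
    locChris s p (r • a) c = r • locChris s p a c :=
  map_smul _ _ _

theorem locChris_add_right (p : E × E) (a c c' : E) :
    locChris s p a (c + c') = locChris s p a c + locChris s p a c' := by
  unfold locChris
  rw [show ((0 : E), c + c') = (0, c) + (0, c') by simp, map_add, add_apply]

theorem locChris_smul_right (p : E × E) (r : ℝ) (a c : E) :
    locChris s p a (r • c) = r • locChris s p a c := by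
  unfold locChris
  rw [show ((0 : E), r • c) = r • (0, c) by simp, map_smul, smul_apply]

/-- Only the last slot is linear by construction; total symmetry carries linearity over to the other
two. -/
theorem IsLocalSpray.locLandsberg_add_right (h : IsLocalSpray Ω L s) {p : E × E} (hp : p ∈ Ω)
    (u v v' : E) :
    locLandsberg L s p u (v + v') = locLandsberg L s p u v + locLandsberg L s p u v' := by
  ext z
  rw [add_apply, h.locLandsberg_symm_right hp, h.locLandsberg_symm_right hp u v,
    h.locLandsberg_symm_right hp u v', map_add]

theorem IsLocalSpray.locLandsberg_smul_right (h : IsLocalSpray Ω L s) {p : E × E} (hp : p ∈ Ω)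
    (r : ℝ) (u v : E) :
    locLandsberg L s p u (r • v) = r • locLandsberg L s p u v := by
  ext z
  rw [smul_apply, h.locLandsberg_symm_right hp, h.locLandsberg_symm_right hp u v, map_smul]

theorem IsLocalSpray.locLandsberg_add_left (h : IsLocalSpray Ω L s) {p : E × E} (hp : p ∈ Ω)
    (u u' v : E) :
    locLandsberg L s p (u + u') v = locLandsberg L s p u v + locLandsberg L s p u' v := by
  ext z
  rw [add_apply, h.locLandsberg_symm_left hp, h.locLandsberg_symm_left hp u v,
    h.locLandsberg_symm_left hp u' v, h.locLandsberg_add_right hp, add_apply]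

theorem IsLocalSpray.locLandsberg_smul_left (h : IsLocalSpray Ω L s) {p : E × E} (hp : p ∈ Ω)
    (r : ℝ) (u v : E) :
    locLandsberg L s p (r • u) v = r • locLandsberg L s p u v := by
  ext z
  rw [smul_apply, h.locLandsberg_symm_left hp, h.locLandsberg_symm_left hp u v,
    h.locLandsberg_smul_right hp, smul_apply]

/-- The fibre Hessian as a linear map to the dual space. -/
def locFlat (L : E × E → ℝ) (p : E × E) : E →L[ℝ] E →L[ℝ] ℝ :=
  ((ContinuousLinearMap.compL ℝ E (E × E) ℝ).flip (ContinuousLinearMap.inr ℝ E E)).comp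
    ((fderiv ℝ (fderiv ℝ L) p).comp (ContinuousLinearMap.inr ℝ E E))

theorem locFlat_apply (p : E × E) (u : E) : locFlat L p u = locMetric L p u := rfl

theorem contDiffAt_locFlat {p : E × E} (hL : ContDiffAt ℝ ∞ L p) :
    ContDiffAt ℝ ∞ (locFlat L) p :=
  contDiffAt_const.clm_comp ((contDiffAt_fderiv (contDiffAt_fderiv hL)).clm_comp contDiffAt_const)

/-- The difference tensor of a connection and the Berwald connection. -/
def locTensor (κ μ : ℝ) (L : E × E → ℝ) (s : E × E → E) (p ξ : E × E) (c : E) : E :=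
  (locFlat L p).inverse (κ • locCartan L p (ξ.2 + locNonlin s p ξ.1) c
    + μ • locLandsberg L s p ξ.1 c)

namespace IsLocalSpray

variable {κ μ : ℝ}

theorem locTensor_add_left (h : IsLocalSpray Ω L s) {p : E × E} (hp : p ∈ Ω) (ξ η : E × E)
    (c : E) : locTensor κ μ L s p (ξ + η) c
      = locTensor κ μ L s p ξ c + locTensor κ μ L s p η c := by
  rw [locTensor, locTensor, locTensor, ← map_add]
  congr 1
  rw [Prod.fst_add, Prod.snd_add, map_add, add_add_add_comm, locCartan_add_left,
    h.locLandsberg_add_left hp]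
  module

theorem locTensor_smul_left (h : IsLocalSpray Ω L s) {p : E × E} (hp : p ∈ Ω) (r : ℝ) (ξ : E × E)
    (c : E) : locTensor κ μ L s p (r • ξ) c = r • locTensor κ μ L s p ξ c := by
  rw [locTensor, locTensor, ← map_smul]
  congr 1
  rw [Prod.smul_fst, Prod.smul_snd, map_smul, ← smul_add, locCartan_smul_left,
    h.locLandsberg_smul_left hp]
  module

theorem locTensor_add_right (h : IsLocalSpray Ω L s) {p : E × E} (hp : p ∈ Ω) (ξ : E × E)
    (c d : E) : locTensor κ μ L s p ξ (c + d)
      = locTensor κ μ L s p ξ c + locTensor κ μ L s p ξ d := by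
  rw [locTensor, locTensor, locTensor, ← map_add]
  congr 1
  rw [locCartan_add_right, h.locLandsberg_add_right hp]
  module

theorem locTensor_smul_right (h : IsLocalSpray Ω L s) {p : E × E} (hp : p ∈ Ω) (r : ℝ) (ξ : E × E)
    (c : E) : locTensor κ μ L s p ξ (r • c) = r • locTensor κ μ L s p ξ c := by
  rw [locTensor, locTensor, ← map_smul]
  congr 1
  rw [locCartan_smul_right, h.locLandsberg_smul_right hp]
  module

/-- For horizontal vectors, the difference tensor is symmetric. -/
theorem locTensor_symm (h : IsLocalSpray Ω L s) {p : E × E} (hp : p ∈ Ω) {ξ η : E × E}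
    (hξ : κ = 0 ∨ ξ.2 + locNonlin s p ξ.1 = 0) (hη : κ = 0 ∨ η.2 + locNonlin s p η.1 = 0) :
    locTensor κ μ L s p ξ η.1 = locTensor κ μ L s p η ξ.1 := by
  have h0 : ∀ c, locCartan L p 0 c = 0 := fun c => by
    simpa using locCartan_smul_left (L := L) p 0 0 c
  have key : ∀ (ξ : E × E) (c : E), (κ = 0 ∨ ξ.2 + locNonlin s p ξ.1 = 0) →
      κ • locCartan L p (ξ.2 + locNonlin s p ξ.1) c = 0 := by
    rintro ξ c (h1 | h1)
    · rw [h1, zero_smul]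
    · rw [h1, h0, smul_zero]
  rw [locTensor, locTensor, key ξ _ hξ, key η _ hη]
  congr 3
  ext z
  exact h.locLandsberg_symm_left hp _ _ _

variable [FiniteDimensional ℝ E]

/-- A definite form gives an injection of `E` into its dual, and the finite dimensions agree. -/
theorem exists_equiv (h : IsLocalSpray Ω L s) {p : E × E} (hp : p ∈ Ω) :
    ∃ e : E ≃L[ℝ] (E →L[ℝ] ℝ), (e : E →L[ℝ] E →L[ℝ] ℝ) = locFlat L p := by
  have hinj : Function.Injective (locFlat L p : E →ₗ[ℝ] E →L[ℝ] ℝ) := by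
    intro a b hab
    refine h.eq_of_locMetric_eq hp fun u => ?_
    exact congrArg (fun T : E →L[ℝ] ℝ => T u) hab
  have hdim : Module.finrank ℝ E = Module.finrank ℝ (E →L[ℝ] ℝ) := by
    rw [← (LinearMap.toContinuousLinearMap : (E →ₗ[ℝ] ℝ) ≃ₗ[ℝ] E →L[ℝ] ℝ).finrank_eq]
    exact (Subspace.dual_finrank_eq (K := ℝ) (V := E)).symm
  refine ⟨(LinearEquiv.ofInjectiveOfFinrankEq _ hinj hdim).toContinuousLinearEquiv, ?_⟩
  ext u v
  rfl

theorem locMetric_locTensor (h : IsLocalSpray Ω L s) {p : E × E} (hp : p ∈ Ω) (ξ : E × E)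
    (c z : E) :
    locMetric L p (locTensor κ μ L s p ξ c) z
      = κ * locCartan L p (ξ.2 + locNonlin s p ξ.1) c z + μ * locLandsberg L s p ξ.1 c z := by
  obtain ⟨e, he⟩ := h.exists_equiv hp
  rw [← locFlat_apply, locTensor, ← he, ContinuousLinearMap.inverse_equiv]
  simp

set_option synthInstance.maxHeartbeats 200000 in
theorem contDiffAt_locTensor (h : IsLocalSpray Ω L s) {p : E × E} (hp : p ∈ Ω)
    {X : E × E → E × E} {c : E × E → E} (hX : ContDiffAt ℝ ∞ X p) (hc : ContDiffAt ℝ ∞ c p) :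
    ContDiffAt ℝ ∞ (fun q => locTensor κ μ L s q (X q) (c q)) p := by
  have hL := h.contDiffAt_lagrangian p hp
  have hs := h.contDiffAt_spray p hp
  obtain ⟨e, he⟩ := h.exists_equiv hp
  -- Inversion of operators is smooth near an invertible one, so the inverse metric depends smoothly
  -- on the point.
  have h0 : ContDiffAt ℝ ∞ ContinuousLinearMap.inverse (locFlat L p) :=
    he ▸ contDiffAt_map_inverse e
  have h1 : ContDiffAt ℝ ∞ (fun q => (locFlat L q).inverse) p :=
    h0.comp p (contDiffAt_locFlat hL)
  refine h1.clm_apply (ContDiffAt.add (ContDiffAt.const_smul κ ?_) (ContDiffAt.const_smul μ ?_))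
  · exact contDiffAt_locCartan hL (hX.snd.add ((contDiffAt_locNonlin hs).clm_apply hX.fst)) hc
  · exact contDiffAt_locLandsberg hL hs hX.fst hc

/-- Both `C` and `C'` vanish on `y`. Hence adding this tensor does not change `∇_X C`, and the
modified connection is still a lift. -/
theorem locTensor_snd (h : IsLocalSpray Ω L s) {p : E × E} (hp : p ∈ Ω) (ξ : E × E) :
    locTensor κ μ L s p ξ p.2 = 0 := by
  refine h.eq_of_locMetric_eq hp fun u => ?_
  rw [h.locMetric_locTensor hp, h.locCartan_symm_right hp, h.locCartan_snd hp,
    h.locLandsberg_symm_right hp, h.locLandsberg_snd hp, ← locFlat_apply, map_zero]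
  simp

end IsLocalSpray

end LocalTensors

/-! ### Charts of `TM`, their differentials and local representatives. -/

section Charts

variable {E : Type*} [NormedAddCommGroup E] [NormedSpace ℝ E]
  {M : Type*} [TopologicalSpace M] [ChartedSpace E M] [IsManifold 𝓘(ℝ, E) ∞ M]

/-- The chart of `TM` induced by the chart of `M` at `x₀`. -/
def tchart (x₀ : M) : PartialEquiv (TM E M) (E × E) :=
  extChartAt 𝓘(ℝ, E).tangent (⟨x₀, 0⟩ : TM E M)

/-- The domain of the chart of `TM` induced by the chart of `M` at `x₀`. -/
def tdom (E : Type*) [NormedAddCommGroup E] [NormedSpace ℝ E] {M : Type*} [TopologicalSpace M]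
    [ChartedSpace E M] (x₀ : M) : Set (TM E M) :=
  {w | w.1 ∈ (chartAt E x₀).source}

/-- The differential of the chart at `x₀`. -/
def baseLoc (x₀ x : M) : TangM E x →L[ℝ] E :=
  (trivializationAt E (TangentSpace 𝓘(ℝ, E)) x₀).continuousLinearMapAt ℝ x

/-- The inverse of the differential of the chart at `x₀`. -/
def baseSymm (x₀ x : M) : E →L[ℝ] TangM E x :=
  (trivializationAt E (TangentSpace 𝓘(ℝ, E)) x₀).symmL ℝ x

/-- The differential of the chart of `TM`. -/
def toLoc (x₀ : M) (w : TM E M) : TTM w →L[ℝ] E × E :=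
  (trivializationAt (E × E) (TangentSpace 𝓘(ℝ, E).tangent) (⟨x₀, 0⟩ : TM E M)).continuousLinearMapAt
    ℝ w

/-- The inverse of the differential of the chart of `TM`. -/
def ofLoc (x₀ : M) (w : TM E M) : E × E →L[ℝ] TTM w :=
  (trivializationAt (E × E) (TangentSpace 𝓘(ℝ, E).tangent) (⟨x₀, 0⟩ : TM E M)).symmL ℝ w

theorem tchart_source (x₀ : M) : (tchart (E := E) x₀).source = tdom E x₀ := by
  ext w
  rw [tchart, extChartAt_source]
  simp [tdom]

theorem mem_tchart_target {x₀ : M} {p : E × E} :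
    p ∈ (tchart x₀).target ↔ p.1 ∈ (extChartAt 𝓘(ℝ, E) x₀).target := by
  rw [tchart, extChartAt_target, extChartAt_target]
  simp only [ModelWithCorners.range_eq_univ, inter_univ]
  exact TangentBundle.mem_chart_target_iff _ _

theorem isOpen_tchart_target (x₀ : M) : IsOpen (tchart (E := E) x₀).target :=
  isOpen_extChartAt_target _

theorem isOpen_tdom (x₀ : M) : IsOpen (tdom E x₀) := by
  rw [← tchart_source]; exact isOpen_extChartAt_source _

theorem tchart_mem_target {x₀ : M} {w : TM E M} (hw : w ∈ tdom E x₀) :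
    tchart x₀ w ∈ (tchart x₀).target :=
  (tchart x₀).map_source (by rwa [tchart_source])

theorem tchart_symm_tchart {x₀ : M} {w : TM E M} (hw : w ∈ tdom E x₀) :
    (tchart x₀).symm (tchart x₀ w) = w :=
  (tchart x₀).left_inv (by rwa [tchart_source])

theorem tchart_symm_mem {x₀ : M} {p : E × E} (hp : p ∈ (tchart x₀).target) :
    (tchart x₀).symm p ∈ tdom E x₀ := by
  rw [← tchart_source]; exact (tchart x₀).map_target hp

theorem tchart_tchart_symm {x₀ : M} {p : E × E} (hp : p ∈ (tchart x₀).target) :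
    tchart x₀ ((tchart x₀).symm p) = p :=
  (tchart x₀).right_inv hp

omit [IsManifold 𝓘(ℝ, E) ∞ M] in
theorem mem_tdom_self (w : TM E M) : w ∈ tdom E w.1 := mem_chart_source E w.1

theorem baseSymm_baseLoc {x₀ x : M} (hx : x ∈ (chartAt E x₀).source) (u : TangM E x) :
    baseSymm x₀ x (baseLoc x₀ x u) = u :=
  (trivializationAt E (TangentSpace 𝓘(ℝ, E)) x₀).symmL_continuousLinearMapAt hx u

theorem baseLoc_baseSymm {x₀ x : M} (hx : x ∈ (chartAt E x₀).source) (u : E) :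
    baseLoc x₀ x (baseSymm x₀ x u) = u :=
  (trivializationAt E (TangentSpace 𝓘(ℝ, E)) x₀).continuousLinearMapAt_symmL hx u

theorem mem_tdom_iff_baseSet {x₀ : M} {w : TM E M} : w ∈ tdom E x₀ ↔ w ∈
    (trivializationAt (E × E) (TangentSpace 𝓘(ℝ, E).tangent) (⟨x₀, 0⟩ : TM E M)).baseSet := by
  simp [tdom]

theorem ofLoc_toLoc {x₀ : M} {w : TM E M} (hw : w ∈ tdom E x₀) (ξ : TTM w) :
    ofLoc x₀ w (toLoc x₀ w ξ) = ξ :=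
  (trivializationAt (E × E) (TangentSpace 𝓘(ℝ, E).tangent)
    (⟨x₀, 0⟩ : TM E M)).symmL_continuousLinearMapAt (mem_tdom_iff_baseSet.1 hw) ξ

theorem toLoc_ofLoc {x₀ : M} {w : TM E M} (hw : w ∈ tdom E x₀) (ξ : E × E) :
    toLoc x₀ w (ofLoc x₀ w ξ) = ξ :=
  (trivializationAt (E × E) (TangentSpace 𝓘(ℝ, E).tangent)
    (⟨x₀, 0⟩ : TM E M)).continuousLinearMapAt_symmL (mem_tdom_iff_baseSet.1 hw) ξ

theorem toLoc_injective {x₀ : M} {w : TM E M} (hw : w ∈ tdom E x₀) {ξ η : TTM w}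
    (h : toLoc x₀ w ξ = toLoc x₀ w η) : ξ = η := by
  rw [← ofLoc_toLoc hw ξ, h, ofLoc_toLoc hw]

theorem baseLoc_injective {x₀ x : M} (hx : x ∈ (chartAt E x₀).source) {ξ η : TangM E x}
    (h : baseLoc x₀ x ξ = baseLoc x₀ x η) : ξ = η := by
  rw [← baseSymm_baseLoc hx ξ, h, baseSymm_baseLoc hx]

theorem baseLoc_eq {x₀ x : M} (hx : x ∈ (chartAt E x₀).source) :
    baseLoc x₀ x = mfderiv 𝓘(ℝ, E) 𝓘(ℝ, E) (extChartAt 𝓘(ℝ, E) x₀) x :=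
  TangentBundle.continuousLinearMapAt_trivializationAt hx

theorem toLoc_eq {x₀ : M} {w : TM E M} (hw : w ∈ tdom E x₀) :
    toLoc x₀ w = mfderiv 𝓘(ℝ, E).tangent 𝓘(ℝ, E × E) (tchart x₀) w :=
  TangentBundle.continuousLinearMapAt_trivializationAt
    (mem_tdom_iff_baseSet.1 hw)

theorem tchart_apply {x₀ : M} {w : TM E M} (hw : w ∈ tdom E x₀) :
    tchart x₀ w = (extChartAt 𝓘(ℝ, E) x₀ w.1, baseLoc x₀ w.1 w.2) := by
  have h : baseLoc x₀ w.1 w.2 = (trivializationAt E (TangentSpace 𝓘(ℝ, E)) x₀ w).2 := by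
    rw [baseLoc, Trivialization.continuousLinearMapAt_apply,
      Trivialization.coe_linearMapAt_of_mem _ hw]
  rw [h]
  rfl

theorem hasMFDerivAt_tchart {x₀ : M} {w : TM E M} (hw : w ∈ tdom E x₀) :
    HasMFDerivAt 𝓘(ℝ, E).tangent 𝓘(ℝ, E × E) (tchart x₀) w (toLoc x₀ w) := by
  rw [toLoc_eq hw]
  exact (mdifferentiableAt_extChartAt (mem_tdom_iff_baseSet.1 hw)).hasMFDerivAt

theorem hasMFDerivAt_baseChart {x₀ x : M} (hx : x ∈ (chartAt E x₀).source) :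
    HasMFDerivAt 𝓘(ℝ, E) 𝓘(ℝ, E) (extChartAt 𝓘(ℝ, E) x₀) x (baseLoc x₀ x) := by
  rw [baseLoc_eq hx]
  exact (mdifferentiableAt_extChartAt hx).hasMFDerivAt

theorem hasMFDerivAt_proj (w : TM E M) :
    HasMFDerivAt 𝓘(ℝ, E).tangent 𝓘(ℝ, E) (fun p : TM E M => p.1) w (dproj w) :=
  ((contMDiff_proj (n := 1) (TangentSpace 𝓘(ℝ, E) : M → Type _)).mdifferentiable
    one_ne_zero w).hasMFDerivAt

/-- The chart of `TM` followed by the first projection is the chart of `M` after `π`; differentiate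
both sides. -/
theorem baseLoc_dproj {x₀ : M} {w : TM E M} (hw : w ∈ tdom E x₀) (ξ : TTM w) :
    baseLoc x₀ w.1 (dproj w ξ) = (toLoc x₀ w ξ).1 := by
  have h1 := (hasMFDerivAt_baseChart (E := E) (x₀ := x₀) (x := w.1) hw).comp w
    (hasMFDerivAt_proj w)
  have h2 := (ContinuousLinearMap.hasMFDerivAt
    (ContinuousLinearMap.fst ℝ E E) (x := tchart x₀ w)).comp w (hasMFDerivAt_tchart hw)
  have h3 := hasMFDerivAt_unique h1 h2
  exact congrArg (fun T => T ξ) h3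

theorem tchart_add {x₀ : M} {w : TM E M} (hw : w ∈ tdom E x₀) (v : TangM E w.1) :
    tchart x₀ (⟨w.1, w.2 + v⟩ : TM E M) = tchart x₀ w + (0, baseLoc x₀ w.1 v) := by
  rw [tchart_apply hw, tchart_apply (w := (⟨w.1, w.2 + v⟩ : TM E M)) hw, map_add]
  simp

theorem mk_add_eq {x₀ : M} {w : TM E M} (hw : w ∈ tdom E x₀) (v : TangM E w.1) :
    (⟨w.1, w.2 + v⟩ : TM E M) = (tchart x₀).symm (tchart x₀ w + (0, baseLoc x₀ w.1 v)) := by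
  rw [← tchart_add hw, tchart_symm_tchart (w := (⟨w.1, w.2 + v⟩ : TM E M)) hw]

theorem contMDiffAt_tchart_symm {x₀ : M} {p : E × E} (hp : p ∈ (tchart x₀).target) :
    ContMDiffAt 𝓘(ℝ, E × E) 𝓘(ℝ, E).tangent ∞ (tchart (M := M) x₀).symm p :=
  (contMDiffOn_extChartAt_symm _).contMDiffAt ((isOpen_tchart_target x₀).mem_nhds hp)

theorem contMDiffAt_tchart {x₀ : M} {w : TM E M} (hw : w ∈ tdom E x₀) :
    ContMDiffAt 𝓘(ℝ, E).tangent 𝓘(ℝ, E × E) ∞ (tchart x₀) w :=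
  contMDiffAt_extChartAt' (mem_tdom_iff_baseSet.1 hw)

theorem hasMFDerivAt_tchart_symm {x₀ : M} {p : E × E} (hp : p ∈ (tchart x₀).target) :
    HasMFDerivAt 𝓘(ℝ, E × E) 𝓘(ℝ, E).tangent (tchart (M := M) x₀).symm p
      (ofLoc x₀ ((tchart x₀).symm p)) := by
  have h1 := ((contMDiffAt_tchart_symm (M := M) hp).mdifferentiableAt (by simp)).hasMFDerivAt
  have hw := tchart_symm_mem (M := M) hp
  have h2 := (hasMFDerivAt_tchart hw).comp p h1
  have h3 : HasMFDerivAt 𝓘(ℝ, E × E) 𝓘(ℝ, E × E)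
      (tchart x₀ ∘ (tchart (M := M) x₀).symm) p (ContinuousLinearMap.id ℝ (E × E)) := by
    refine (hasMFDerivAt_id (I := 𝓘(ℝ, E × E)) p).congr_of_eventuallyEq ?_
    filter_upwards [(isOpen_tchart_target x₀).mem_nhds hp] with q hq
    exact tchart_tchart_symm hq
  have h4 := hasMFDerivAt_unique h2 h3
  have h5 : mfderiv 𝓘(ℝ, E × E) 𝓘(ℝ, E).tangent (tchart (M := M) x₀).symm p
      = ofLoc x₀ ((tchart x₀).symm p) := by
    ext1 ξ
    refine toLoc_injective hw ?_
    exact (congrArg (fun T => T ξ) h4).trans (toLoc_ofLoc hw ξ).symm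
  rw [← h5]
  exact h1

/-- All the spaces `TTM w` unfold to `E × E`, so a coordinate vector can be moved between equal base
points that are not definitionally equal. -/
theorem toLoc_congr (x₀ : M) {w w' : TM E M} (h : w = w') (ξ : E × E) :
    toLoc x₀ w (show TTM w from ξ) = toLoc x₀ w' (show TTM w' from ξ) := by
  subst h; rfl

/-- In the chart the line `w + t u` is the affine line from the image of `w` in the direction `(0,
u)`. -/
theorem toLoc_vlift {x₀ : M} {w : TM E M} (hw : w ∈ tdom E x₀) (u : TangM E w.1) :
    toLoc x₀ w (vlift w u) = (0, baseLoc x₀ w.1 u) := by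
  have hp := tchart_mem_target hw
  have e : (fun t : ℝ => (⟨w.1, w.2 + t • u⟩ : TM E M)) =
      (tchart x₀).symm ∘ fun t : ℝ => tchart x₀ w + t • ((0 : E), baseLoc x₀ w.1 u) := by
    funext t
    rw [mk_add_eq hw, map_smul]
    simp
  have hl : HasMFDerivAt 𝓘(ℝ, ℝ) 𝓘(ℝ, E × E)
      (fun t : ℝ => tchart x₀ w + t • ((0 : E), baseLoc x₀ w.1 u)) 0
      (ContinuousLinearMap.toSpanSingleton ℝ ((0 : E), baseLoc x₀ w.1 u)) := by
    refine HasFDerivAt.hasMFDerivAt ?_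
    exact ((ContinuousLinearMap.toSpanSingleton ℝ
      ((0 : E), baseLoc x₀ w.1 u)).hasFDerivAt).const_add _
  have h0 : tchart x₀ w + (0 : ℝ) • ((0 : E), baseLoc x₀ w.1 u) = tchart x₀ w := by simp
  have h1 := (hasMFDerivAt_tchart_symm (x₀ := x₀) (M := M)
    (p := tchart x₀ w + (0 : ℝ) • ((0 : E), baseLoc x₀ w.1 u)) (by rwa [h0])).comp 0 hl
  rw [← e] at h1
  have h2 : vlift w u = (ofLoc x₀ ((tchart x₀).symm
      (tchart x₀ w + (0 : ℝ) • ((0 : E), baseLoc x₀ w.1 u))) ((0 : E), baseLoc x₀ w.1 u)) := by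
    have := congrArg (fun T => T (1 : ℝ)) h1.mfderiv
    refine Eq.trans this ?_
    exact congrArg _ (one_smul ℝ ((0 : E), baseLoc x₀ w.1 u))
  -- The chain rule is applied at the point of parameter `0` of the line, which equals `w` only
  -- propositionally.
  have hw' : (tchart x₀).symm (tchart x₀ w + (0 : ℝ) • ((0 : E), baseLoc x₀ w.1 u)) = w := by
    rw [h0, tchart_symm_tchart hw]
  rw [h2]
  refine (toLoc_congr x₀ hw'.symm _).trans ?_
  exact toLoc_ofLoc (by rwa [hw']) _

/-! ### Local representatives -/

/-- The local representative of a vector field on `TM`. -/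
def loc (x₀ : M) (X : Field E M) (p : E × E) : E × E :=
  toLoc x₀ ((tchart x₀).symm p) (X ((tchart x₀).symm p))

/-- The local representative of a vector field on `M`. -/
def locB (x₀ : M) (V : (x : M) → TangM E x) (x : E) : E :=
  baseLoc x₀ ((extChartAt 𝓘(ℝ, E) x₀).symm x) (V ((extChartAt 𝓘(ℝ, E) x₀).symm x))

/-- The vector field `X` is smooth at `w`. -/
def SmoothFieldAt (X : Field E M) (w : TM E M) : Prop :=
  ContMDiffAt 𝓘(ℝ, E).tangent 𝓘(ℝ, E).tangent.tangent ∞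
    (fun w => (⟨w, X w⟩ : TangentBundle 𝓘(ℝ, E).tangent (TM E M))) w

theorem loc_tchart {x₀ : M} {w : TM E M} (hw : w ∈ tdom E x₀) (X : Field E M) :
    loc x₀ X (tchart x₀ w) = toLoc x₀ w (X w) := by
  unfold loc
  rw [tchart_symm_tchart hw]

theorem eventually_mem_tdom {x₀ : M} {w : TM E M} (hw : w ∈ tdom E x₀) :
    ∀ᶠ w' in 𝓝 w, w' ∈ tdom E x₀ :=
  (isOpen_tdom x₀).mem_nhds hw

theorem contMDiffAt_iff_loc {G : Type*} [NormedAddCommGroup G] [NormedSpace ℝ G] {x₀ : M}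
    {w : TM E M} (hw : w ∈ tdom E x₀) {f : TM E M → G} :
    ContMDiffAt 𝓘(ℝ, E).tangent 𝓘(ℝ, G) ∞ f w
      ↔ ContDiffAt ℝ ∞ (f ∘ (tchart x₀).symm) (tchart x₀ w) := by
  constructor
  · intro h
    rw [← contMDiffAt_iff_contDiffAt]
    refine ContMDiffAt.comp _ ?_ (contMDiffAt_tchart_symm (tchart_mem_target hw))
    rwa [tchart_symm_tchart hw]
  · intro h
    have := h.contMDiffAt.comp w (contMDiffAt_tchart hw)
    refine this.congr_of_eventuallyEq ?_
    filter_upwards [eventually_mem_tdom hw] with w' hw'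
    simp [tchart_symm_tchart hw']

theorem smoothFieldAt_iff {x₀ : M} {w : TM E M} (hw : w ∈ tdom E x₀) {X : Field E M} :
    SmoothFieldAt X w ↔ ContDiffAt ℝ ∞ (loc x₀ X) (tchart x₀ w) := by
  unfold SmoothFieldAt
  rw [Trivialization.contMDiffAt_section_iff (trivializationAt (E × E)
    (TangentSpace 𝓘(ℝ, E).tangent) (⟨x₀, 0⟩ : TM E M)) (mem_tdom_iff_baseSet.1 hw)]
  refine Iff.trans ?_ (contMDiffAt_iff_loc (f := fun w => toLoc x₀ w (X w)) hw)
  refine Filter.EventuallyEq.contMDiffAt_iff ?_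
  filter_upwards [eventually_mem_tdom hw] with w' hw'
  rw [toLoc, Trivialization.continuousLinearMapAt_apply,
      Trivialization.coe_linearMapAt_of_mem _ (mem_tdom_iff_baseSet.1 hw')]


theorem smoothFieldAt_symm_iff {x₀ : M} {p : E × E} (hp : p ∈ (tchart x₀).target) {X : Field E M} :
    SmoothFieldAt X ((tchart x₀).symm p) ↔ ContDiffAt ℝ ∞ (loc x₀ X) p := by
  rw [smoothFieldAt_iff (tchart_symm_mem hp), tchart_tchart_symm hp]

/-- Identifying the representative with a pullback gives access to the naturality of the Lie
bracket, and so to the formula for brackets in `loc_bracket`. -/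
theorem loc_eq_mpullback {x₀ : M} {p : E × E} (hp : p ∈ (tchart x₀).target) (X : Field E M) :
    VectorField.mpullback 𝓘(ℝ, E × E) 𝓘(ℝ, E).tangent (tchart x₀).symm X p = loc x₀ X p := by
  have hw := tchart_symm_mem (M := M) hp
  let e : (E × E) ≃L[ℝ] TTM ((tchart (M := M) x₀).symm p) :=
    ContinuousLinearEquiv.equivOfInverse (ofLoc x₀ ((tchart x₀).symm p))
      (toLoc x₀ ((tchart x₀).symm p)) (fun ξ => toLoc_ofLoc hw ξ) (fun ξ => ofLoc_toLoc hw ξ)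
  have h := (hasMFDerivAt_tchart_symm (M := M) hp).mfderiv
  rw [VectorField.mpullback_apply, h]
  have : ofLoc x₀ ((tchart (M := M) x₀).symm p) = (e : E × E →L[ℝ] TTM _) := rfl
  rw [loc]
  exact congrArg (fun T => T (X ((tchart x₀).symm p)))
    ((congrArg ContinuousLinearMap.inverse this).trans (ContinuousLinearMap.inverse_equiv e))

theorem loc_bracket [CompleteSpace E] {x₀ : M} {p : E × E} (hp : p ∈ (tchart x₀).target)
    {X Y : Field E M} (hX : SmoothFieldAt X ((tchart x₀).symm p))
    (hY : SmoothFieldAt Y ((tchart x₀).symm p)) :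
    loc x₀ (bracket X Y) p
      = fderiv ℝ (loc x₀ Y) p (loc x₀ X p) - fderiv ℝ (loc x₀ X) p (loc x₀ Y p) := by
  have : IsManifold 𝓘(ℝ, E).tangent (minSmoothness ℝ 2) (TM E M) := by
    rw [minSmoothness_of_isRCLikeNormedField]; infer_instance
  have h := VectorField.mpullback_mlieBracket (I := 𝓘(ℝ, E × E)) (I' := 𝓘(ℝ, E).tangent)
    (f := (tchart (M := M) x₀).symm) (V := X) (W := Y) (x₀ := p) (n := ∞)
    (ContMDiffAt.mdifferentiableAt hX (by simp)) (ContMDiffAt.mdifferentiableAt hY (by simp))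
    (contMDiffAt_tchart_symm hp) (by
      rw [minSmoothness_of_isRCLikeNormedField]; exact WithTop.coe_le_coe.2 le_top)
  rw [loc_eq_mpullback hp] at h
  rw [bracket, h]
  have hev : ∀ X : Field E M,
      VectorField.mpullback 𝓘(ℝ, E × E) 𝓘(ℝ, E).tangent (tchart x₀).symm X =ᶠ[𝓝 p] loc x₀ X := by
    intro X
    filter_upwards [(isOpen_tchart_target x₀).mem_nhds hp] with q hq
    exact loc_eq_mpullback hq X
  have h2 := Filter.EventuallyEq.mlieBracket_vectorField_eq (I := 𝓘(ℝ, E × E)) (hev X) (hev Y)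
  refine h2.trans ?_
  have h3 := congrFun (VectorField.mlieBracketWithin_eq_lieBracketWithin (𝕜 := ℝ) (V := loc x₀ X)
    (W := loc x₀ Y) (s := univ)) p
  refine h3.trans ?_
  rw [VectorField.lieBracketWithin_univ]
  rfl

theorem dirDeriv_eq {x₀ : M} {w : TM E M} (hw : w ∈ tdom E x₀) {f : TM E M → ℝ}
    (hf : ContMDiffAt 𝓘(ℝ, E).tangent 𝓘(ℝ, ℝ) ∞ f w) (X : Field E M) :
    dirDeriv X f w
      = fderiv ℝ (f ∘ (tchart x₀).symm) (tchart x₀ w) (loc x₀ X (tchart x₀ w)) := by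
  have h1 := (contMDiffAt_iff_loc hw).1 hf
  have h2 := (differentiableAt_of_contDiffAt h1).hasFDerivAt.hasMFDerivAt.comp w
    (hasMFDerivAt_tchart hw)
  have h3 : HasMFDerivAt 𝓘(ℝ, E).tangent 𝓘(ℝ, ℝ) f w
      ((fderiv ℝ (f ∘ (tchart x₀).symm) (tchart x₀ w)).comp (toLoc x₀ w)) := by
    refine h2.congr_of_eventuallyEq ?_
    filter_upwards [eventually_mem_tdom hw] with w' hw'
    simp [tchart_symm_tchart hw']
  rw [loc_tchart hw]
  exact congrArg (fun T => T (X w)) h3.mfderiv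

/-! ### The slit tangent bundle -/

/-- The image of the slit tangent bundle in the chart at `x₀`. -/
def slitLoc (E : Type*) [NormedAddCommGroup E] [NormedSpace ℝ E] {M : Type*} [TopologicalSpace M]
    [ChartedSpace E M] (x₀ : M) : Set (E × E) :=
  (extChartAt 𝓘(ℝ, E) x₀).target ×ˢ {0}ᶜ

omit [IsManifold 𝓘(ℝ, E) ∞ M] in
theorem isOpen_slitLoc (x₀ : M) : IsOpen (slitLoc E x₀) :=
  (isOpen_extChartAt_target x₀).prod isOpen_compl_singleton

theorem slitLoc_subset (x₀ : M) : slitLoc E x₀ ⊆ (tchart x₀).target :=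
  fun _ hp => mem_tchart_target.2 hp.1

theorem tchart_mem_slitLoc {x₀ : M} {w : TM E M} (hw : w ∈ tdom E x₀) :
    tchart x₀ w ∈ slitLoc E x₀ ↔ w ∈ slit E M := by
  have h := mem_tchart_target.1 (tchart_mem_target hw)
  have h2 : baseLoc x₀ w.1 w.2 = 0 ↔ w.2 = 0 :=
    ⟨fun h => baseLoc_injective hw (h.trans (map_zero _).symm), fun h => by rw [h, map_zero]⟩
  simp only [slitLoc, mem_prod, h, true_and, mem_compl_iff, mem_singleton_iff, slit, mem_ofPred_eq]
  rw [tchart_apply hw, h2]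

theorem tchart_symm_mem_slit {x₀ : M} {p : E × E} (hp : p ∈ slitLoc E x₀) :
    (tchart x₀).symm p ∈ slit E M := by
  have h := slitLoc_subset x₀ hp
  rw [← tchart_mem_slitLoc (tchart_symm_mem h), tchart_tchart_symm h]
  exact hp

theorem isOpen_slit : IsOpen (slit E M) := by
  rw [isOpen_iff_mem_nhds]
  intro w hw
  have hd := mem_tdom_self w
  have hc : ContinuousAt (tchart (M := M) w.1) w := (contMDiffAt_tchart hd).continuousAt
  filter_upwards [eventually_mem_tdom hd, hc.preimage_mem_nhds
    ((isOpen_slitLoc w.1).mem_nhds ((tchart_mem_slitLoc hd).2 hw))] with w' h1 h2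
  exact (tchart_mem_slitLoc h1).1 h2

theorem smoothField_iff {X : Field E M} :
    SmoothField X ↔ ∀ w ∈ slit E M, SmoothFieldAt X w :=
  ⟨fun h _ hw => h.contMDiffAt (isOpen_slit.mem_nhds hw),
    fun h _ hw => (h _ hw).contMDiffWithinAt⟩

theorem SmoothField.contDiffAt {X : Field E M} (hX : SmoothField X) {x₀ : M} {p : E × E}
    (hp : p ∈ slitLoc E x₀) : ContDiffAt ℝ ∞ (loc x₀ X) p :=
  (smoothFieldAt_symm_iff (slitLoc_subset _ hp)).1
    (smoothField_iff.1 hX _ (tchart_symm_mem_slit hp))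

theorem smoothField_of_loc {X : Field E M}
    (h : ∀ x₀ : M, ∀ p ∈ slitLoc E x₀, ContDiffAt ℝ ∞ (loc x₀ X) p) : SmoothField X :=
  smoothField_iff.2 fun _ hw => (smoothFieldAt_iff (mem_tdom_self _)).2
    (h _ _ ((tchart_mem_slitLoc (mem_tdom_self _)).2 hw))

end Charts

/-! ### Iterated one-variable derivatives as Fréchet derivatives. -/

section LineDerivatives

variable {H : Type*} [NormedAddCommGroup H] [NormedSpace ℝ H]

theorem deriv_line {f : H → ℝ} {q : H} (hf : DifferentiableAt ℝ f q) (a : H) :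
    deriv (fun t : ℝ => f (q + t • a)) 0 = fderiv ℝ f q a := by
  have h1 : HasDerivAt (fun t : ℝ => q + t • a) a 0 := by
    simpa using ((hasDerivAt_id (0 : ℝ)).smul_const a).const_add q
  have h2 : HasFDerivAt f (fderiv ℝ f q) (q + (0 : ℝ) • a) := by
    simpa using hf.hasFDerivAt
  exact (h2.comp_hasDerivAt (0 : ℝ) h1).deriv

theorem eventually_line {Ω : Set H} (hΩ : IsOpen Ω) {p : H} (hp : p ∈ Ω) (a : H) :
    ∀ᶠ t : ℝ in 𝓝 0, p + t • a ∈ Ω := by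
  have hc : ContinuousAt (fun t : ℝ => p + t • a) 0 := by fun_prop
  refine hc.preimage_mem_nhds (hΩ.mem_nhds ?_)
  simpa using hp

theorem deriv_deriv_line {Ω : Set H} (hΩ : IsOpen Ω) {f : H → ℝ}
    (hf : ∀ q ∈ Ω, ContDiffAt ℝ ∞ f q) {p : H} (hp : p ∈ Ω) (a b : H) :
    deriv (fun t : ℝ => deriv (fun s : ℝ => f (p + t • a + s • b)) 0) 0
      = fderiv ℝ (fderiv ℝ f) p a b := by
  have h1 : (fun t : ℝ => deriv (fun s : ℝ => f (p + t • a + s • b)) 0)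
      =ᶠ[𝓝 0] fun t => fderiv ℝ f (p + t • a) b := by
    filter_upwards [eventually_line hΩ hp a] with t ht
    exact deriv_line (differentiableAt_of_contDiffAt (hf _ ht)) b
  have h2 := differentiableAt_of_contDiffAt (contDiffAt_fderiv (hf p hp))
  rw [h1.deriv_eq, deriv_line (f := fun q => fderiv ℝ f q b)
    (h2.clm_apply (differentiableAt_const b)),
    fderiv_clm_apply_apply h2 (differentiableAt_const b)]
  simp

theorem deriv_deriv_deriv_line {Ω : Set H} (hΩ : IsOpen Ω) {f : H → ℝ}
    (hf : ∀ q ∈ Ω, ContDiffAt ℝ ∞ f q) {p : H} (hp : p ∈ Ω) (a b c : H) :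
    deriv (fun r : ℝ => deriv (fun s : ℝ => deriv (fun t : ℝ =>
      f (p + r • a + s • b + t • c)) 0) 0) 0
      = fderiv ℝ (fderiv ℝ (fderiv ℝ f)) p a b c := by
  have h1 : (fun r : ℝ => deriv (fun s : ℝ => deriv (fun t : ℝ =>
      f (p + r • a + s • b + t • c)) 0) 0)
      =ᶠ[𝓝 0] fun r => fderiv ℝ (fderiv ℝ f) (p + r • a) b c := by
    filter_upwards [eventually_line hΩ hp a] with t ht
    exact deriv_deriv_line hΩ hf ht b c
  have h2 := differentiableAt_of_contDiffAt (contDiffAt_fderiv (contDiffAt_fderiv (hf p hp)))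
  have h3 := h2.clm_apply (differentiableAt_const b)
  rw [h1.deriv_eq, deriv_line (f := fun q => fderiv ℝ (fderiv ℝ f) q b c)
    (h3.clm_apply (differentiableAt_const c)),
    fderiv_clm_apply_apply h3 (differentiableAt_const c),
    fderiv_clm_apply_apply h2 (differentiableAt_const b)]
  simp

end LineDerivatives

/-! ### The fundamental tensor, the Cartan tensor and the geodesic spray in a chart. -/

section Tensors

variable {E : Type*} [NormedAddCommGroup E] [NormedSpace ℝ E]
  {M : Type*} [TopologicalSpace M] [ChartedSpace E M] [IsManifold 𝓘(ℝ, E) ∞ M]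
  {F : TM E M → ℝ} {S : Field E M}

/-- The local representative of the energy `F² / 2`. -/
def locEnergy (x₀ : M) (F : TM E M → ℝ) (p : E × E) : ℝ :=
  F ((tchart x₀).symm p) ^ 2 / 2

theorem sq_mk_add {x₀ : M} {w : TM E M} (hw : w ∈ tdom E x₀) (v : TangM E w.1) :
    F ⟨w.1, w.2 + v⟩ ^ 2 = 2 * locEnergy x₀ F (tchart x₀ w + (0, baseLoc x₀ w.1 v)) := by
  rw [mk_add_eq hw, locEnergy]
  ring

theorem contMDiffAt_energy (hF : IsFinslerMetric F) {w : TM E M} (hw : w ∈ slit E M) :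
    ContMDiffAt 𝓘(ℝ, E).tangent 𝓘(ℝ, ℝ) ∞ (fun w => F w ^ 2 / 2) w := by
  have h := (contMDiffAt_iff_loc (mem_tdom_self w)).1
    ((hF.smooth w hw).contMDiffAt (isOpen_slit.mem_nhds hw))
  exact (contMDiffAt_iff_loc (mem_tdom_self w)).2 ((h.pow 2).div_const 2)

theorem contDiffAt_locEnergy (hF : IsFinslerMetric F) (x₀ : M) {p : E × E}
    (hp : p ∈ slitLoc E x₀) : ContDiffAt ℝ ∞ (locEnergy x₀ F) p := by
  have hw := tchart_symm_mem (M := M) (slitLoc_subset x₀ hp)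
  have h := (contMDiffAt_iff_loc hw).1 (contMDiffAt_energy hF (tchart_symm_mem_slit hp))
  rwa [tchart_tchart_symm (slitLoc_subset x₀ hp)] at h

theorem fundTensor_eq (hF : IsFinslerMetric F) {x₀ : M} {w : TM E M} (hw : w ∈ tdom E x₀)
    (hs : w ∈ slit E M) (u v : TangM E w.1) :
    fundTensor F w u v
      = locMetric (locEnergy x₀ F) (tchart x₀ w) (baseLoc x₀ w.1 u) (baseLoc x₀ w.1 v) := by
  have h := deriv_deriv_line (isOpen_slitLoc x₀) (fun q => contDiffAt_locEnergy hF x₀)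
    ((tchart_mem_slitLoc hw).2 hs) (0, baseLoc x₀ w.1 v) (0, baseLoc x₀ w.1 u)
  -- The outer derivative in `fundTensor` is along `v`, hence the exchange of arguments.
  rw [locMetric_symm (contDiffAt_locEnergy hF x₀ ((tchart_mem_slitLoc hw).2 hs)),
    locMetric_apply, ← h, fundTensor]
  have e : ∀ t s : ℝ, F ⟨w.1, w.2 + s • u + t • v⟩ ^ 2 = 2 * locEnergy x₀ F
      (tchart x₀ w + t • ((0 : E), baseLoc x₀ w.1 v) + s • ((0 : E), baseLoc x₀ w.1 u)) := by
    intro t s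
    rw [add_assoc, sq_mk_add hw, map_add, map_smul, map_smul]
    congr 2
    ext <;> simp [add_comm, add_assoc]
  simp_rw [e, deriv_const_mul_field]
  ring

theorem cartanTensor_eq (hF : IsFinslerMetric F) {x₀ : M} {w : TM E M} (hw : w ∈ tdom E x₀)
    (hs : w ∈ slit E M) (u v z : TangM E w.1) :
    cartanTensor F w u v z
      = locCartan (locEnergy x₀ F) (tchart x₀ w) (baseLoc x₀ w.1 u) (baseLoc x₀ w.1 v)
        (baseLoc x₀ w.1 z) := by
  have h := deriv_deriv_deriv_line (isOpen_slitLoc x₀) (fun q => contDiffAt_locEnergy hF x₀)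
    ((tchart_mem_slitLoc hw).2 hs) (0, baseLoc x₀ w.1 u) (0, baseLoc x₀ w.1 v)
    (0, baseLoc x₀ w.1 z)
  rw [locCartan_apply, ← h, cartanTensor]
  -- `F²` is twice the energy, so the factor `1/4` becomes the `1/2` of `locCartan`.
  have e : ∀ r s t : ℝ, F ⟨w.1, w.2 + r • u + s • v + t • z⟩ ^ 2 = 2 * locEnergy x₀ F
      (tchart x₀ w + r • ((0 : E), baseLoc x₀ w.1 u) + s • ((0 : E), baseLoc x₀ w.1 v)
        + t • ((0 : E), baseLoc x₀ w.1 z)) := by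
    intro r s t
    rw [add_assoc, add_assoc, sq_mk_add hw, map_add, map_add, map_smul, map_smul, map_smul]
    congr 2
    ext <;> simp [add_assoc]
  simp_rw [e, deriv_const_mul_field]
  ring

theorem isLocalLagrangian (hF : IsFinslerMetric F) (x₀ : M) :
    IsLocalLagrangian (slitLoc E x₀) (locEnergy x₀ F) where
  isOpen := isOpen_slitLoc x₀
  contDiffAt_lagrangian p hp := contDiffAt_locEnergy hF x₀ hp
  euler p hp := by
    have hp' := slitLoc_subset x₀ hp
    have hw := tchart_symm_mem (M := M) hp'
    set w := (tchart (M := M) x₀).symm p with hwdef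
    have hpw : tchart x₀ w = p := tchart_tchart_symm hp'
    have hp2 : p.2 = baseLoc x₀ w.1 w.2 := by rw [← hpw, tchart_apply hw]
    rw [← deriv_line (differentiableAt_of_contDiffAt (contDiffAt_locEnergy hF x₀ hp))]
    have h1 : (fun t : ℝ => locEnergy x₀ F (p + t • ((0 : E), p.2)))
        =ᶠ[𝓝 0] fun t => (1 + t) ^ 2 * locEnergy x₀ F p := by
      -- Moving from `w` by `t w` scales `F` by `1 + t`. Homogeneity is only positive, which
      -- restricts to `t > -1`.
      filter_upwards [lt_mem_nhds (show (-1 : ℝ) < 0 by norm_num)] with t ht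
      have e1 := sq_mk_add (F := F) hw (t • w.2)
      have e2 : w.2 + t • w.2 = (1 + t) • w.2 := by rw [add_smul, one_smul]
      rw [e2, hF.homogeneous w (1 + t) (by linarith), hpw, map_smul, ← hp2] at e1
      have e3 : locEnergy x₀ F p = F w ^ 2 / 2 := rfl
      have e4 : ((0 : E), t • p.2) = t • ((0 : E), p.2) := by simp
      rw [e4] at e1
      rw [e3]
      have e5 : F ⟨w.1, w.2⟩ = F w := rfl
      nlinarith [e1]
    rw [h1.deriv_eq]
    have h2 : HasDerivAt (fun t : ℝ => (1 + t) ^ 2 * locEnergy x₀ F p)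
        (2 * locEnergy x₀ F p) 0 := by
      have := (((hasDerivAt_id (0 : ℝ)).const_add 1).pow 2).mul_const (locEnergy x₀ F p)
      simpa using this
    exact h2.deriv
  posDef p hp u hu := by
    have hp' := slitLoc_subset x₀ hp
    have hw := tchart_symm_mem (M := M) hp'
    have hs := tchart_symm_mem_slit (M := M) hp
    have h := hF.posDef _ hs (baseSymm x₀ _ u) (fun h0 => hu (by
      rw [← baseLoc_baseSymm hw u, h0, map_zero]))
    rwa [fundTensor_eq hF hw hs, baseLoc_baseSymm hw, tchart_tchart_symm hp'] at h

theorem loc_almostTangent {x₀ : M} {p : E × E} (hp : p ∈ (tchart x₀).target) (X : Field E M) :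
    loc x₀ (almostTangent X) p = (0, (loc x₀ X p).1) := by
  have hw := tchart_symm_mem (M := M) hp
  rw [loc, almostTangent, toLoc_vlift hw, baseLoc_dproj hw, loc]

theorem smoothFieldAt_almostTangent {X : Field E M} {w : TM E M} (hX : SmoothFieldAt X w) :
    SmoothFieldAt (almostTangent X) w := by
  have hw := mem_tdom_self w
  rw [smoothFieldAt_iff hw] at hX ⊢
  refine (contDiffAt_const.prodMk hX.fst).congr_of_eventuallyEq
    (f := fun p => ((0 : E), (loc w.1 X p).1)) ?_
  filter_upwards [(isOpen_tchart_target w.1).mem_nhds (tchart_mem_target hw)] with q hq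
  exact loc_almostTangent hq X

/-- The conditions quantify over global fields, while arguments at a point need a prescribed value.
A field constant in the chart is cut off by a bump function on `M` pulled back along `π`. -/
theorem exists_smoothField [FiniteDimensional ℝ E] [T2Space M] (w : TM E M) (ξ : TTM w) :
    ∃ Y : Field E M, (∀ w', SmoothFieldAt Y w') ∧ Y w = ξ := by
  let χ : SmoothBumpFunction 𝓘(ℝ, E) w.1 := Classical.arbitrary _
  let s : Field E M := fun w' => ofLoc w.1 w' (toLoc w.1 w ξ)
  have hs : ∀ w' ∈ tdom E w.1, SmoothFieldAt s w' := by
    intro w' hw'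
    rw [smoothFieldAt_iff hw']
    refine (contDiffAt_const (c := toLoc w.1 w ξ)).congr_of_eventuallyEq ?_
    filter_upwards [(isOpen_tchart_target w.1).mem_nhds (tchart_mem_target hw')] with q hq
    exact toLoc_ofLoc (tchart_symm_mem hq) _
  have hψ : ContMDiff 𝓘(ℝ, E).tangent 𝓘(ℝ, ℝ) ∞ (fun w' : TM E M => χ w'.1) :=
    χ.contMDiff.comp (contMDiff_proj (TangentSpace 𝓘(ℝ, E) : M → Type _))
  have hsupp : tsupport (fun w' : TM E M => χ w'.1) ⊆ tdom E w.1 := by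
    intro w' hw'
    have hc : Continuous (fun w' : TM E M => w'.1) :=
      (contMDiff_proj (n := ∞) (IB := 𝓘(ℝ, E)) (TangentSpace 𝓘(ℝ, E) : M → Type _)).continuous
    exact χ.tsupport_subset_chartAt_source (tsupport_comp_subset_preimage χ hc hw')
  have := ContMDiffOn.smul_section_of_tsupport hψ.contMDiffOn (isOpen_tdom w.1) hsupp
    (s := s) (fun w' hw' => ContMDiffAt.contMDiffWithinAt (hs w' hw'))
  refine ⟨_, this, ?_⟩
  simp [s, ofLoc_toLoc (mem_tdom_self w)]

/-- The local representative of the vertical part of a spray. -/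
def locSpray (x₀ : M) (S : Field E M) (p : E × E) : E := (loc x₀ S p).2

theorem baseLoc_snd {x₀ : M} {p : E × E} (hp : p ∈ (tchart x₀).target) :
    baseLoc x₀ ((tchart (M := M) x₀).symm p).1 ((tchart x₀).symm p).2 = p.2 := by
  have := tchart_apply (tchart_symm_mem (M := M) hp)
  rw [tchart_tchart_symm hp] at this
  exact (congrArg Prod.snd this).symm

/-- By `g(y, ·) = ∂L/∂y`, the form `θ_F` is `∂L/∂y · dx` in coordinates. -/
theorem legendreForm_comp (hF : IsFinslerMetric F) {x₀ : M} {p : E × E} (hp : p ∈ slitLoc E x₀)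
    (X : Field E M) :
    legendreForm F X ((tchart x₀).symm p)
      = fderiv ℝ (locEnergy x₀ F) p (0, (loc x₀ X p).1) := by
  have hp' := slitLoc_subset x₀ hp
  have hw := tchart_symm_mem (M := M) hp'
  have hs := tchart_symm_mem_slit (M := M) hp
  rw [legendreForm, fundTensor_eq hF hw hs, baseLoc_dproj hw, tchart_tchart_symm hp',
    locMetric_symm (contDiffAt_locEnergy hF x₀ hp)]
  rw [baseLoc_snd hp', (isLocalLagrangian hF x₀).locMetric_snd hp]
  rfl

theorem dirDeriv_legendreForm (hF : IsFinslerMetric F) {x₀ : M} {p : E × E}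
    (hp : p ∈ slitLoc E x₀) {X : Field E M} (hX : SmoothField X) (Y : Field E M) :
    dirDeriv Y (legendreForm F X) ((tchart x₀).symm p)
      = fderiv ℝ (fderiv ℝ (locEnergy x₀ F)) p (loc x₀ Y p) (0, (loc x₀ X p).1)
        + fderiv ℝ (locEnergy x₀ F) p (0, (fderiv ℝ (loc x₀ X) p (loc x₀ Y p)).1) := by
  have hp' := slitLoc_subset x₀ hp
  have hw := tchart_symm_mem (M := M) hp'
  have hE := contDiffAt_locEnergy hF x₀ hp
  have hXp := hX.contDiffAt hp
  have hev : (legendreForm F X) ∘ (tchart x₀).symm =ᶠ[𝓝 p]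
      fun q => fderiv ℝ (locEnergy x₀ F) q (0, (loc x₀ X q).1) := by
    filter_upwards [(isOpen_slitLoc x₀).mem_nhds hp] with q hq
    exact legendreForm_comp hF hq X
  have h0 : ContDiffAt ℝ ∞ (fun q => ((0 : E), (loc x₀ X q).1)) p :=
    contDiffAt_const.prodMk hXp.fst
  have hs : ContDiffAt ℝ ∞ (fun q => fderiv ℝ (locEnergy x₀ F) q (0, (loc x₀ X q).1)) p :=
    (contDiffAt_fderiv hE).clm_apply h0
  rw [dirDeriv_eq hw, tchart_tchart_symm hp', hev.fderiv_eq,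
    fderiv_clm_apply_apply (differentiableAt_of_contDiffAt (contDiffAt_fderiv hE))
      (differentiableAt_of_contDiffAt h0)]
  · congr 2
    have hd := differentiableAt_of_contDiffAt hXp
    rw [((hasFDerivAt_const (0 : E) p).prodMk hd.hasFDerivAt.fst).fderiv]
    rfl
  · rw [contMDiffAt_iff_loc hw, tchart_tchart_symm hp']
    exact hs.congr_of_eventuallyEq hev

/-- Expanding `-dθ_F(S, Y)`, the derivatives of `Y` and `S` cancel against the bracket term, and a
tensorial equation in `ξ` remains. -/
theorem spray_equation [FiniteDimensional ℝ E] [CompleteSpace E] [T2Space M]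
    (hF : IsFinslerMetric F) (hS : IsGeodesicSpray F S) {x₀ : M} {p : E × E}
    (hp : p ∈ slitLoc E x₀) (ξ : E × E) :
    fderiv ℝ (locEnergy x₀ F) p ξ
      = fderiv ℝ (fderiv ℝ (locEnergy x₀ F)) p ξ (0, (loc x₀ S p).1)
        - fderiv ℝ (fderiv ℝ (locEnergy x₀ F)) p (loc x₀ S p) (0, ξ.1) := by
  have hp' := slitLoc_subset x₀ hp
  have hw := tchart_symm_mem (M := M) hp'
  have hs := tchart_symm_mem_slit (M := M) hp
  obtain ⟨Y, hY, hYw⟩ := exists_smoothField _ (ofLoc x₀ ((tchart (M := M) x₀).symm p) ξ)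
  have hYs : SmoothField Y := smoothField_iff.2 fun w _ => hY w
  have hloc : loc x₀ Y p = ξ := by rw [loc, hYw, toLoc_ofLoc hw]
  have h := hS.2 Y hYs _ hs
  have e1 : (fun w => F w ^ 2 / 2) ∘ (tchart x₀).symm = locEnergy x₀ F := rfl
  rw [dirDeriv_eq hw (contMDiffAt_energy hF hs), e1, tchart_tchart_symm hp', hloc,
    symplecticForm, dirDeriv_legendreForm hF hp hYs, dirDeriv_legendreForm hF hp hS.1,
    legendreForm_comp hF hp, loc_bracket hp' (smoothField_iff.1 hS.1 _ hs) (hY _), hloc] at h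
  have e2 : ∀ a b : E × E, ((0 : E), (a - b).1) = (0, a.1) - (0, b.1) := by simp
  rw [e2, map_sub] at h
  linarith

/-- Testing the symplectic equation on vertical vectors gives `g(S₁, u) = ∂_u L = g(y, u)`, so `S`
is a second order field. -/
theorem loc_spray_fst [FiniteDimensional ℝ E] [CompleteSpace E] [T2Space M]
    (hF : IsFinslerMetric F) (hS : IsGeodesicSpray F S) {x₀ : M} {p : E × E}
    (hp : p ∈ slitLoc E x₀) : (loc x₀ S p).1 = p.2 := by
  have hL := isLocalLagrangian hF x₀
  refine hL.eq_of_locMetric_eq hp fun u => ?_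
  have h := spray_equation hF hS hp (0, u)
  rw [← hL.locMetric_snd hp, show ((0 : E), (0 : E)) = 0 from rfl, map_zero, sub_zero,
    ← locMetric_apply] at h
  rw [locMetric_symm (hL.contDiffAt_lagrangian p hp), ← h,
    locMetric_symm (hL.contDiffAt_lagrangian p hp)]

/-- Testing the symplectic equation on base directions gives the Euler-Lagrange equation;
2-homogeneity of `∂_x L` removes the first term. -/
theorem isLocalSpray [FiniteDimensional ℝ E] [CompleteSpace E] [T2Space M]
    (hF : IsFinslerMetric F) (hS : IsGeodesicSpray F S) (x₀ : M) :
    IsLocalSpray (slitLoc E x₀) (locEnergy x₀ F) (locSpray x₀ S) where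
  toIsLocalLagrangian := isLocalLagrangian hF x₀
  contDiffAt_spray p hp := (hS.1.contDiffAt hp).snd
  spray p hp u := by
    have h := spray_equation hF hS hp (u, 0)
    have h1 := loc_spray_fst hF hS hp
    have h2 : (p.2, locSpray x₀ S p) = loc x₀ S p := by rw [← h1]; rfl
    rw [h2]
    rw [h1, (isLocalLagrangian hF x₀).fderiv_fderiv_fst_snd hp] at h
    linarith

end Tensors

/-! ### The canonical connection, its projections and the vertical bundle in a chart. -/

section Projections

variable {E : Type*} [NormedAddCommGroup E] [NormedSpace ℝ E] [FiniteDimensional ℝ E]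
  [CompleteSpace E]
  {M : Type*} [TopologicalSpace M] [ChartedSpace E M] [IsManifold 𝓘(ℝ, E) ∞ M] [T2Space M]
  {F : TM E M → ℝ} {S : Field E M}

theorem loc_spray (hF : IsFinslerMetric F) (hS : IsGeodesicSpray F S) {x₀ : M} {p : E × E}
    (hp : p ∈ slitLoc E x₀) : loc x₀ S p = (p.2, locSpray x₀ S p) := by
  rw [← loc_spray_fst hF hS hp]; rfl

theorem fderiv_loc_spray (hF : IsFinslerMetric F) (hS : IsGeodesicSpray F S) {x₀ : M} {p : E × E}
    (hp : p ∈ slitLoc E x₀) (ξ : E × E) :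
    fderiv ℝ (loc x₀ S) p ξ = (ξ.2, fderiv ℝ (locSpray x₀ S) p ξ) := by
  rw [fderiv_eq_of_eqOn (isOpen_slitLoc x₀) (fun q hq => loc_spray hF hS hq) hp]
  have hs := differentiableAt_of_contDiffAt ((isLocalSpray hF hS x₀).contDiffAt_spray p hp)
  rw [(hasFDerivAt_snd.prodMk hs.hasFDerivAt).fderiv]
  rfl

omit [FiniteDimensional ℝ E] [CompleteSpace E] [T2Space M] in
theorem fderiv_loc_almostTangent {x₀ : M} {p : E × E} (hp : p ∈ (tchart x₀).target)
    {X : Field E M} (hX : DifferentiableAt ℝ (loc x₀ X) p) (ξ : E × E) :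
    fderiv ℝ (loc x₀ (almostTangent X)) p ξ = (0, (fderiv ℝ (loc x₀ X) p ξ).1) := by
  rw [fderiv_eq_of_eqOn (isOpen_tchart_target x₀) (fun q hq => loc_almostTangent hq X) hp,
    ((hasFDerivAt_const (0 : E) p).prodMk hX.hasFDerivAt.fst).fderiv]
  rfl

omit [FiniteDimensional ℝ E] [CompleteSpace E] [T2Space M] in
theorem smoothFieldAt_extend (w : TM E M) (ξ : TTM w) :
    SmoothFieldAt (FiberBundle.extend (E × E) ξ) w := by
  unfold SmoothFieldAt
  rw [Bundle.contMDiffAt_section]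
  refine (contMDiffAt_const (c := (trivializationAt (E × E) (TangentSpace 𝓘(ℝ, E).tangent) w
    ⟨w, ξ⟩).2)).congr_of_eventuallyEq ?_
  have hb := (trivializationAt (E × E) (TangentSpace 𝓘(ℝ, E).tangent) w).open_baseSet.mem_nhds
    (FiberBundle.mem_baseSet_trivializationAt' w)
  filter_upwards [hb] with w' hw'
  have h := (trivializationAt (E × E) (TangentSpace 𝓘(ℝ, E).tangent) w).apply_mk_symm hw'
    (trivializationAt (E × E) (TangentSpace 𝓘(ℝ, E).tangent) w ⟨w, ξ⟩).2
  exact (congrArg Prod.snd h :)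

omit [FiniteDimensional ℝ E] [CompleteSpace E] [T2Space M] in
theorem fderiv_locSpray_snd {x₀ : M} (p : E × E) (a : E) :
    fderiv ℝ (locSpray x₀ S) p (0, a) = (-2 : ℝ) • locNonlin (locSpray x₀ S) p a := by
  rw [locNonlin_apply, smul_smul]; norm_num

/-- The derivative of the extension of `ξ` occurs in both brackets and cancels. What is left is the
derivative of the spray, whose fibre part is `-2 N`. -/
theorem toLoc_canonicalConnection (hF : IsFinslerMetric F) (hS : IsGeodesicSpray F S) {x₀ : M}
    {p : E × E} (hp : p ∈ slitLoc E x₀) (ξ : TTM ((tchart (M := M) x₀).symm p)) :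
    toLoc x₀ _ (canonicalConnection S _ ξ) = ((toLoc x₀ _ ξ).1,
      -(toLoc x₀ _ ξ).2 - (2 : ℝ) • locNonlin (locSpray x₀ S) p (toLoc x₀ _ ξ).1) := by
  have hp' := slitLoc_subset x₀ hp
  have hs := tchart_symm_mem_slit (M := M) hp
  set X : Field E M := FiberBundle.extend (E × E) ξ with hXdef
  have hX : SmoothFieldAt X ((tchart (M := M) x₀).symm p) := smoothFieldAt_extend _ ξ
  have hX0 : loc x₀ X p = toLoc x₀ _ ξ := by
    rw [loc, hXdef, FiberBundle.extend_apply_self]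
  have hd := differentiableAt_of_contDiffAt ((smoothFieldAt_symm_iff hp').1 hX)
  have hSs := smoothField_iff.1 hS.1 _ hs
  have e1 : toLoc x₀ _ (canonicalConnection S _ ξ)
      = loc x₀ (almostTangent (bracket S X)) p - loc x₀ (bracket S (almostTangent X)) p := by
    rw [canonicalConnection, map_sub]; rfl
  rw [e1, loc_almostTangent hp', loc_bracket hp' hSs hX,
    loc_bracket hp' hSs (smoothFieldAt_almostTangent hX), fderiv_loc_almostTangent hp' hd,
    loc_almostTangent hp', fderiv_loc_spray hF hS hp, fderiv_loc_spray hF hS hp,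
    fderiv_locSpray_snd, hX0]
  ext
  · simp
  · simp only [Prod.snd_sub, Prod.fst_sub]
    module

theorem loc_hproj (hF : IsFinslerMetric F) (hS : IsGeodesicSpray F S) {x₀ : M}
    {p : E × E} (hp : p ∈ slitLoc E x₀) (X : Field E M) :
    loc x₀ (hproj S X) p = ((loc x₀ X p).1, -locNonlin (locSpray x₀ S) p (loc x₀ X p).1) := by
  have e1 : loc x₀ (hproj S X) p = (1 / 2 : ℝ) • (loc x₀ X p
      + toLoc x₀ _ (canonicalConnection S _ (X ((tchart x₀).symm p)))) := by
    rw [loc, hproj, map_smul, map_add]; rfl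
  rw [e1, toLoc_canonicalConnection hF hS hp]
  change (1 / 2 : ℝ) • (loc x₀ X p + ((loc x₀ X p).1, -(loc x₀ X p).2
    - (2 : ℝ) • locNonlin (locSpray x₀ S) p (loc x₀ X p).1)) = _
  ext
  · simp only [Prod.smul_fst, Prod.fst_add]; module
  · simp only [Prod.smul_snd, Prod.snd_add]; module

theorem loc_vproj (hF : IsFinslerMetric F) (hS : IsGeodesicSpray F S) {x₀ : M}
    {p : E × E} (hp : p ∈ slitLoc E x₀) (X : Field E M) :
    loc x₀ (vproj S X) p
      = (0, (loc x₀ X p).2 + locNonlin (locSpray x₀ S) p (loc x₀ X p).1) := by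
  have e1 : loc x₀ (vproj S X) p = (1 / 2 : ℝ) • (loc x₀ X p
      - toLoc x₀ _ (canonicalConnection S _ (X ((tchart x₀).symm p)))) := by
    rw [loc, vproj, map_smul, map_sub]; rfl
  rw [e1, toLoc_canonicalConnection hF hS hp]
  change (1 / 2 : ℝ) • (loc x₀ X p - ((loc x₀ X p).1, -(loc x₀ X p).2
    - (2 : ℝ) • locNonlin (locSpray x₀ S) p (loc x₀ X p).1)) = _
  ext
  · simp
  · simp only [Prod.smul_snd, Prod.snd_sub]; module

theorem isHorizontal_iff (hF : IsFinslerMetric F) (hS : IsGeodesicSpray F S) {x₀ : M}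
    {p : E × E} (hp : p ∈ slitLoc E x₀) (X : Field E M) :
    IsHorizontal S ((tchart x₀).symm p) (X ((tchart x₀).symm p))
      ↔ (loc x₀ X p).2 + locNonlin (locSpray x₀ S) p (loc x₀ X p).1 = 0 := by
  have hw := tchart_symm_mem (M := M) (slitLoc_subset x₀ hp)
  have h := toLoc_canonicalConnection hF hS hp (X ((tchart x₀).symm p))
  change _ = ((loc x₀ X p).1, -(loc x₀ X p).2
    - (2 : ℝ) • locNonlin (locSpray x₀ S) p (loc x₀ X p).1) at h
  have h2 : toLoc x₀ _ (X ((tchart x₀).symm p)) = loc x₀ X p := rfl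
  constructor
  · intro hh
    rw [IsHorizontal] at hh
    rw [hh, h2] at h
    have h3 := congrArg Prod.snd h
    simp only at h3
    have : (2 : ℝ) • ((loc x₀ X p).2 + locNonlin (locSpray x₀ S) p (loc x₀ X p).1) = 0 := by
      rw [show (2 : ℝ) • ((loc x₀ X p).2 + locNonlin (locSpray x₀ S) p (loc x₀ X p).1)
        = (loc x₀ X p).2 - (-(loc x₀ X p).2
          - (2 : ℝ) • locNonlin (locSpray x₀ S) p (loc x₀ X p).1) by module, ← h3, sub_self]
    exact (smul_eq_zero.1 this).resolve_left two_ne_zero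
  · intro hh
    refine toLoc_injective hw ?_
    rw [h, h2]
    ext
    · rfl
    · rw [add_comm, add_eq_zero_iff_eq_neg] at hh
      simp only [hh]
      module

theorem smoothFieldAt_hproj (hF : IsFinslerMetric F) (hS : IsGeodesicSpray F S) {x₀ : M}
    {p : E × E} (hp : p ∈ slitLoc E x₀) {X : Field E M}
    (hX : ContDiffAt ℝ ∞ (fun q => (loc x₀ X q).1) p) :
    ContDiffAt ℝ ∞ (loc x₀ (hproj S X)) p := by
  have hs := (isLocalSpray hF hS x₀).contDiffAt_spray p hp
  refine (hX.prodMk ((contDiffAt_locNonlin hs).clm_apply hX).neg).congr_of_eventuallyEq ?_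
  filter_upwards [(isOpen_slitLoc x₀).mem_nhds hp] with q hq
  exact loc_hproj hF hS hq X

theorem smoothField_hproj (hF : IsFinslerMetric F) (hS : IsGeodesicSpray F S) {X : Field E M}
    (hX : SmoothField X) : SmoothField (hproj S X) :=
  smoothField_of_loc fun _ _ hp => smoothFieldAt_hproj hF hS hp (hX.contDiffAt hp).fst

theorem smoothField_vproj (hF : IsFinslerMetric F) (hS : IsGeodesicSpray F S) {X : Field E M}
    (hX : SmoothField X) : SmoothField (vproj S X) := by
  refine smoothField_of_loc fun x₀ p hp => ?_
  have hs := (isLocalSpray hF hS x₀).contDiffAt_spray p hp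
  have hXp := hX.contDiffAt hp
  refine (contDiffAt_const (c := (0 : E)).prodMk
    (hXp.snd.add ((contDiffAt_locNonlin hs).clm_apply hXp.fst))).congr_of_eventuallyEq ?_
  filter_upwards [(isOpen_slitLoc x₀).mem_nhds hp] with q hq
  exact loc_vproj hF hS hq X

omit [FiniteDimensional ℝ E] [CompleteSpace E] [T2Space M]

theorem smoothField_almostTangent {X : Field E M} (hX : SmoothField X) :
    SmoothField (almostTangent X) :=
  smoothField_iff.2 fun w hw => smoothFieldAt_almostTangent (smoothField_iff.1 hX w hw)

theorem dproj_eq_zero_iff {x₀ : M} {w : TM E M} (hw : w ∈ tdom E x₀) (ξ : TTM w) :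
    dproj w ξ = 0 ↔ (toLoc x₀ w ξ).1 = 0 := by
  rw [← baseLoc_dproj hw]
  exact ⟨fun h => by rw [h, map_zero], fun h => baseLoc_injective hw (h.trans (map_zero _).symm)⟩

theorem smoothVertical_of_loc {X : Field E M} (hX : SmoothField X)
    (h : ∀ x₀ : M, ∀ p ∈ slitLoc E x₀, (loc x₀ X p).1 = 0) : SmoothVertical X := by
  refine ⟨hX, fun w hw => ?_⟩
  have hd := mem_tdom_self w
  rw [dproj_eq_zero_iff hd, ← loc_tchart hd]
  exact h _ _ ((tchart_mem_slitLoc hd).2 hw)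

theorem SmoothVertical.loc_fst {X : Field E M} (hX : SmoothVertical X) {x₀ : M} {p : E × E}
    (hp : p ∈ slitLoc E x₀) : (loc x₀ X p).1 = 0 :=
  (dproj_eq_zero_iff (tchart_symm_mem (slitLoc_subset x₀ hp)) _).1
    (hX.2 _ (tchart_symm_mem_slit hp))

theorem SmoothVertical.loc_eq {X : Field E M} (hX : SmoothVertical X) {x₀ : M} {p : E × E}
    (hp : p ∈ slitLoc E x₀) : loc x₀ X p = (0, (loc x₀ X p).2) := by
  rw [← hX.loc_fst hp]

theorem smoothVertical_almostTangent {X : Field E M} (hX : SmoothField X) :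
    SmoothVertical (almostTangent X) :=
  smoothVertical_of_loc (smoothField_almostTangent hX) fun x₀ p hp => by
    rw [loc_almostTangent (slitLoc_subset x₀ hp)]

theorem smoothVertical_vproj [FiniteDimensional ℝ E] [CompleteSpace E] [T2Space M]
    (hF : IsFinslerMetric F) (hS : IsGeodesicSpray F S) {X : Field E M}
    (hX : SmoothField X) : SmoothVertical (vproj S X) :=
  smoothVertical_of_loc (smoothField_vproj hF hS hX) fun x₀ p hp => by
    rw [loc_vproj hF hS hp]

theorem vlift_injective (w : TM E M) : Function.Injective (vlift w) := by
  intro u v h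
  have hw := mem_tdom_self w
  have := congrArg (toLoc w.1 w) h
  rw [toLoc_vlift hw, toLoc_vlift hw] at this
  exact baseLoc_injective hw (congrArg Prod.snd this)

theorem vdrop_vlift (w : TM E M) (u : TangM E w.1) : vdrop w (vlift w u) = u :=
  Function.leftInverse_invFun (vlift_injective w) u

theorem baseLoc_vdrop {x₀ : M} {w : TM E M} (hw : w ∈ tdom E x₀) {ξ : TTM w}
    (hξ : (toLoc x₀ w ξ).1 = 0) : baseLoc x₀ w.1 (vdrop w ξ) = (toLoc x₀ w ξ).2 := by
  have : ξ = vlift w (baseSymm x₀ w.1 (toLoc x₀ w ξ).2) := by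
    refine toLoc_injective hw ?_
    rw [toLoc_vlift hw, baseLoc_baseSymm hw, ← hξ]
  rw [this, vdrop_vlift, baseLoc_baseSymm hw, ← this]

theorem dproj_surjective (w : TM E M) : Function.Surjective (dproj w) := by
  intro u
  have hw := mem_tdom_self w
  refine ⟨ofLoc w.1 w (baseLoc w.1 w.1 u, 0), baseLoc_injective hw ?_⟩
  rw [baseLoc_dproj hw, toLoc_ofLoc hw]

theorem dproj_invFun (w : TM E M) (u : TangM E w.1) :
    dproj w (Function.invFun (dproj w) u) = u :=
  Function.invFun_eq (dproj_surjective w u)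

theorem vertMetric_eq (hF : IsFinslerMetric F) {x₀ : M} {p : E × E} (hp : p ∈ slitLoc E x₀)
    {Y Z : Field E M} (hY : (loc x₀ Y p).1 = 0) (hZ : (loc x₀ Z p).1 = 0) :
    vertMetric F Y Z ((tchart x₀).symm p)
      = locMetric (locEnergy x₀ F) p (loc x₀ Y p).2 (loc x₀ Z p).2 := by
  have hp' := slitLoc_subset x₀ hp
  have hw := tchart_symm_mem (M := M) hp'
  rw [vertMetric, fundTensor_eq hF hw (tchart_symm_mem_slit hp), baseLoc_vdrop hw hY,
    baseLoc_vdrop hw hZ, tchart_tchart_symm hp']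
  rfl

theorem vertCartan_eq (hF : IsFinslerMetric F) {x₀ : M} {p : E × E} (hp : p ∈ slitLoc E x₀)
    {X Y Z : Field E M} (hX : (loc x₀ X p).1 = 0) (hY : (loc x₀ Y p).1 = 0)
    (hZ : (loc x₀ Z p).1 = 0) :
    vertCartan F X Y Z ((tchart x₀).symm p)
      = locCartan (locEnergy x₀ F) p (loc x₀ X p).2 (loc x₀ Y p).2 (loc x₀ Z p).2 := by
  have hp' := slitLoc_subset x₀ hp
  have hw := tchart_symm_mem (M := M) hp'
  rw [vertCartan, cartanTensor_eq hF hw (tchart_symm_mem_slit hp), baseLoc_vdrop hw hX,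
    baseLoc_vdrop hw hY, baseLoc_vdrop hw hZ, tchart_tchart_symm hp']
  rfl

end Projections

/-! ### Coordinate formulas for brackets and for derivatives of the Cartan tensor. -/

section LocalCovariantDerivative

variable {E : Type*} [NormedAddCommGroup E] [NormedSpace ℝ E]
  {H : Type*} [NormedAddCommGroup H] [NormedSpace ℝ H]
  {Ω : Set (E × E)} {L : E × E → ℝ} {s : E × E → E}

/-- The derivatives of `a` enter the base part of the bracket and, through `N`, its fibre part; the
vertical projection cancels them. The fibre derivative of `N` is what supplies `Γ`. -/
theorem vert_locBracket {p : E × E} (hs : ContDiffAt ℝ ∞ s p) {a c : E × E → E}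
    (ha : DifferentiableAt ℝ a p) (hc : DifferentiableAt ℝ c p) {A C : E × E → E × E}
    (hA : A =ᶠ[𝓝 p] fun q => (a q, -locNonlin s q (a q))) (hC : C =ᶠ[𝓝 p] fun q => (0, c q)) :
    (fderiv ℝ C p (A p) - fderiv ℝ A p (C p)).2
        + locNonlin s p (fderiv ℝ C p (A p) - fderiv ℝ A p (C p)).1
      = fderiv ℝ c p (A p) + locChris s p (a p) (c p) := by
  have hN := differentiableAt_of_contDiffAt (contDiffAt_locNonlin hs)
  have h1 : ∀ ζ, fderiv ℝ C p ζ = (0, fderiv ℝ c p ζ) := by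
    intro ζ
    rw [hC.fderiv_eq, ((hasFDerivAt_const (0 : E) p).prodMk hc.hasFDerivAt).fderiv]
    rfl
  have h2 : ∀ ζ, fderiv ℝ A p ζ = (fderiv ℝ a p ζ,
      -(fderiv ℝ (locNonlin s) p ζ (a p) + locNonlin s p (fderiv ℝ a p ζ))) := by
    intro ζ
    rw [hA.fderiv_eq, (ha.hasFDerivAt.prodMk (hN.clm_apply ha).hasFDerivAt.fun_neg).fderiv,
      ContinuousLinearMap.prod_apply, neg_apply, fderiv_clm_apply_apply hN ha]
  rw [h1, h2, hC.self_of_nhds]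
  simp only [locChris, Prod.snd_sub, Prod.fst_sub, map_sub, map_zero]
  abel

theorem differentiableAt_fun_comp {K G : Type*} [NormedAddCommGroup K] [NormedSpace ℝ K]
    [NormedAddCommGroup G] [NormedSpace ℝ G] {A : K → G} {b : H → K} {x : H}
    (hA : DifferentiableAt ℝ A (b x)) (hb : DifferentiableAt ℝ b x) :
    DifferentiableAt ℝ (fun y => A (b y)) x :=
  hA.comp x hb

theorem fderiv_fun_comp_apply {K G : Type*} [NormedAddCommGroup K] [NormedSpace ℝ K]
    [NormedAddCommGroup G] [NormedSpace ℝ G] {A : K → G} {b : H → K} {x : H}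
    (hA : DifferentiableAt ℝ A (b x)) (hb : DifferentiableAt ℝ b x) (ζ : H) :
    fderiv ℝ (fun y => A (b y)) x ζ = fderiv ℝ A (b x) (fderiv ℝ b x ζ) :=
  DFunLike.congr_fun (fderiv_comp (g := A) (f := b) x hA hb) ζ

set_option maxSynthPendingDepth 3 in
theorem fderiv_trilinear_comp {K K' G : Type*} [NormedAddCommGroup K] [NormedSpace ℝ K]
    [NormedAddCommGroup K'] [NormedSpace ℝ K'] [NormedAddCommGroup G] [NormedSpace ℝ G]
    {T : K' → K →L[ℝ] K →L[ℝ] K →L[ℝ] G} {b : H → K'} {u v z : H → K} {x : H}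
    (hT : DifferentiableAt ℝ T (b x)) (hb : DifferentiableAt ℝ b x) (hu : DifferentiableAt ℝ u x)
    (hv : DifferentiableAt ℝ v x) (hz : DifferentiableAt ℝ z x) (ζ : H) :
    fderiv ℝ (fun y => T (b y) (u y) (v y) (z y)) x ζ
      = fderiv ℝ (fun q => T q (u x) (v x) (z x)) (b x) (fderiv ℝ b x ζ)
        + T (b x) (fderiv ℝ u x ζ) (v x) (z x) + T (b x) (u x) (fderiv ℝ v x ζ) (z x)
        + T (b x) (u x) (v x) (fderiv ℝ z x ζ) := by
  have hTb := differentiableAt_fun_comp (G := K →L[ℝ] K →L[ℝ] K →L[ℝ] G) hT hb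
  have hTb' := fderiv_fun_comp_apply (G := K →L[ℝ] K →L[ℝ] K →L[ℝ] G) hT hb ζ
  have c1 := hT.clm_apply (differentiableAt_const (u x))
  have c2 := c1.clm_apply (differentiableAt_const (v x))
  have d1 := hTb.clm_apply hu
  have d2 := d1.clm_apply hv
  rw [fderiv_clm_apply_apply d2 hz, fderiv_clm_apply_apply d1 hv, fderiv_clm_apply_apply hTb hu,
    hTb', fderiv_clm_apply_apply c2 (differentiableAt_const _),
    fderiv_clm_apply_apply c1 (differentiableAt_const _),
    fderiv_clm_apply_apply hT (differentiableAt_const _)]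
  simp only [add_apply, fderiv_fun_const, Pi.zero_apply, zero_apply, map_zero, add_zero]

theorem fderiv_locCartan_comp {b : H → E × E} {u v z : H → E} {x : H}
    (hL : ContDiffAt ℝ ∞ L (b x)) (hb : DifferentiableAt ℝ b x) (hu : DifferentiableAt ℝ u x)
    (hv : DifferentiableAt ℝ v x) (hz : DifferentiableAt ℝ z x) (ζ : H) :
    fderiv ℝ (fun y => locCartan L (b y) (u y) (v y) (z y)) x ζ
      = fderiv ℝ (fun q => locCartan L q (u x) (v x)) (b x) (fderiv ℝ b x ζ) (z x)
        + locCartan L (b x) (fderiv ℝ u x ζ) (v x) (z x)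
        + locCartan L (b x) (u x) (fderiv ℝ v x ζ) (z x)
        + locCartan L (b x) (u x) (v x) (fderiv ℝ z x ζ) := by
  have hT := differentiableAt_of_contDiffAt
    (contDiffAt_fderiv (contDiffAt_fderiv (contDiffAt_fderiv hL)))
  have hin : ∀ {f : H → E}, DifferentiableAt ℝ f x →
      DifferentiableAt ℝ (fun y => ((0 : E), f y)) x ∧
      fderiv ℝ (fun y => ((0 : E), f y)) x ζ = (0, fderiv ℝ f x ζ) := by
    intro f hf
    refine ⟨(differentiableAt_const _).prodMk hf, ?_⟩
    rw [((hasFDerivAt_const (0 : E) x).prodMk hf.hasFDerivAt).fderiv]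
    rfl
  have hc' := differentiableAt_of_contDiffAt (contDiffAt_locCartan hL
      (contDiffAt_const (c := u x)) (contDiffAt_const (c := v x)))
  have e2 : fderiv ℝ (fun q => locCartan L q (u x) (v x)) (b x) (fderiv ℝ b x ζ) (z x)
      = fderiv ℝ (fun q => locCartan L q (u x) (v x) (z x)) (b x) (fderiv ℝ b x ζ) := by
    rw [fderiv_clm_apply_apply hc' (differentiableAt_const _)]
    simp
  have h := fderiv_trilinear_comp hT hb (hin hu).1 (hin hv).1 (hin hz).1 ζ
  rw [(hin hz).2, (hin hu).2, (hin hv).2] at h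
  have c1 := hT.clm_apply (differentiableAt_const ((0 : E), u x))
  have c2 := c1.clm_apply (differentiableAt_const ((0 : E), v x))
  have c3 := c2.clm_apply (differentiableAt_const ((0 : E), z x))
  have d1 := (differentiableAt_fun_comp hT hb).clm_apply (hin hu).1
  have d2 := d1.clm_apply (hin hv).1
  have d3 := d2.clm_apply (hin hz).1
  rw [e2]
  simp only [locCartan_apply]
  rw [fderiv_const_mul d3, fderiv_const_mul c3, smul_apply, smul_apply, smul_eq_mul,
    smul_eq_mul]
  refine (congrArg (fun r : ℝ => 1 / 2 * r) h).trans ?_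
  ring

end LocalCovariantDerivative

theorem hasDerivAt_of_hasMFDerivAt {G : Type*} [NormedAddCommGroup G] [NormedSpace ℝ G] {f : ℝ → G}
    {t : ℝ} {f' : ℝ →L[ℝ] G} (h : HasMFDerivAt 𝓘(ℝ, ℝ) 𝓘(ℝ, G) f t f') :
    HasDerivAt f (f' 1) t := by
  have h' : HasFDerivAt f f' t := h.hasFDerivAt
  exact h'.hasDerivAt

/-! ### The derivative of the Cartan tensor along a geodesic field. -/

section CartanDerivative

variable {E : Type*} [NormedAddCommGroup E] [NormedSpace ℝ E]
  {M : Type*} [TopologicalSpace M] [ChartedSpace E M] [IsManifold 𝓘(ℝ, E) ∞ M]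
  {F : TM E M → ℝ} {S : Field E M}

theorem tchart_symm_fst {x₀ : M} {p : E × E} (hp : p ∈ (tchart x₀).target) :
    ((tchart (M := M) x₀).symm p).1 = (extChartAt 𝓘(ℝ, E) x₀).symm p.1 := by
  have hw := tchart_symm_mem (M := M) hp
  have h := tchart_apply hw
  rw [tchart_tchart_symm hp] at h
  have h1 := congrArg Prod.fst h
  simp only at h1
  rw [h1, (extChartAt 𝓘(ℝ, E) x₀).left_inv]
  rw [extChartAt_source]
  exact hw

theorem locB_fst {x₀ : M} {p : E × E} (hp : p ∈ (tchart x₀).target) (V : (x : M) → TangM E x) :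
    locB x₀ V p.1 = baseLoc x₀ _ (V ((tchart (M := M) x₀).symm p).1) := by
  rw [tchart_symm_fst hp, locB]

theorem locB_extChartAt {x₀ x : M} (hx : x ∈ (chartAt E x₀).source) (V : (x : M) → TangM E x) :
    locB x₀ V (extChartAt 𝓘(ℝ, E) x₀ x) = baseLoc x₀ x (V x) := by
  rw [locB, (extChartAt 𝓘(ℝ, E) x₀).left_inv (by rwa [extChartAt_source])]

theorem contDiffAt_locB {x₀ x : M} (hx : x ∈ (chartAt E x₀).source) {V : (x : M) → TangM E x}
    (hV : ContMDiffAt 𝓘(ℝ, E) 𝓘(ℝ, E).tangent ∞ (fun x => (⟨x, V x⟩ : TM E M)) x) :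
    ContDiffAt ℝ ∞ (locB x₀ V) (extChartAt 𝓘(ℝ, E) x₀ x) := by
  have hx' : x ∈ (extChartAt 𝓘(ℝ, E) x₀).source := by rwa [extChartAt_source]
  have ht := (extChartAt 𝓘(ℝ, E) x₀).map_source hx'
  have hsymm : ContMDiffAt 𝓘(ℝ, E) 𝓘(ℝ, E) ∞ (extChartAt 𝓘(ℝ, E) x₀).symm
      (extChartAt 𝓘(ℝ, E) x₀ x) :=
    (contMDiffOn_extChartAt_symm _).contMDiffAt ((isOpen_extChartAt_target x₀).mem_nhds ht)
  have hl := (extChartAt 𝓘(ℝ, E) x₀).left_inv hx'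
  have h1 : ContMDiffAt 𝓘(ℝ, E) 𝓘(ℝ, E × E) ∞
      (fun y => tchart x₀ (⟨(extChartAt 𝓘(ℝ, E) x₀).symm y,
        V ((extChartAt 𝓘(ℝ, E) x₀).symm y)⟩ : TM E M)) (extChartAt 𝓘(ℝ, E) x₀ x) := by
    have h2 : ContMDiffAt 𝓘(ℝ, E) 𝓘(ℝ, E).tangent ∞ (fun x => (⟨x, V x⟩ : TM E M))
      ((extChartAt 𝓘(ℝ, E) x₀).symm (extChartAt 𝓘(ℝ, E) x₀ x)) := by rwa [hl]
    have h3 := h2.comp (extChartAt 𝓘(ℝ, E) x₀ x) hsymm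
    refine ContMDiffAt.comp _ (contMDiffAt_tchart (x₀ := x₀) ?_) h3
    change (extChartAt 𝓘(ℝ, E) x₀).symm (extChartAt 𝓘(ℝ, E) x₀ x) ∈ (chartAt E x₀).source
    rwa [hl]
  refine (contMDiffAt_iff_contDiffAt.1 h1).snd.congr_of_eventuallyEq ?_
  filter_upwards [(isOpen_extChartAt_target x₀).mem_nhds ht] with y hy
  have hy' := (extChartAt 𝓘(ℝ, E) x₀).map_target hy
  rw [extChartAt_source] at hy'
  rw [tchart_apply (w := (⟨(extChartAt 𝓘(ℝ, E) x₀).symm y,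
        V ((extChartAt 𝓘(ℝ, E) x₀).symm y)⟩ : TM E M)) hy']
  rfl

theorem contMDiffAt_extend_base {x : M} (u : TangM E x) :
    ContMDiffAt 𝓘(ℝ, E) 𝓘(ℝ, E).tangent ∞
      (fun y => (⟨y, FiberBundle.extend E u y⟩ : TM E M)) x := by
  rw [Bundle.contMDiffAt_section]
  refine (contMDiffAt_const (c := (trivializationAt E (TangentSpace 𝓘(ℝ, E)) x
    ⟨x, u⟩).2)).congr_of_eventuallyEq ?_
  have hb := (trivializationAt E (TangentSpace 𝓘(ℝ, E)) x).open_baseSet.mem_nhds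
    (FiberBundle.mem_baseSet_trivializationAt' x)
  filter_upwards [hb] with y hy
  have h := (trivializationAt E (TangentSpace 𝓘(ℝ, E)) x).apply_mk_symm hy
    (trivializationAt E (TangentSpace 𝓘(ℝ, E)) x ⟨x, u⟩).2
  exact (congrArg Prod.snd h :)

theorem loc_vliftField {x₀ : M} {p : E × E} (hp : p ∈ (tchart x₀).target)
    (V : (x : M) → TangM E x) : loc x₀ (vliftField V) p = (0, locB x₀ V p.1) := by
  rw [loc, vliftField, toLoc_vlift (tchart_symm_mem hp), locB_fst hp]

variable [FiniteDimensional ℝ E] [CompleteSpace E] [T2Space M]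

/-- The horizontal projection sees only the base component, so the arbitrary preimage under `dπ` in
the definition plays no role. -/
theorem loc_hliftField (hF : IsFinslerMetric F) (hS : IsGeodesicSpray F S) {x₀ : M} {p : E × E}
    (hp : p ∈ slitLoc E x₀) (U : (x : M) → TangM E x) :
    loc x₀ (hliftField S U) p
      = (locB x₀ U p.1, -locNonlin (locSpray x₀ S) p (locB x₀ U p.1)) := by
  have hp' := slitLoc_subset x₀ hp
  rw [hliftField, loc_hproj hF hS hp, loc, ← baseLoc_dproj (tchart_symm_mem hp'), dproj_invFun,
    locB_fst hp']

theorem baseLoc_affineDeriv (hF : IsFinslerMetric F) (hS : IsGeodesicSpray F S) {x₀ : M}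
    {p : E × E} (hp : p ∈ slitLoc E x₀) {U V : (x : M) → TangM E x}
    (hU : ContDiffAt ℝ ∞ (locB x₀ U) p.1) (hV : ContDiffAt ℝ ∞ (locB x₀ V) p.1) :
    baseLoc x₀ _ (affineDeriv S ((tchart x₀).symm p) U V)
      = fderiv ℝ (locB x₀ V) p.1 (locB x₀ U p.1)
        + locChris (locSpray x₀ S) p (locB x₀ U p.1) (locB x₀ V p.1) := by
  have hp' := slitLoc_subset x₀ hp
  have hw := tchart_symm_mem (M := M) hp'
  have hs := (isLocalSpray hF hS x₀).contDiffAt_spray p hp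
  have ha : ContDiffAt ℝ ∞ (fun q : E × E => locB x₀ U q.1) p := hU.comp p contDiffAt_fst
  have hc : ContDiffAt ℝ ∞ (fun q : E × E => locB x₀ V q.1) p := hV.comp p contDiffAt_fst
  have hA : loc x₀ (hliftField S U) =ᶠ[𝓝 p]
      fun q => (locB x₀ U q.1, -locNonlin (locSpray x₀ S) q (locB x₀ U q.1)) := by
    filter_upwards [(isOpen_slitLoc x₀).mem_nhds hp] with q hq
    exact loc_hliftField hF hS hq U
  have hC : loc x₀ (vliftField V) =ᶠ[𝓝 p] fun q => (0, locB x₀ V q.1) := by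
    filter_upwards [(isOpen_slitLoc x₀).mem_nhds hp] with q hq
    exact loc_vliftField (slitLoc_subset x₀ hq) V
  have hAs : ContDiffAt ℝ ∞ (loc x₀ (hliftField S U)) p :=
    (ha.prodMk ((contDiffAt_locNonlin hs).clm_apply ha).neg).congr_of_eventuallyEq hA
  have hCs : ContDiffAt ℝ ∞ (loc x₀ (vliftField V)) p :=
    (contDiffAt_const.prodMk hc).congr_of_eventuallyEq hC
  have h := loc_vproj hF hS hp (bracket (hliftField S U) (vliftField V))
  rw [loc_bracket hp' ((smoothFieldAt_symm_iff hp').2 hAs) ((smoothFieldAt_symm_iff hp').2 hCs),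
    vert_locBracket hs (differentiableAt_of_contDiffAt ha) (differentiableAt_of_contDiffAt hc)
      hA hC, hA.self_of_nhds] at h
  have h1 : toLoc x₀ _ (vproj S (bracket (hliftField S U) (vliftField V)) ((tchart x₀).symm p))
    = _ := h
  rw [affineDeriv, baseLoc_vdrop hw (by rw [h1]), h1]
  simp only
  congr 1
  have := fderiv_comp (g := locB x₀ V) (f := Prod.fst) p (differentiableAt_of_contDiffAt hV)
    differentiableAt_fst
  have h2 := congrArg (fun T => T (locB x₀ U p.1,
    -locNonlin (locSpray x₀ S) p (locB x₀ U p.1))) this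
  refine Eq.trans h2 ?_
  simp [fderiv_fst]

omit [FiniteDimensional ℝ E] [CompleteSpace E] [T2Space M] in
/-- A vector field whose integral curve is a geodesic is differentiated by the spray. -/
theorem fderiv_locB_geodesicExtension {x₀ : M} {w : TM E M} (hw : w ∈ tdom E x₀)
    {W : (x : M) → TangM E x} (hW : IsGeodesicExtension S w W) :
    fderiv ℝ (locB x₀ W) (extChartAt 𝓘(ℝ, E) x₀ w.1) (baseLoc x₀ w.1 w.2)
      = locSpray x₀ S (tchart x₀ w) := by
  obtain ⟨⟨O, hO, hwO, hne, hsm⟩, hWw, γ, hγ0, hγ, hδ⟩ := hW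
  -- The computation takes place at `(γ 0, W (γ 0))` and is moved to `w` only at the end, which
  -- avoids transporting tangent vectors.
  have hδ0 : (⟨γ 0, W (γ 0)⟩ : TM E M) = w := by rw [hγ0, hWw]
  have hd := contDiffAt_locB (x₀ := x₀) hw ((hsm w.1 hwO).contMDiffAt (hO.mem_nhds hwO))
  have hw0 : (⟨γ 0, W (γ 0)⟩ : TM E M) ∈ tdom E x₀ := by rwa [hδ0]
  rw [← hγ0] at hd
  have d1 : HasDerivAt (fun t => extChartAt 𝓘(ℝ, E) x₀ (γ t)) (baseLoc x₀ (γ 0) (W (γ 0))) 0 := by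
    have := hasDerivAt_of_hasMFDerivAt ((hasMFDerivAt_baseChart (x₀ := x₀) (x := γ 0) hw0).comp 0
      hγ.self_of_nhds)
    refine this.congr_deriv ?_
    exact congrArg (baseLoc x₀ (γ 0)) (one_smul ℝ (W (γ 0)))
  have d2 : HasDerivAt (fun t => tchart x₀ (⟨γ t, W (γ t)⟩ : TM E M))
      (toLoc x₀ _ (S (⟨γ 0, W (γ 0)⟩ : TM E M))) 0 := by
    have := hasDerivAt_of_hasMFDerivAt ((hasMFDerivAt_tchart hw0).comp 0 hδ.self_of_nhds)
    refine this.congr_deriv ?_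
    exact congrArg (toLoc x₀ _) (one_smul ℝ (S (⟨γ 0, W (γ 0)⟩ : TM E M)))
  have d3 := (differentiableAt_of_contDiffAt hd).hasFDerivAt.comp_hasDerivAt (0 : ℝ) d1
  have hev : locB x₀ W ∘ (fun t => extChartAt 𝓘(ℝ, E) x₀ (γ t)) =ᶠ[𝓝 0]
      fun t => (tchart x₀ (⟨γ t, W (γ t)⟩ : TM E M)).2 := by
    have hc : ContinuousAt γ 0 := hγ.self_of_nhds.continuousAt
    filter_upwards [hc.preimage_mem_nhds ((chartAt E x₀).open_source.mem_nhds hw0)] with t ht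
    rw [Function.comp_apply, locB_extChartAt ht, tchart_apply (w := (⟨γ t, W (γ t)⟩ : TM E M)) ht]
  -- The fibre coordinate of the velocity curve is differentiated twice over: by the chain rule
  -- through `W`, and as an integral curve of `S`.
  have d5 := (d3.congr_of_eventuallyEq hev.symm).unique d2.snd
  have key : fderiv ℝ (locB x₀ W) (extChartAt 𝓘(ℝ, E) x₀ (⟨γ 0, W (γ 0)⟩ : TM E M).1)
      (baseLoc x₀ (⟨γ 0, W (γ 0)⟩ : TM E M).1 (⟨γ 0, W (γ 0)⟩ : TM E M).2)
      = locSpray x₀ S (tchart x₀ (⟨γ 0, W (γ 0)⟩ : TM E M)) := by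
    rw [locSpray, loc_tchart hw0]
    exact d5
  rwa [hδ0] at key

/-- Along the geodesic the base point `(x, W x)` moves with velocity `(y, s)`, and `D^W_W V = ∂_y V
+ N V` because `Γ(y, ·) = N`. The derivatives of `U`, `V`, `Z` then cancel, and no derivative of `W`
beyond `s` survives. -/
theorem cartanDeriv_eq (hF : IsFinslerMetric F) (hS : IsGeodesicSpray F S) {x₀ : M} {w : TM E M}
    (hw : w ∈ tdom E x₀) (hs : w ∈ slit E M) {W U V Z : (x : M) → TangM E x}
    (hW : IsGeodesicExtension S w W)
    (hU : ContDiffAt ℝ ∞ (locB x₀ U) (extChartAt 𝓘(ℝ, E) x₀ w.1))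
    (hV : ContDiffAt ℝ ∞ (locB x₀ V) (extChartAt 𝓘(ℝ, E) x₀ w.1))
    (hZ : ContDiffAt ℝ ∞ (locB x₀ Z) (extChartAt 𝓘(ℝ, E) x₀ w.1)) :
    cartanDeriv F S w W U V Z
      = locLandsberg (locEnergy x₀ F) (locSpray x₀ S) (tchart x₀ w) (baseLoc x₀ w.1 (U w.1))
        (baseLoc x₀ w.1 (V w.1)) (baseLoc x₀ w.1 (Z w.1)) := by
  have hp := (tchart_mem_slitLoc hw).2 hs
  have hsp := isLocalSpray hF hS x₀
  have hgeo := fderiv_locB_geodesicExtension hw hW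
  obtain ⟨⟨O, hO, hwO, hne, hsm⟩, hWw, -⟩ := hW
  have hWs := contDiffAt_locB (x₀ := x₀) hw ((hsm w.1 hwO).contMDiffAt (hO.mem_nhds hwO))
  have hBW : baseLoc x₀ w.1 (W w.1) = baseLoc x₀ w.1 w.2 := by rw [hWw]
  have hpt := tchart_apply hw
  have hp1 : (tchart x₀ w).1 = extChartAt 𝓘(ℝ, E) x₀ w.1 := by rw [hpt]
  have hp2 : (tchart x₀ w).2 = baseLoc x₀ w.1 w.2 := by rw [hpt]
  have lW : locB x₀ W (extChartAt 𝓘(ℝ, E) x₀ w.1) = baseLoc x₀ w.1 w.2 := by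
    rw [locB_extChartAt hw, hBW]
  have lU := locB_extChartAt (x₀ := x₀) (x := w.1) hw U
  have lV := locB_extChartAt (x₀ := x₀) (x := w.1) hw V
  have lZ := locB_extChartAt (x₀ := x₀) (x := w.1) hw Z
  have hb : (extChartAt 𝓘(ℝ, E) x₀ w.1, locB x₀ W (extChartAt 𝓘(ℝ, E) x₀ w.1))
      = tchart x₀ w := by rw [hpt, lW]
  have hbd : DifferentiableAt ℝ (fun y => (y, locB x₀ W y)) (extChartAt 𝓘(ℝ, E) x₀ w.1) :=
    differentiableAt_id.prodMk (differentiableAt_of_contDiffAt hWs)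
  have haff : ∀ {V : (x : M) → TangM E x},
      ContDiffAt ℝ ∞ (locB x₀ V) (extChartAt 𝓘(ℝ, E) x₀ w.1) →
      baseLoc x₀ w.1 (affineDeriv S w W V)
        = fderiv ℝ (locB x₀ V) (extChartAt 𝓘(ℝ, E) x₀ w.1) (baseLoc x₀ w.1 w.2)
          + locNonlin (locSpray x₀ S) (tchart x₀ w) (baseLoc x₀ w.1 (V w.1)) := by
    intro V hV
    have h := baseLoc_affineDeriv hF hS hp (U := W) (V := V) (by rwa [hp1]) (by rwa [hp1])
    rw [tchart_symm_tchart hw, hp1, lW, locB_extChartAt hw] at h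
    rw [h, ← hp2, hsp.locChris_snd hp]
  -- the derivative of the Cartan tensor along `W`
  have hf : HasMFDerivAt 𝓘(ℝ, E) 𝓘(ℝ, ℝ)
      (fun x => cartanTensor F ⟨x, W x⟩ (U x) (V x) (Z x)) w.1
      ((fderiv ℝ (fun y => locCartan (locEnergy x₀ F) (y, locB x₀ W y) (locB x₀ U y)
        (locB x₀ V y) (locB x₀ Z y)) (extChartAt 𝓘(ℝ, E) x₀ w.1)).comp (baseLoc x₀ w.1)) := by
    have hd : ContDiffAt ℝ ∞ (fun y => locCartan (locEnergy x₀ F) (y, locB x₀ W y) (locB x₀ U y)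
        (locB x₀ V y) (locB x₀ Z y)) (extChartAt 𝓘(ℝ, E) x₀ w.1) := by
      refine ContDiffAt.clm_apply (contDiffAt_locCartan_comp ?_ (contDiffAt_id.prodMk hWs) hU hV) hZ
      have h := hsp.contDiffAt_lagrangian _ hp
      rwa [← hb] at h
    have h1 := (differentiableAt_of_contDiffAt hd).hasFDerivAt.hasMFDerivAt.comp w.1
      (hasMFDerivAt_baseChart (x₀ := x₀) (x := w.1) hw)
    refine h1.congr_of_eventuallyEq ?_
    filter_upwards [hO.mem_nhds hwO, (chartAt E x₀).open_source.mem_nhds hw] with x hxO hx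
    rw [cartanTensor_eq hF (x₀ := x₀) (w := (⟨x, W x⟩ : TM E M)) hx (hne x hxO),
      tchart_apply (w := (⟨x, W x⟩ : TM E M)) hx, Function.comp_apply, locB_extChartAt hx,
      locB_extChartAt hx, locB_extChartAt hx, locB_extChartAt hx]
  have hfirst : mfderiv 𝓘(ℝ, E) 𝓘(ℝ, ℝ)
      (fun x => cartanTensor F ⟨x, W x⟩ (U x) (V x) (Z x)) w.1 (W w.1)
      = fderiv ℝ (fun y => locCartan (locEnergy x₀ F) (y, locB x₀ W y) (locB x₀ U y)
        (locB x₀ V y) (locB x₀ Z y)) (extChartAt 𝓘(ℝ, E) x₀ w.1) (baseLoc x₀ w.1 w.2) := by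
    rw [← hBW]
    exact DFunLike.congr_fun hf.mfderiv (W w.1)
  have hbf : fderiv ℝ (fun y => (y, locB x₀ W y)) (extChartAt 𝓘(ℝ, E) x₀ w.1)
      (baseLoc x₀ w.1 w.2) = ((tchart x₀ w).2, locSpray x₀ S (tchart x₀ w)) := by
    have h : HasFDerivAt (fun y => (y, locB x₀ W y)) _ (extChartAt 𝓘(ℝ, E) x₀ w.1) :=
      (hasFDerivAt_id _).prodMk (differentiableAt_of_contDiffAt hWs).hasFDerivAt
    rw [h.fderiv, ContinuousLinearMap.prod_apply, hgeo, hp2]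
    rfl
  rw [fderiv_locCartan_comp (by rw [hb]; exact hsp.contDiffAt_lagrangian _ hp) hbd
    (differentiableAt_of_contDiffAt hU) (differentiableAt_of_contDiffAt hV)
    (differentiableAt_of_contDiffAt hZ), hb, hbf, lU, lV, lZ] at hfirst
  unfold cartanDeriv
  refine (congrArg (fun r : ℝ => r - cartanTensor F w (affineDeriv S w W U) (V w.1) (Z w.1)
    - cartanTensor F w (U w.1) (affineDeriv S w W V) (Z w.1)
    - cartanTensor F w (U w.1) (V w.1) (affineDeriv S w W Z)) hfirst).trans ?_
  rw [cartanTensor_eq hF hw hs, cartanTensor_eq hF hw hs, cartanTensor_eq hF hw hs, haff hU,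
    haff hV, haff hZ, locLandsberg_apply, locCartan_add_left, locCartan_add_right, map_add,
    add_apply, add_apply]
  ring

end CartanDerivative

/-! ### Solutions of second order equations and fields extending their velocity. -/

section IntegralCurves

variable {E : Type*} [NormedAddCommGroup E] [NormedSpace ℝ E]

/-- Bootstrapping: if `σ` is `Cⁿ`, then its derivative `v ∘ σ` is `Cⁿ`, so `σ` is `Cⁿ⁺¹`. -/
theorem contDiffOn_of_hasDerivAt {v : E → E} {Ω : Set E} (hv : ContDiffOn ℝ ∞ v Ω) {σ : ℝ → E}
    {I : Set ℝ} (hI : IsOpen I) (hσ : ∀ t ∈ I, σ t ∈ Ω)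
    (hd : ∀ t ∈ I, HasDerivAt σ (v (σ t)) t) : ContDiffOn ℝ ∞ σ I := by
  have hdiff : DifferentiableOn ℝ σ I := fun t ht => (hd t ht).differentiableAt.differentiableWithinAt
  rw [contDiffOn_infty]
  intro n
  induction n with
  | zero => exact contDiffOn_zero.2 hdiff.continuousOn
  | succ n ih =>
    rw [Nat.cast_succ, contDiffOn_succ_iff_deriv_of_isOpen hI]
    refine ⟨hdiff, fun h => absurd h (by simp), ?_⟩
    refine ContDiffOn.congr (f := v ∘ σ) ?_ fun t ht => (hd t ht).deriv
    exact (hv.of_le (by exact_mod_cast le_top)).comp ih hσ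

/-- Extension of the velocity of a solution of a second order equation to a vector field. -/
theorem exists_velocity_extension [CompleteSpace E] {Ω : Set (E × E)} (hΩ : IsOpen Ω)
    {s : E × E → E}
    (hs : ∀ q ∈ Ω, ContDiffAt ℝ ∞ s q) {p : E × E} (hp : p ∈ Ω) (hp0 : p.2 ≠ 0) :
    ∃ (O : Set E) (W : E → E) (σ : ℝ → E × E), IsOpen O ∧ p.1 ∈ O ∧ ContDiffOn ℝ ∞ W O ∧
      (∀ x ∈ O, W x ≠ 0) ∧ W p.1 = p.2 ∧ σ 0 = p ∧
      ∀ᶠ t in 𝓝 0, σ t ∈ Ω ∧ HasDerivAt σ ((σ t).2, s (σ t)) t ∧ W (σ t).1 = (σ t).2 := by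
  set v : E × E → E × E := fun q => (q.2, s q) with hv
  have hvs : ∀ q ∈ Ω, ContDiffAt ℝ ∞ v q := fun q hq => contDiffAt_snd.prodMk (hs q hq)
  obtain ⟨σ, hσ0, ε, hε, hd⟩ := ((hvs p hp).of_le (m := 1) (by simp)).exists_forall_mem_closedBall_exists_eq_forall_mem_Ioo_hasDerivAt₀ 0
  -- Since `ℓ` does not vanish on the initial velocity, `ℓ` of the position is a local coordinate
  -- for time. `W x` will be the velocity at the time when the curve has the same value of `ℓ` as
  -- `x`, so `W` is constant on the level sets of `ℓ`.
  obtain ⟨ℓ, hℓ⟩ := SeparatingDual.exists_ne_zero (R := ℝ) hp0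
  have hIoo : Ioo (0 - ε) (0 + ε) ∈ 𝓝 (0 : ℝ) := Ioo_mem_nhds (by linarith) (by linarith)
  have hσc : ContinuousAt σ 0 := (hd 0 (mem_of_mem_nhds hIoo)).continuousAt
  have hmem : ∀ᶠ t in 𝓝 (0 : ℝ), t ∈ Ioo (0 - ε) (0 + ε) ∧ σ t ∈ Ω ∧ ℓ (σ t).2 ≠ 0 := by
    refine Filter.Eventually.and hIoo (Filter.Eventually.and (hσc.preimage_mem_nhds (hΩ.mem_nhds (hσ0.symm ▸ hp))) ?_)
    refine (ContinuousAt.comp (g := fun q : E × E => ℓ q.2) (by fun_prop) hσc).eventually_ne ?_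
    rwa [Function.comp_apply, hσ0]
  obtain ⟨I, hI, hIo, hI0⟩ := eventually_nhds_iff.1 hmem
  have hσs : ContDiffOn ℝ ∞ σ I :=
    contDiffOn_of_hasDerivAt (fun q hq => (hvs q hq).contDiffWithinAt) hIo
      (fun t ht => (hI t ht).2.1) fun t ht => hd t (hI t ht).1
  have hσt : ∀ t ∈ I, ContDiffAt ℝ ∞ σ t := fun t ht => hσs.contDiffAt (hIo.mem_nhds ht)
  set h : ℝ → ℝ := fun t => ℓ (σ t).1 with hh
  have hhs : ∀ t ∈ I, ContDiffAt ℝ ∞ h t := fun t ht => ℓ.contDiff.contDiffAt.comp t (hσt t ht).fst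
  have hhd : ∀ t ∈ I, HasDerivAt h (ℓ (σ t).2) t := fun t ht =>
    ℓ.hasFDerivAt.comp_hasDerivAt t (hd t (hI t ht).1).fst
  have hne : ∀ t ∈ I, ℓ (σ t).2 ≠ 0 := fun t ht => (hI t ht).2.2
  let φ := (hhs 0 hI0).toOpenPartialHomeomorph h ((hhd 0 hI0).hasFDerivAt_equiv (hne 0 hI0))
    (by simp)
  have hφ0 : (0 : ℝ) ∈ φ.source := (hhs 0 hI0).mem_toOpenPartialHomeomorph_source _ _
  have hφ : ∀ t, φ t = h t := fun t => rfl
  have hsymm : ∀ a ∈ φ.target, φ.symm a ∈ I → ContDiffAt ℝ ∞ φ.symm a := fun a ha haI =>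
    φ.contDiffAt_symm_deriv (hne _ haI) ha (hhd _ haI) (hhs _ haI)
  have hTo : IsOpen (φ.target ∩ φ.symm ⁻¹' I) := φ.isOpen_inter_preimage_symm hIo
  have hback : ∀ t ∈ φ.source, φ.symm (ℓ (σ t).1) = t := fun t ht => φ.left_inv ht
  have hp1 : φ.symm (ℓ p.1) = 0 := by rw [← hback 0 hφ0, hσ0]
  refine ⟨ℓ ⁻¹' (φ.target ∩ φ.symm ⁻¹' I), fun x => (σ (φ.symm (ℓ x))).2, σ,
    hTo.preimage ℓ.continuous, ⟨?_, ?_⟩, ?_, ?_, ?_, hσ0, ?_⟩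
  · rw [← hσ0]
    exact φ.map_source hφ0
  · change φ.symm (ℓ p.1) ∈ I
    rwa [hp1]
  · intro x hx
    have h1 : ContDiffAt ℝ ∞ (fun x => φ.symm (ℓ x)) x :=
      ContDiffAt.comp x (hsymm _ hx.1 hx.2) ℓ.contDiff.contDiffAt
    exact (ContDiffAt.comp x (hσt _ hx.2) h1).snd.contDiffWithinAt
  · intro x hx h0
    refine hne _ hx.2 ?_
    exact (congrArg ℓ h0).trans (map_zero ℓ)
  · simp only [hp1, hσ0]
  · filter_upwards [hIo.mem_nhds hI0, φ.open_source.mem_nhds hφ0] with t ht hts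
    refine ⟨(hI t ht).2.1, hd t (hI t ht).1, ?_⟩
    simp only [hback t hts]

end IntegralCurves

/-! ### Existence of geodesic fields and the local form of `C'`. -/

section GeodesicExtension

variable {E : Type*} [NormedAddCommGroup E] [NormedSpace ℝ E] [FiniteDimensional ℝ E]
  [CompleteSpace E] {M : Type*} [TopologicalSpace M] [T2Space M] [ChartedSpace E M]
  [IsManifold 𝓘(ℝ, E) ∞ M] {F : TM E M → ℝ} {S : Field E M}

/-- The field built in the chart is carried to `M`. The curve in `TM` is an integral curve of `S`,
and its projection is an integral curve of `W` because `dπ(S(w)) = w`. -/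
theorem exists_isGeodesicExtension (hF : IsFinslerMetric F) (hS : IsGeodesicSpray F S)
    {w : TM E M} (hw : w ∈ slit E M) : ∃ W, IsGeodesicExtension S w W := by
  have hd := mem_tdom_self w
  set x₀ : M := w.1 with hx₀
  have hsp := isLocalSpray hF hS x₀
  have hp := (tchart_mem_slitLoc hd).2 hw
  obtain ⟨O, Ŵ, σ, hO, hpO, hŴ, hne, hŴp, hσ0, hev⟩ :=
    exists_velocity_extension (isOpen_slitLoc x₀) hsp.contDiffAt_spray hp hp.2
  let W : (x : M) → TangM E x := fun x => baseSymm x₀ x (Ŵ (extChartAt 𝓘(ℝ, E) x₀ x))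
  have hpt := tchart_apply hd
  have hWtchart : ∀ x ∈ (chartAt E x₀).source, (⟨x, W x⟩ : TM E M)
      = (tchart x₀).symm (extChartAt 𝓘(ℝ, E) x₀ x, Ŵ (extChartAt 𝓘(ℝ, E) x₀ x)) := by
    intro x hx
    have hx' : (⟨x, W x⟩ : TM E M) ∈ tdom E x₀ := hx
    rw [← tchart_symm_tchart hx', tchart_apply hx', baseLoc_baseSymm hx]
  have hσW : ∀ᶠ t in 𝓝 (0 : ℝ), (⟨((tchart (M := M) x₀).symm (σ t)).1,
      W ((tchart (M := M) x₀).symm (σ t)).1⟩ : TM E M) = (tchart x₀).symm (σ t) := by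
    filter_upwards [hev] with t ht
    have hq := slitLoc_subset x₀ ht.1
    have hx := tchart_symm_mem (M := M) hq
    rw [hWtchart _ hx, tchart_symm_fst hq, (extChartAt 𝓘(ℝ, E) x₀).right_inv ht.1.1, ht.2.2]
  have h0 : (tchart (M := M) x₀).symm (σ 0) = w := by rw [hσ0, tchart_symm_tchart hd]
  have hδ : ∀ᶠ t in 𝓝 (0 : ℝ), HasMFDerivAt 𝓘(ℝ, ℝ) 𝓘(ℝ, E).tangent
      (fun t => (tchart (M := M) x₀).symm (σ t)) t
      ((1 : ℝ →L[ℝ] ℝ).smulRight (S ((tchart (M := M) x₀).symm (σ t)))) := by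
    filter_upwards [hev] with t ht
    have hq := slitLoc_subset x₀ ht.1
    have hx := tchart_symm_mem (M := M) hq
    have h1 := (hasMFDerivAt_tchart_symm (M := M) hq).comp t ht.2.1.hasFDerivAt.hasMFDerivAt
    have e : ofLoc x₀ ((tchart (M := M) x₀).symm (σ t)) ((σ t).2, locSpray x₀ S (σ t))
        = S ((tchart (M := M) x₀).symm (σ t)) := by
      rw [← loc_spray hF hS ht.1, loc, ofLoc_toLoc hx]
    refine h1.congr_mfderiv ?_
    refine ContinuousLinearMap.ext fun r : ℝ => ?_
    change ofLoc x₀ _ (r • ((σ t).2, locSpray x₀ S (σ t))) = r • S ((tchart (M := M) x₀).symm (σ t))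
    rw [map_smul, e]
  -- Vectors at equal points are compared without transport: through equality in the total space
  -- here, and through the common model `E × E` in `hSc`.
  have hmk : ∀ (a : TM E M) (y : TangM E a.1), (⟨a.1, y⟩ : TM E M) = a → y = a.2 := by
    rintro ⟨x, v⟩ y h
    simpa using h
  have hSc : ∀ a b : TM E M, a = b → (S a : E × E) = S b := by
    rintro a b rfl
    rfl
  refine ⟨W, ⟨(chartAt E x₀).source ∩ extChartAt 𝓘(ℝ, E) x₀ ⁻¹' O, ?_, ⟨hd, ?_⟩, ?_, ?_⟩, ?_,
    fun t => ((tchart (M := M) x₀).symm (σ t)).1, ?_, ?_, ?_⟩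
  · rw [← extChartAt_source 𝓘(ℝ, E)]
    exact isOpen_extChartAt_preimage' x₀ hO
  · rw [hpt] at hpO
    exact hpO
  · intro x hx h0
    refine hne _ hx.2 ?_
    have h1 := congrArg (baseLoc x₀ x) h0
    rwa [baseLoc_baseSymm hx.1, map_zero] at h1
  · intro x hx
    have hx' : x ∈ (extChartAt 𝓘(ℝ, E) x₀).source := by
      rw [extChartAt_source]; exact hx.1
    have ht := (extChartAt 𝓘(ℝ, E) x₀).map_source hx'
    have hc : ContMDiffAt 𝓘(ℝ, E) 𝓘(ℝ, E) ∞ (extChartAt 𝓘(ℝ, E) x₀) x :=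
      contMDiffAt_extChartAt' hx.1
    have hg : ContDiffAt ℝ ∞ (fun y => (y, Ŵ y)) (extChartAt 𝓘(ℝ, E) x₀ x) :=
      contDiffAt_id.prodMk (hŴ.contDiffAt (hO.mem_nhds hx.2))
    have h1 := (contMDiffAt_tchart_symm (M := M) (x₀ := x₀)
      (p := (extChartAt 𝓘(ℝ, E) x₀ x, Ŵ (extChartAt 𝓘(ℝ, E) x₀ x)))
      (mem_tchart_target.2 ht)).comp x (hg.contMDiffAt.comp x hc)
    refine (h1.congr_of_eventuallyEq ?_).contMDiffWithinAt
    filter_upwards [(chartAt E x₀).open_source.mem_nhds hx.1] with y hy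
    exact hWtchart y hy
  · change baseSymm x₀ w.1 (Ŵ (extChartAt 𝓘(ℝ, E) x₀ w.1)) = w.2
    rw [hpt] at hŴp
    rw [hŴp, baseSymm_baseLoc hd]
  · exact congrArg Bundle.TotalSpace.proj h0
  · filter_upwards [hev, hσW, hδ] with t ht hWt hδt
    have hq := slitLoc_subset x₀ ht.1
    have hx := tchart_symm_mem (M := M) hq
    have h1 := (hasMFDerivAt_proj ((tchart (M := M) x₀).symm (σ t))).comp t hδt
    refine h1.congr_mfderiv ?_
    have e : dproj _ (S ((tchart (M := M) x₀).symm (σ t)))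
        = W ((tchart (M := M) x₀).symm (σ t)).1 := by
      rw [hmk _ _ hWt]
      refine baseLoc_injective hx ?_
      rw [baseLoc_dproj hx, baseLoc_snd hq]
      exact loc_spray_fst hF hS ht.1
    refine ContinuousLinearMap.ext fun r : ℝ => ?_
    change dproj _ (r • S ((tchart (M := M) x₀).symm (σ t)))
      = r • W ((tchart (M := M) x₀).symm (σ t)).1
    rw [map_smul, e]
  · filter_upwards [hσW.eventually_nhds, hδ] with t hWt hδt
    refine (hδt.congr_of_eventuallyEq hWt).congr_mfderiv ?_
    exact congrArg (fun v : E × E => (1 : ℝ →L[ℝ] ℝ).smulRight v) (hSc _ _ hWt.self_of_nhds).symm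

/-- Existence of a geodesic field makes the choice in the definition meaningful, and the right-hand
side shows that the result does not depend on it. -/
theorem cartanPrime_eq (hF : IsFinslerMetric F) (hS : IsGeodesicSpray F S) {x₀ : M} {w : TM E M}
    (hw : w ∈ tdom E x₀) (hs : w ∈ slit E M) (u v z : TangM E w.1) :
    cartanPrime F S w u v z
      = locLandsberg (locEnergy x₀ F) (locSpray x₀ S) (tchart x₀ w) (baseLoc x₀ w.1 u)
        (baseLoc x₀ w.1 v) (baseLoc x₀ w.1 z) := by
  have he : ∀ u : TangM E w.1,
      ContDiffAt ℝ ∞ (locB x₀ (FiberBundle.extend E u)) (extChartAt 𝓘(ℝ, E) x₀ w.1) :=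
    fun u => contDiffAt_locB hw (contMDiffAt_extend_base u)
  rw [cartanPrime, cartanDeriv_eq hF hS hw hs
    (Classical.epsilon_spec (exists_isGeodesicExtension hF hS hs)) (he u) (he v) (he z)]
  simp only [FiberBundle.extend_apply_self]

theorem vertCartanPrime_eq (hF : IsFinslerMetric F) (hS : IsGeodesicSpray F S) {x₀ : M}
    {p : E × E} (hp : p ∈ slitLoc E x₀) {X Y Z : Field E M} (hX : (loc x₀ X p).1 = 0)
    (hY : (loc x₀ Y p).1 = 0) (hZ : (loc x₀ Z p).1 = 0) :
    vertCartanPrime F S X Y Z ((tchart x₀).symm p)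
      = locLandsberg (locEnergy x₀ F) (locSpray x₀ S) p (loc x₀ X p).2 (loc x₀ Y p).2
        (loc x₀ Z p).2 := by
  have hp' := slitLoc_subset x₀ hp
  have hw := tchart_symm_mem (M := M) hp'
  rw [vertCartanPrime, cartanPrime_eq hF hS hw (tchart_symm_mem_slit hp), baseLoc_vdrop hw hX,
    baseLoc_vdrop hw hY, baseLoc_vdrop hw hZ, tchart_tchart_symm hp']
  rfl

end GeodesicExtension

/-! ### Local covariant derivatives and the Leibniz rule for the metric. -/

/-- The local expression of a covariant derivative. -/
def locNabla {E : Type*} [NormedAddCommGroup E] [NormedSpace ℝ E] (κ μ : ℝ) (L : E × E → ℝ)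
    (s : E × E → E) (X : E × E → E × E) (c : E × E → E) (p : E × E) : E :=
  fderiv ℝ c p (X p) + locChris s p (X p).1 (c p) + locTensor κ μ L s p (X p) (c p)

theorem locMetric_add_left {E : Type*} [NormedAddCommGroup E] [NormedSpace ℝ E] (L : E × E → ℝ)
    (p : E × E) (a b u : E) :
    locMetric L p (a + b) u = locMetric L p a u + locMetric L p b u := by
  rw [← locFlat_apply, ← locFlat_apply, ← locFlat_apply, map_add, add_apply]

theorem contDiffAt_locMetric {E : Type*} [NormedAddCommGroup E] [NormedSpace ℝ E]
    {L : E × E → ℝ} {p : E × E} (hL : ContDiffAt ℝ ∞ L p) {c d : E × E → E}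
    (hc : ContDiffAt ℝ ∞ c p) (hd : ContDiffAt ℝ ∞ d p) :
    ContDiffAt ℝ ∞ (fun q => locMetric L q (c q) (d q)) p :=
  ((contDiffAt_fderiv (contDiffAt_fderiv hL)).clm_apply (contDiffAt_const.prodMk hc)).clm_apply
    (contDiffAt_const.prodMk hd)

theorem fderiv_locMetric_comp {E : Type*} [NormedAddCommGroup E] [NormedSpace ℝ E]
    {L : E × E → ℝ} {p : E × E} (hL : ContDiffAt ℝ ∞ L p) {c d : E × E → E}
    (hc : DifferentiableAt ℝ c p) (hd : DifferentiableAt ℝ d p) (ζ : E × E) :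
    fderiv ℝ (fun q => locMetric L q (c q) (d q)) p ζ
      = fderiv ℝ (fun q => locMetric L q (c p) (d p)) p ζ
        + locMetric L p (fderiv ℝ c p ζ) (d p) + locMetric L p (c p) (fderiv ℝ d p ζ) := by
  have h2 := differentiableAt_of_contDiffAt (contDiffAt_fderiv (contDiffAt_fderiv hL))
  have hin : ∀ {f : E × E → E}, DifferentiableAt ℝ f p →
      DifferentiableAt ℝ (fun y => ((0 : E), f y)) p ∧
      fderiv ℝ (fun y => ((0 : E), f y)) p ζ = (0, fderiv ℝ f p ζ) := by
    intro f hf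
    refine ⟨(differentiableAt_const _).prodMk hf, ?_⟩
    rw [((hasFDerivAt_const (0 : E) p).prodMk hf.hasFDerivAt).fderiv]
    rfl
  have c1 := h2.clm_apply (differentiableAt_const ((0 : E), c p))
  have d1 := h2.clm_apply (hin hc).1
  simp only [locMetric_apply]
  rw [fderiv_clm_apply_apply d1 (hin hd).1, fderiv_clm_apply_apply h2 (hin hc).1, (hin hc).2,
    (hin hd).2, fderiv_clm_apply_apply c1 (differentiableAt_const _),
    fderiv_clm_apply_apply h2 (differentiableAt_const _)]
  simp

/-! ### The two-parameter family of lifts: torsion and metric derivative. -/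

section Construction

variable {E : Type*} [NormedAddCommGroup E] [NormedSpace ℝ E]
  {M : Type*} [TopologicalSpace M] [ChartedSpace E M] [IsManifold 𝓘(ℝ, E) ∞ M]

/-- The horizontal vector field corresponding to a vertical vector field. -/
def horLift (S : Field E M) (Y : Field E M) : Field E M :=
  hproj S (fun w => Function.invFun (dproj w) (vdrop w (Y w)))

/-- The covariant derivative of the Berwald connection. -/
def berwald (S : Field E M) (X Y : Field E M) : Field E M := fun w =>
  almostTangent (bracket (vproj S X) (horLift S Y)) w + vproj S (bracket (hproj S X) Y) w

/-- The metric dual of `κ C(V X, Y, ·) + μ C'(J X, Y, ·)`. -/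
def diffTensor (κ μ : ℝ) (F : TM E M → ℝ) (S : Field E M) (X Y : Field E M) : Field E M := fun w =>
  vlift w (Classical.epsilon fun u => ∀ z, fundTensor F w u z
    = κ * cartanTensor F w (vdrop w (vproj S X w)) (vdrop w (Y w)) z
      + μ * cartanPrime F S w (dproj w (X w)) (vdrop w (Y w)) z)

/-- A two-parameter family of connections on the vertical bundle. -/
def finslerConn (κ μ : ℝ) (F : TM E M → ℝ) (S : Field E M) (X Y : Field E M) : Field E M :=
  fun w => berwald S X Y w + diffTensor κ μ F S X Y w

/-- Every pointwise assertion on `TM \ 0` is checked through this reduction to charts. -/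
theorem forall_slit_of_forall_slitLoc {P : TM E M → Prop}
    (h : ∀ x₀ : M, ∀ p ∈ slitLoc E x₀, P ((tchart x₀).symm p)) : ∀ w ∈ slit E M, P w := by
  intro w hw
  have hd := mem_tdom_self w
  rw [← tchart_symm_tchart hd]
  exact h _ _ ((tchart_mem_slitLoc hd).2 hw)

theorem eq_of_loc_eq {x₀ : M} {p : E × E} (hp : p ∈ slitLoc E x₀) {X Y : Field E M}
    (h : loc x₀ X p = loc x₀ Y p) : X ((tchart x₀).symm p) = Y ((tchart x₀).symm p) :=
  toLoc_injective (tchart_symm_mem (slitLoc_subset x₀ hp)) h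

variable [FiniteDimensional ℝ E] [CompleteSpace E] [T2Space M] {F : TM E M → ℝ} {S : Field E M}

theorem loc_horLift (hF : IsFinslerMetric F) (hS : IsGeodesicSpray F S) {x₀ : M} {p : E × E}
    (hp : p ∈ slitLoc E x₀) {Y : Field E M} (hY : SmoothVertical Y) :
    loc x₀ (horLift S Y) p
      = ((loc x₀ Y p).2, -locNonlin (locSpray x₀ S) p (loc x₀ Y p).2) := by
  have hw := tchart_symm_mem (M := M) (slitLoc_subset x₀ hp)
  have h : (loc x₀ (fun w => Function.invFun (dproj w) (vdrop w (Y w)) : Field E M) p).1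
      = (loc x₀ Y p).2 := by
    rw [loc, ← baseLoc_dproj hw, dproj_invFun, baseLoc_vdrop hw (hY.loc_fst hp), loc]
  rw [horLift, loc_hproj hF hS hp, h]

theorem smoothField_horLift (hF : IsFinslerMetric F) (hS : IsGeodesicSpray F S) {Y : Field E M}
    (hY : SmoothVertical Y) : SmoothField (horLift S Y) := by
  refine smoothField_of_loc fun x₀ p hp => ?_
  have hs := (isLocalSpray hF hS x₀).contDiffAt_spray p hp
  have hYp := (hY.1.contDiffAt hp).snd
  refine (hYp.prodMk ((contDiffAt_locNonlin hs).clm_apply hYp).neg).congr_of_eventuallyEq ?_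
  filter_upwards [(isOpen_slitLoc x₀).mem_nhds hp] with q hq
  exact loc_horLift hF hS hq hY

theorem loc_almostTangent_horLift (hF : IsFinslerMetric F) (hS : IsGeodesicSpray F S) {x₀ : M}
    {p : E × E} (hp : p ∈ slitLoc E x₀) {Y : Field E M} (hY : SmoothVertical Y) :
    loc x₀ (almostTangent (horLift S Y)) p = loc x₀ Y p := by
  rw [loc_almostTangent (slitLoc_subset x₀ hp), loc_horLift hF hS hp hY, ← hY.loc_eq hp]

theorem almostTangent_horLift (hF : IsFinslerMetric F) (hS : IsGeodesicSpray F S) {Y : Field E M}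
    (hY : SmoothVertical Y) : ∀ w ∈ slit E M, almostTangent (horLift S Y) w = Y w :=
  forall_slit_of_forall_slitLoc fun _ _ hp =>
    eq_of_loc_eq hp (loc_almostTangent_horLift hF hS hp hY)

omit [FiniteDimensional ℝ E] [CompleteSpace E] [T2Space M] in
theorem hproj_add_vproj (X : Field E M) : hproj S X + vproj S X = X := by
  funext w
  rw [Pi.add_apply, hproj, vproj]
  module

theorem loc_hproj_of_horizontal (hF : IsFinslerMetric F) (hS : IsGeodesicSpray F S) {x₀ : M}
    {p : E × E} (hp : p ∈ slitLoc E x₀) (X : Field E M) :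
    (loc x₀ (hproj S X) p).2 + locNonlin (locSpray x₀ S) p (loc x₀ (hproj S X) p).1 = 0 := by
  rw [loc_hproj hF hS hp, neg_add_cancel]

/-- The `J`-bracket contributes the derivative of `Y` along `V X`, the vertical part of the other
bracket its derivative along `H X` together with `Γ`; the two derivatives add up to the one along
`X`. -/
theorem loc_berwald (hF : IsFinslerMetric F) (hS : IsGeodesicSpray F S) {x₀ : M} {p : E × E}
    (hp : p ∈ slitLoc E x₀) {X Y : Field E M} (hX : SmoothField X) (hY : SmoothVertical Y) :
    loc x₀ (berwald S X Y) p = (0, fderiv ℝ (fun q => (loc x₀ Y q).2) p (loc x₀ X p)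
      + locChris (locSpray x₀ S) p (loc x₀ X p).1 (loc x₀ Y p).2) := by
  have hp' := slitLoc_subset x₀ hp
  have hw := tchart_symm_mem_slit (M := M) hp
  have hs := (isLocalSpray hF hS x₀).contDiffAt_spray p hp
  have hXp := hX.contDiffAt hp
  have hYp := hY.1.contDiffAt hp
  have hZ := smoothField_horLift hF hS hY
  have hA := smoothField_vproj hF hS hX
  have hB := smoothField_hproj hF hS hX
  have hsm : ∀ {X : Field E M}, SmoothField X → SmoothFieldAt X ((tchart x₀).symm p) :=
    fun h => smoothField_iff.1 h _ hw
  have e : loc x₀ (berwald S X Y) p = loc x₀ (almostTangent (bracket (vproj S X) (horLift S Y))) p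
      + loc x₀ (vproj S (bracket (hproj S X) Y)) p := map_add _ _ _
  have hZ1 : fderiv ℝ (fun q => (loc x₀ (horLift S Y) q).1) p
      = fderiv ℝ (fun q => (loc x₀ Y q).2) p :=
    fderiv_eq_of_eqOn (isOpen_slitLoc x₀) (fun q hq => by rw [loc_horLift hF hS hq hY]) hp
  have hA1 : fderiv ℝ (fun q => (loc x₀ (vproj S X) q).1) p = 0 := by
    rw [fderiv_eq_of_eqOn (h := fun _ => (0 : E)) (isOpen_slitLoc x₀)
      (fun q hq => by rw [loc_vproj hF hS hq]) hp]
    simp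
  have hfst : ∀ {X : Field E M}, SmoothField X → ∀ ξ, (fderiv ℝ (loc x₀ X) p ξ).1
      = fderiv ℝ (fun q => (loc x₀ X q).1) p ξ := by
    intro X hX ξ
    rw [(differentiableAt_of_contDiffAt (hX.contDiffAt hp)).hasFDerivAt.fst.fderiv]
    rfl
  rw [e, loc_almostTangent hp', loc_bracket hp' (hsm hA) (hsm hZ), Prod.fst_sub, hfst hZ, hfst hA,
    hZ1, hA1, loc_vproj hF hS hp, loc_vproj hF hS hp, loc_bracket hp' (hsm hB) (hsm hY.1),
    vert_locBracket hs (a := fun q => (loc x₀ X q).1) (c := fun q => (loc x₀ Y q).2)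
      (differentiableAt_of_contDiffAt hXp.fst) (differentiableAt_of_contDiffAt hYp.snd)
      (eventually_of_mem ((isOpen_slitLoc x₀).mem_nhds hp) fun q hq => loc_hproj hF hS hq X)
      (eventually_of_mem ((isOpen_slitLoc x₀).mem_nhds hp) fun q hq => hY.loc_eq hq),
    loc_hproj hF hS hp, zero_apply, sub_zero, Prod.mk_add_mk, add_zero, ← add_assoc, ← map_add,
    Prod.mk_add_mk, zero_add, add_neg_cancel_right]

/-- The chosen vector and `locTensor` solve the same Riesz equation for `g`, whose solution is
unique because `g` is nondegenerate. -/
theorem loc_diffTensor (κ μ : ℝ) (hF : IsFinslerMetric F) (hS : IsGeodesicSpray F S) {x₀ : M}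
    {p : E × E} (hp : p ∈ slitLoc E x₀) {X Y : Field E M} (hY : SmoothVertical Y) :
    loc x₀ (diffTensor κ μ F S X Y) p = (0, locTensor κ μ (locEnergy x₀ F) (locSpray x₀ S) p
      (loc x₀ X p) (loc x₀ Y p).2) := by
  have hsp := isLocalSpray hF hS x₀
  have hp' := slitLoc_subset x₀ hp
  have hw := tchart_symm_mem (M := M) hp'
  have hws := tchart_symm_mem_slit (M := M) hp
  rw [loc, diffTensor, toLoc_vlift hw]
  set w := (tchart (M := M) x₀).symm p with hwdef
  have hV : baseLoc x₀ w.1 (vdrop w (vproj S X w))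
      = (loc x₀ X p).2 + locNonlin (locSpray x₀ S) p (loc x₀ X p).1 := by
    have h := loc_vproj hF hS hp X
    have h' : toLoc x₀ w (vproj S X w) = _ := h
    rw [baseLoc_vdrop hw (by rw [h']), h']
  have hYv : baseLoc x₀ w.1 (vdrop w (Y w)) = (loc x₀ Y p).2 := by
    rw [baseLoc_vdrop hw (hY.loc_fst hp)]; rfl
  have hXd : baseLoc x₀ w.1 (dproj w (X w)) = (loc x₀ X p).1 := baseLoc_dproj hw _
  have hiff : ∀ u z : TangM E w.1, fundTensor F w u z
      = κ * cartanTensor F w (vdrop w (vproj S X w)) (vdrop w (Y w)) z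
        + μ * cartanPrime F S w (dproj w (X w)) (vdrop w (Y w)) z
      ↔ locMetric (locEnergy x₀ F) p (baseLoc x₀ w.1 u) (baseLoc x₀ w.1 z)
        = locMetric (locEnergy x₀ F) p (locTensor κ μ (locEnergy x₀ F) (locSpray x₀ S) p
          (loc x₀ X p) (loc x₀ Y p).2) (baseLoc x₀ w.1 z) := by
    intro u z
    rw [fundTensor_eq hF hw hws, cartanTensor_eq hF hw hws, cartanPrime_eq hF hS hw hws, hV, hYv,
      hXd, hsp.locMetric_locTensor hp, hwdef, tchart_tchart_symm hp']
  have hex : ∃ u, ∀ z, fundTensor F w u z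
      = κ * cartanTensor F w (vdrop w (vproj S X w)) (vdrop w (Y w)) z
        + μ * cartanPrime F S w (dproj w (X w)) (vdrop w (Y w)) z := by
    refine ⟨baseSymm x₀ w.1 (locTensor κ μ (locEnergy x₀ F) (locSpray x₀ S) p
          (loc x₀ X p) (loc x₀ Y p).2), fun z => ?_⟩
    rw [hiff, baseLoc_baseSymm hw]
  have hspec := Classical.epsilon_spec hex
  refine Prod.ext rfl (hsp.eq_of_locMetric_eq hp fun z => ?_)
  have h := (hiff _ _).1 (hspec (baseSymm x₀ w.1 z))
  rwa [baseLoc_baseSymm hw] at h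

theorem loc_finslerConn (κ μ : ℝ) (hF : IsFinslerMetric F) (hS : IsGeodesicSpray F S) {x₀ : M}
    {p : E × E} (hp : p ∈ slitLoc E x₀) {X Y : Field E M} (hX : SmoothField X)
    (hY : SmoothVertical Y) :
    loc x₀ (finslerConn κ μ F S X Y) p = (0, locNabla κ μ (locEnergy x₀ F) (locSpray x₀ S)
      (loc x₀ X) (fun q => (loc x₀ Y q).2) p) := by
  have e : loc x₀ (finslerConn κ μ F S X Y) p = loc x₀ (berwald S X Y) p
      + loc x₀ (diffTensor κ μ F S X Y) p := map_add _ _ _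
  rw [e, loc_berwald hF hS hp hX hY, loc_diffTensor κ μ hF hS hp hY, Prod.mk_add_mk, add_zero,
    locNabla]

theorem smoothVertical_finslerConn (κ μ : ℝ) (hF : IsFinslerMetric F) (hS : IsGeodesicSpray F S)
    {X Y : Field E M} (hX : SmoothField X) (hY : SmoothVertical Y) :
    SmoothVertical (finslerConn κ μ F S X Y) := by
  refine smoothVertical_of_loc (smoothField_of_loc fun x₀ p hp => ?_) fun x₀ p hp => by
    rw [loc_finslerConn κ μ hF hS hp hX hY]
  have hsp := isLocalSpray hF hS x₀
  have hs := hsp.contDiffAt_spray p hp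
  have hXp := hX.contDiffAt hp
  have hYp := (hY.1.contDiffAt hp).snd
  refine (contDiffAt_const (c := (0 : E)).prodMk ((((contDiffAt_fderiv hYp).clm_apply hXp).add
    (contDiffAt_locChris hs hXp.fst hYp)).add (hsp.contDiffAt_locTensor (κ := κ) (μ := μ) hp hXp
    hYp))).congr_of_eventuallyEq ?_
  filter_upwards [(isOpen_slitLoc x₀).mem_nhds hp] with q hq
  exact loc_finslerConn κ μ hF hS hq hX hY

omit [FiniteDimensional ℝ E] [CompleteSpace E] [T2Space M] in
theorem loc_add (x₀ : M) (X X' : Field E M) : loc x₀ (X + X') = loc x₀ X + loc x₀ X' := by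
  funext p
  exact map_add (toLoc x₀ _) _ _

omit [FiniteDimensional ℝ E] [CompleteSpace E] [T2Space M] in
theorem SmoothField.add {X X' : Field E M} (hX : SmoothField X) (hX' : SmoothField X') :
    SmoothField (X + X') :=
  smoothField_of_loc fun x₀ p hp => by
    rw [loc_add]
    exact (hX.contDiffAt hp).add (hX'.contDiffAt hp)

omit [FiniteDimensional ℝ E] [CompleteSpace E] [T2Space M] in
theorem SmoothVertical.add {X X' : Field E M} (hX : SmoothVertical X) (hX' : SmoothVertical X') :
    SmoothVertical (X + X') :=
  ⟨hX.1.add hX'.1, fun w hw => by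
    rw [Pi.add_apply, map_add, hX.2 w hw, hX'.2 w hw, add_zero]⟩

omit [FiniteDimensional ℝ E] [CompleteSpace E] [T2Space M] in
theorem loc_smul_of_eq {x₀ : M} {p : E × E} (hp : p ∈ slitLoc E x₀) {f : TM E M → ℝ}
    {X X' : Field E M} (h : ∀ w ∈ slit E M, X' w = f w • X w) :
    loc x₀ X' p = f ((tchart x₀).symm p) • loc x₀ X p := by
  rw [loc, h _ (tchart_symm_mem_slit hp), map_smul, loc]

theorem isLinearConnection_finslerConn (κ μ : ℝ) (hF : IsFinslerMetric F)
    (hS : IsGeodesicSpray F S) : IsLinearConnection (finslerConn κ μ F S) where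
  smooth X Y hX hY := smoothVertical_finslerConn κ μ hF hS hX hY
  add_left X X' Y hX hX' hY := forall_slit_of_forall_slitLoc fun x₀ p hp => by
    refine toLoc_injective (tchart_symm_mem (slitLoc_subset x₀ hp)) ?_
    have hsp := isLocalSpray hF hS x₀
    rw [map_add]
    change loc x₀ (finslerConn κ μ F S (X + X') Y) p = loc x₀ (finslerConn κ μ F S X Y) p
      + loc x₀ (finslerConn κ μ F S X' Y) p
    rw [loc_finslerConn κ μ hF hS hp (hX.add hX') hY, loc_finslerConn κ μ hF hS hp hX hY,
      loc_finslerConn κ μ hF hS hp hX' hY, loc_add, Prod.mk_add_mk, add_zero]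
    simp only [locNabla, Pi.add_apply, Prod.fst_add]
    rw [map_add, locChris_add_left, hsp.locTensor_add_left hp]
    congr 1
    abel
  add_right X Y Y' hX hY hY' := forall_slit_of_forall_slitLoc fun x₀ p hp => by
    refine toLoc_injective (tchart_symm_mem (slitLoc_subset x₀ hp)) ?_
    have hsp := isLocalSpray hF hS x₀
    rw [map_add]
    change loc x₀ (finslerConn κ μ F S X (Y + Y')) p = loc x₀ (finslerConn κ μ F S X Y) p
      + loc x₀ (finslerConn κ μ F S X Y') p
    rw [loc_finslerConn κ μ hF hS hp hX (hY.add hY'), loc_finslerConn κ μ hF hS hp hX hY,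
      loc_finslerConn κ μ hF hS hp hX hY', loc_add, Prod.mk_add_mk, add_zero]
    simp only [locNabla, Pi.add_apply, Prod.snd_add]
    rw [fderiv_fun_add (differentiableAt_of_contDiffAt (hY.1.contDiffAt hp).snd)
      (differentiableAt_of_contDiffAt (hY'.1.contDiffAt hp).snd), add_apply,
      locChris_add_right, hsp.locTensor_add_right hp]
    congr 1
    abel
  smul_left f X X' Y hf hX hX' hY h := forall_slit_of_forall_slitLoc fun x₀ p hp => by
    refine toLoc_injective (tchart_symm_mem (slitLoc_subset x₀ hp)) ?_
    have hsp := isLocalSpray hF hS x₀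
    rw [map_smul]
    change loc x₀ (finslerConn κ μ F S X' Y) p
      = f ((tchart x₀).symm p) • loc x₀ (finslerConn κ μ F S X Y) p
    rw [loc_finslerConn κ μ hF hS hp hX' hY, loc_finslerConn κ μ hF hS hp hX hY, Prod.smul_mk,
      smul_zero]
    simp only [locNabla]
    rw [loc_smul_of_eq hp h, Prod.smul_fst, map_smul, locChris_smul_left,
      hsp.locTensor_smul_left hp, smul_add, smul_add]
  leibniz f X Y Y' hf hX hY hY' h := forall_slit_of_forall_slitLoc fun x₀ p hp => by
    have hp' := slitLoc_subset x₀ hp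
    have hw := tchart_symm_mem (M := M) hp'
    have hsp := isLocalSpray hF hS x₀
    have hfp := hf.contMDiffAt (isOpen_slit.mem_nhds (tchart_symm_mem_slit (M := M) hp))
    have hfs := (contMDiffAt_iff_loc hw).1 hfp
    rw [tchart_tchart_symm hp'] at hfs
    refine toLoc_injective hw ?_
    rw [map_add, map_smul, map_smul, dirDeriv_eq hw hfp, tchart_tchart_symm hp']
    change loc x₀ (finslerConn κ μ F S X Y') p
      = f ((tchart x₀).symm p) • loc x₀ (finslerConn κ μ F S X Y) p
        + fderiv ℝ (f ∘ (tchart x₀).symm) p (loc x₀ X p) • loc x₀ Y p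
    rw [loc_finslerConn κ μ hF hS hp hX hY', loc_finslerConn κ μ hF hS hp hX hY, hY.loc_eq hp,
      Prod.smul_mk, Prod.smul_mk, Prod.mk_add_mk, smul_zero, smul_zero, add_zero]
    simp only [locNabla]
    rw [fderiv_eq_of_eqOn (f := fun q => (loc x₀ Y' q).2)
      (h := fun q => (f ∘ (tchart x₀).symm) q • (loc x₀ Y q).2) (isOpen_slitLoc x₀)
      (fun q hq => by rw [loc_smul_of_eq hq h]; rfl) hp,
      fderiv_fun_smul (differentiableAt_of_contDiffAt hfs)
        (differentiableAt_of_contDiffAt (hY.1.contDiffAt hp).snd),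
      loc_smul_of_eq hp h, Prod.smul_snd, locChris_smul_right, hsp.locTensor_smul_right hp]
    simp only [add_apply, smul_apply, ContinuousLinearMap.smulRight_apply, Function.comp_apply]
    congr 1
    module

omit [FiniteDimensional ℝ E] [CompleteSpace E] [T2Space M] in
theorem loc_canonicalField {x₀ : M} {p : E × E} (hp : p ∈ (tchart x₀).target) :
    loc x₀ (canonicalField : Field E M) p = (0, p.2) := by
  rw [loc, canonicalField, toLoc_vlift (tchart_symm_mem hp), baseLoc_snd hp]

omit [FiniteDimensional ℝ E] [CompleteSpace E] [T2Space M] in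
theorem smoothVertical_canonicalField : SmoothVertical (canonicalField : Field E M) := by
  refine smoothVertical_of_loc (smoothField_of_loc fun x₀ p hp => ?_) fun x₀ p hp => by
    rw [loc_canonicalField (slitLoc_subset x₀ hp)]
  refine (contDiffAt_const (c := (0 : E)).prodMk contDiffAt_snd).congr_of_eventuallyEq ?_
  filter_upwards [(isOpen_slitLoc x₀).mem_nhds hp] with q hq
  exact loc_canonicalField (slitLoc_subset x₀ hq)

/-- In coordinates `C` is `(0, y)`: the difference tensor vanishes on `y`, and `Γ(a, y) = N a`. So
`∇_X C` is the vertical part of `X` whatever `κ` and `μ` are, which makes every member of the family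
a lift. -/
theorem loc_finslerConn_canonicalField (κ μ : ℝ) (hF : IsFinslerMetric F)
    (hS : IsGeodesicSpray F S) {x₀ : M} {p : E × E} (hp : p ∈ slitLoc E x₀) {X : Field E M}
    (hX : SmoothField X) :
    loc x₀ (finslerConn κ μ F S X canonicalField) p
      = (0, (loc x₀ X p).2 + locNonlin (locSpray x₀ S) p (loc x₀ X p).1) := by
  have hsp := isLocalSpray hF hS x₀
  rw [loc_finslerConn κ μ hF hS hp hX smoothVertical_canonicalField, locNabla,
    fderiv_eq_of_eqOn (h := Prod.snd) (isOpen_slitLoc x₀)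
      (fun q hq => by rw [loc_canonicalField (slitLoc_subset x₀ hq)]) hp,
    loc_canonicalField (slitLoc_subset x₀ hp), hsp.locTensor_snd hp, hsp.locChris_snd_right hp,
    fderiv_snd, add_zero]
  rfl

theorem isLift_finslerConn (κ μ : ℝ) (hF : IsFinslerMetric F) (hS : IsGeodesicSpray F S) :
    IsLift S (finslerConn κ μ F S) where
  isLinearConnection := isLinearConnection_finslerConn κ μ hF hS
  almostProjectable X hX := forall_slit_of_forall_slitLoc fun x₀ p hp => by
    refine eq_of_loc_eq hp ?_
    rw [loc_finslerConn_canonicalField κ μ hF hS hp hX.1, hX.loc_fst hp, map_zero, add_zero,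
      ← hX.loc_eq hp]
  ker_eq X hX := forall_slit_of_forall_slitLoc fun x₀ p hp => by
    have h := loc_finslerConn_canonicalField κ μ hF hS hp hX
    rw [isHorizontal_iff hF hS hp]
    constructor
    · intro h0
      rw [loc, h0, map_zero] at h
      exact (congrArg Prod.snd h).symm
    · intro h0
      refine toLoc_injective (tchart_symm_mem (slitLoc_subset x₀ hp)) ?_
      rw [map_zero]
      refine h.trans ?_
      rw [h0]
      rfl

/-- The derivative terms form the bracket and the symmetric `Γ` drops out, so only the difference
tensor is left, antisymmetrised. -/
theorem loc_torsion_finslerConn (κ μ : ℝ) (hF : IsFinslerMetric F) (hS : IsGeodesicSpray F S)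
    {x₀ : M} {p : E × E} (hp : p ∈ slitLoc E x₀) {X Y : Field E M} (hX : SmoothField X)
    (hY : SmoothField Y) :
    loc x₀ (torsion (finslerConn κ μ F S) X Y) p
      = (0, locTensor κ μ (locEnergy x₀ F) (locSpray x₀ S) p (loc x₀ X p) (loc x₀ Y p).1
          - locTensor κ μ (locEnergy x₀ F) (locSpray x₀ S) p (loc x₀ Y p) (loc x₀ X p).1) := by
  have hsp := isLocalSpray hF hS x₀
  have hp' := slitLoc_subset x₀ hp
  have hws := tchart_symm_mem_slit (M := M) hp
  have e : loc x₀ (torsion (finslerConn κ μ F S) X Y) p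
      = loc x₀ (finslerConn κ μ F S X (almostTangent Y)) p
        - loc x₀ (finslerConn κ μ F S Y (almostTangent X)) p
        - loc x₀ (almostTangent (bracket X Y)) p := by
    rw [loc, torsion, map_sub, map_sub]; rfl
  have hJ : ∀ {X : Field E M}, SmoothField X → ∀ ξ,
      fderiv ℝ (fun q => (loc x₀ (almostTangent X) q).2) p ξ = (fderiv ℝ (loc x₀ X) p ξ).1 := by
    intro X hX ξ
    rw [fderiv_eq_of_eqOn (h := fun q => (loc x₀ X q).1) (isOpen_slitLoc x₀)
      (fun q hq => by rw [loc_almostTangent (slitLoc_subset x₀ hq)]) hp,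
      (differentiableAt_of_contDiffAt (hX.contDiffAt hp)).hasFDerivAt.fst.fderiv]
    rfl
  rw [e, loc_finslerConn κ μ hF hS hp hX (smoothVertical_almostTangent hY),
    loc_finslerConn κ μ hF hS hp hY (smoothVertical_almostTangent hX), loc_almostTangent hp',
    loc_bracket hp' (smoothField_iff.1 hX _ hws) (smoothField_iff.1 hY _ hws), locNabla, locNabla,
    hJ hX, hJ hY, loc_almostTangent hp', loc_almostTangent hp',
    locChris_symm (hsp.contDiffAt_spray p hp) (loc x₀ Y p).1]
  simp only [Prod.mk_sub_mk, sub_zero, Prod.fst_sub]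
  congr 1
  abel

/-- With `κ = 0` only the `C'` part of the difference tensor remains, and it is symmetric for all
`X`, `Y`. -/
theorem t3_finslerConn (μ : ℝ) (hF : IsFinslerMetric F) (hS : IsGeodesicSpray F S) :
    T3 (finslerConn 0 μ F S) := by
  intro X Y hX hY
  refine forall_slit_of_forall_slitLoc fun x₀ p hp => ?_
  refine toLoc_injective (tchart_symm_mem (slitLoc_subset x₀ hp)) ?_
  rw [map_zero]
  refine (loc_torsion_finslerConn 0 μ hF hS hp hX hY).trans ?_
  rw [(isLocalSpray hF hS x₀).locTensor_symm hp (Or.inl rfl) (Or.inl rfl), sub_self]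
  rfl

/-- On horizontal vectors the Cartan part vanishes for every `κ`, and the `C'` part is symmetric. -/
theorem t2_finslerConn (κ μ : ℝ) (hF : IsFinslerMetric F) (hS : IsGeodesicSpray F S) :
    T2 S (finslerConn κ μ F S) := by
  intro X Y hX hY
  refine forall_slit_of_forall_slitLoc fun x₀ p hp => ?_
  refine toLoc_injective (tchart_symm_mem (slitLoc_subset x₀ hp)) ?_
  rw [map_zero]
  refine (loc_torsion_finslerConn κ μ hF hS hp (smoothField_hproj hF hS hX)
    (smoothField_hproj hF hS hY)).trans ?_
  rw [(isLocalSpray hF hS x₀).locTensor_symm hp (Or.inr (loc_hproj_of_horizontal hF hS hp X))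
    (Or.inr (loc_hproj_of_horizontal hF hS hp Y)), sub_self]
  rfl

/-- The Berwald part contributes `2 C - 2 C'`. The difference tensor acts on both arguments of `g`,
and by symmetry of `C` and `C'` it subtracts `2κ C + 2μ C'`. -/
theorem nablaMetric_finslerConn (κ μ : ℝ) (hF : IsFinslerMetric F) (hS : IsGeodesicSpray F S)
    {X Y Z : Field E M} (hX : SmoothField X) (hY : SmoothVertical Y) (hZ : SmoothVertical Z) :
    ∀ w ∈ slit E M, nablaMetric F (finslerConn κ μ F S) X Y Z w
      = (2 - 2 * κ) * vertCartan F (vproj S X) Y Z w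
        - (2 + 2 * μ) * vertCartanPrime F S (almostTangent X) Y Z w := by
  refine forall_slit_of_forall_slitLoc fun x₀ p hp => ?_
  have hp' := slitLoc_subset x₀ hp
  have hw := tchart_symm_mem (M := M) hp'
  have hsp := isLocalSpray hF hS x₀
  have hL := hsp.contDiffAt_lagrangian p hp
  have hYp := (hY.1.contDiffAt hp).snd
  have hZp := (hZ.1.contDiffAt hp).snd
  have hev : vertMetric F Y Z ∘ (tchart x₀).symm =ᶠ[𝓝 p]
      fun q => locMetric (locEnergy x₀ F) q (loc x₀ Y q).2 (loc x₀ Z q).2 := by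
    filter_upwards [(isOpen_slitLoc x₀).mem_nhds hp] with q hq
    exact vertMetric_eq hF hq (hY.loc_fst hq) (hZ.loc_fst hq)
  have hm : ContMDiffAt 𝓘(ℝ, E).tangent 𝓘(ℝ, ℝ) ∞ (vertMetric F Y Z) ((tchart x₀).symm p) := by
    rw [contMDiffAt_iff_loc hw, tchart_tchart_symm hp']
    exact (contDiffAt_locMetric hL hYp hZp).congr_of_eventuallyEq hev
  have hV : ∀ Y : Field E M, (loc x₀ (almostTangent Y) p).1 = 0 := fun Y => by
    rw [loc_almostTangent hp']
  have hV' : (loc x₀ (vproj S X) p).1 = 0 := by rw [loc_vproj hF hS hp]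
  have hDY := loc_finslerConn κ μ hF hS hp hX hY
  have hDZ := loc_finslerConn κ μ hF hS hp hX hZ
  rw [nablaMetric, dirDeriv_eq hw hm, tchart_tchart_symm hp', hev.fderiv_eq,
    fderiv_locMetric_comp hL (differentiableAt_of_contDiffAt hYp)
      (differentiableAt_of_contDiffAt hZp), hsp.fderiv_locMetric_eq hp,
    vertMetric_eq hF hp (by rw [hDY]) (hZ.loc_fst hp),
    vertMetric_eq hF hp (hY.loc_fst hp) (by rw [hDZ]), hDY, hDZ,
    vertCartan_eq hF hp hV' (hY.loc_fst hp) (hZ.loc_fst hp),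
    vertCartanPrime_eq hF hS hp (hV X) (hY.loc_fst hp) (hZ.loc_fst hp), loc_vproj hF hS hp,
    loc_almostTangent hp']
  have hT : ∀ c d, locMetric (locEnergy x₀ F) p d (locTensor κ μ (locEnergy x₀ F)
      (locSpray x₀ S) p (loc x₀ X p) c) = κ * locCartan (locEnergy x₀ F) p ((loc x₀ X p).2
        + locNonlin (locSpray x₀ S) p (loc x₀ X p).1) d c
      + μ * locLandsberg (locEnergy x₀ F) (locSpray x₀ S) p (loc x₀ X p).1 d c := by
    intro c d
    rw [locMetric_symm hL, hsp.locMetric_locTensor hp, hsp.locCartan_symm_right hp,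
      hsp.locLandsberg_symm_right hp]
  simp only [locNabla, locMetric_add_left, map_add, hT, hsp.locMetric_locTensor hp]
  ring

/-- A vertical vector has no base component, so the `C'` part vanishes and `𝒞_♭` is `κ` times the
symmetric tensor `C`. -/
theorem m7_finslerConn (κ μ : ℝ) (hF : IsFinslerMetric F) (hS : IsGeodesicSpray F S) :
    M7 F (finslerConn κ μ F S) := by
  intro X Y Z hX hY hZ
  refine forall_slit_of_forall_slitLoc fun x₀ p hp => ?_
  have hp' := slitLoc_subset x₀ hp
  have hsp := isLocalSpray hF hS x₀
  have key : ∀ {Y Z : Field E M}, SmoothField Y →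
      cFlat F (finslerConn κ μ F S) X Y Z ((tchart x₀).symm p)
        = κ * locCartan (locEnergy x₀ F) p (loc x₀ X p).1 (loc x₀ Y p).1 (loc x₀ Z p).1 := by
    intro Y Z hY
    have ht := loc_torsion_finslerConn κ μ hF hS hp (smoothField_almostTangent hX) hY
    have h0 : locTensor κ μ (locEnergy x₀ F) (locSpray x₀ S) p (loc x₀ Y p) 0 = 0 := by
      simpa using hsp.locTensor_smul_right (κ := κ) (μ := μ) hp 0 (loc x₀ Y p) 0
    have hL0 : ∀ v, locLandsberg (locEnergy x₀ F) (locSpray x₀ S) p 0 v = 0 := fun v => by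
      simpa using hsp.locLandsberg_smul_left hp 0 0 v
    rw [loc_almostTangent hp', h0, sub_zero] at ht
    rw [cFlat, vertMetric_eq hF hp (by rw [ht]) (by rw [loc_almostTangent hp']), ht,
      loc_almostTangent hp', hsp.locMetric_locTensor hp]
    simp only [map_zero, add_zero, hL0, zero_apply, mul_zero]
  rw [key hY, key hZ, hsp.locCartan_symm_right hp]

theorem isBerwald_finslerConn (hF : IsFinslerMetric F) (hS : IsGeodesicSpray F S) :
    IsBerwald S (finslerConn 0 0 F S) := by
  intro X Y hX hY
  refine forall_slit_of_forall_slitLoc fun x₀ p hp => ?_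
  have hp' := slitLoc_subset x₀ hp
  have hws := tchart_symm_mem_slit (M := M) hp
  have hs := (isLocalSpray hF hS x₀).contDiffAt_spray p hp
  have hJX := smoothField_almostTangent hX
  have hJY := smoothVertical_almostTangent hY
  have hHX := smoothField_hproj hF hS hX
  have hsm : ∀ {X : Field E M}, SmoothField X → SmoothFieldAt X ((tchart x₀).symm p) :=
    fun h => smoothField_iff.1 h _ hws
  have hT : ∀ ξ c, locTensor 0 0 (locEnergy x₀ F) (locSpray x₀ S) p ξ c = 0 := by
    intro ξ c
    rw [locTensor, zero_smul, zero_smul, add_zero, map_zero]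
  have hC : ∀ c, locChris (locSpray x₀ S) p 0 c = 0 := fun c => by
    simpa using locChris_smul_left (s := locSpray x₀ S) p 0 0 c
  constructor
  · refine eq_of_loc_eq hp ?_
    rw [loc_finslerConn 0 0 hF hS hp hJX hJY, loc_almostTangent hp',
      loc_bracket hp' (hsm hJX) (hsm hY), Prod.fst_sub,
      fderiv_loc_almostTangent hp' (differentiableAt_of_contDiffAt (hX.contDiffAt hp)), sub_zero,
      locNabla, hT, loc_almostTangent hp', hC, add_zero, add_zero,
      fderiv_eq_of_eqOn (h := fun q => (loc x₀ Y q).1) (isOpen_slitLoc x₀)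
        (fun q hq => by rw [loc_almostTangent (slitLoc_subset x₀ hq)]) hp,
      (differentiableAt_of_contDiffAt (hY.contDiffAt hp)).hasFDerivAt.fst.fderiv]
    rfl
  · refine eq_of_loc_eq hp ?_
    rw [loc_finslerConn 0 0 hF hS hp hHX hJY, loc_vproj hF hS hp,
      loc_bracket hp' (hsm hHX) (hsm hJY.1),
      vert_locBracket hs (a := fun q => (loc x₀ X q).1)
        (c := fun q => (loc x₀ (almostTangent Y) q).2)
        (differentiableAt_of_contDiffAt (hX.contDiffAt hp).fst)
        (differentiableAt_of_contDiffAt (hJY.1.contDiffAt hp).snd)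
        (eventually_of_mem ((isOpen_slitLoc x₀).mem_nhds hp) fun q hq => loc_hproj hF hS hq X)
        (eventually_of_mem ((isOpen_slitLoc x₀).mem_nhds hp) fun q hq => hJY.loc_eq hq),
      locNabla, hT, add_zero, loc_hproj hF hS hp]

end Construction

/-! ### Uniqueness: the difference of two connections with the same metric derivative. -/

section Uniqueness

variable {E : Type*} [NormedAddCommGroup E] [NormedSpace ℝ E]
  {M : Type*} [TopologicalSpace M] [ChartedSpace E M] [IsManifold 𝓘(ℝ, E) ∞ M]
  {F : TM E M → ℝ} {S : Field E M} {D D' : Field E M → Field E M → Field E M}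

namespace IsLinearConnection

/-- The axioms compare fields only on `TM \ 0`; taking the function `1` in the two linearity rules
shows that values on the null section do not matter. -/
theorem congr (hD : IsLinearConnection D) {X X' Y Y' : Field E M} (hX : SmoothField X)
    (hX' : SmoothField X') (hY : SmoothVertical Y) (hY' : SmoothVertical Y')
    (h : ∀ w ∈ slit E M, X' w = X w) (h' : ∀ w ∈ slit E M, Y' w = Y w) :
    ∀ w ∈ slit E M, D X' Y' w = D X Y w := by
  intro w hw
  rw [hD.smul_left (fun _ => 1) X X' Y' contMDiffOn_const hX hX' hY'
      (fun w hw => by rw [h w hw, one_smul]) w hw,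
    hD.leibniz (fun _ => 1) X Y Y' contMDiffOn_const hX hY hY'
      (fun w hw => by rw [h' w hw, one_smul]) w hw]
  have : dirDeriv X (fun _ => (1 : ℝ)) w = 0 := by
    rw [dirDeriv, mfderiv_const]; rfl
  rw [this, one_smul, one_smul, zero_smul, add_zero]

theorem eq_zero (hD : IsLinearConnection D) {X Y : Field E M} (hX : SmoothField X)
    (hY : SmoothVertical Y) (h : ∀ w ∈ slit E M, Y w = 0) : ∀ w ∈ slit E M, D X Y w = 0 := by
  intro w hw
  -- A field vanishing on `TM \ 0` is `0` times itself there.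
  have h1 := hD.leibniz (fun _ => 0) X Y Y contMDiffOn_const hX hY hY
    (fun w hw => by rw [h w hw, smul_zero]) w hw
  rwa [h w hw, zero_smul, smul_zero, add_zero] at h1

end IsLinearConnection

theorem almostTangent_almostTangent (X : Field E M) :
    ∀ w ∈ slit E M, almostTangent (almostTangent X) w = 0 := by
  refine forall_slit_of_forall_slitLoc fun x₀ p hp => ?_
  have hp' := slitLoc_subset x₀ hp
  refine toLoc_injective (tchart_symm_mem hp') ?_
  have h : loc x₀ (almostTangent (almostTangent X)) p = 0 := by
    rw [loc_almostTangent hp', loc_almostTangent hp']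
    rfl
  rw [map_zero]
  exact h

variable [FiniteDimensional ℝ E] [CompleteSpace E] [T2Space M]

/-- Split `X = H X + V X`. Both `V X` and `Y` are of the form `J(·)` on `TM \ 0`, via the horizontal
lift of vertical fields. -/
theorem eq_of_horizontal_of_vertical (hF : IsFinslerMetric F) (hS : IsGeodesicSpray F S)
    (hD : IsLinearConnection D) (hD' : IsLinearConnection D')
    (hH : ∀ X Y, SmoothField X → SmoothField Y → ∀ w ∈ slit E M,
      D (hproj S X) (almostTangent Y) w = D' (hproj S X) (almostTangent Y) w)
    (hV : ∀ X Y, SmoothField X → SmoothField Y → ∀ w ∈ slit E M,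
      D (almostTangent X) (almostTangent Y) w = D' (almostTangent X) (almostTangent Y) w) :
    ∀ X Y, SmoothField X → SmoothVertical Y → ∀ w ∈ slit E M, D X Y w = D' X Y w := by
  intro X Y hX hY w hw
  have hHX := smoothField_hproj hF hS hX
  have hVX := smoothVertical_vproj hF hS hX
  have hL := smoothField_horLift hF hS hY
  have hL' := smoothField_horLift hF hS hVX
  have key : ∀ {D : Field E M → Field E M → Field E M}, IsLinearConnection D →
      D X Y w = D (hproj S X) (almostTangent (horLift S Y)) w
        + D (almostTangent (horLift S (vproj S X))) (almostTangent (horLift S Y)) w := by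
    intro D hD
    have h := hD.add_left (hproj S X) (vproj S X) Y hHX hVX.1 hY w hw
    rw [hproj_add_vproj] at h
    rw [h, hD.congr hHX hHX hY (smoothVertical_almostTangent hL) (fun _ _ => rfl)
      (almostTangent_horLift hF hS hY) w hw,
      hD.congr hVX.1 (smoothVertical_almostTangent hL').1 hY (smoothVertical_almostTangent hL)
        (almostTangent_horLift hF hS hVX) (almostTangent_horLift hF hS hY) w hw]
  rw [key hD, key hD', hH X _ hX hL w hw, hV _ _ hL' hL w hw]

omit [FiniteDimensional ℝ E] [CompleteSpace E] [T2Space M] in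
/-- The difference of two metric derivatives is skew-symmetric. -/
theorem vertMetric_sub_add_eq_zero (hF : IsFinslerMetric F) (hD : IsLinearConnection D)
    (hD' : IsLinearConnection D') {X Y Z : Field E M} (hX : SmoothField X) (hY : SmoothVertical Y)
    (hZ : SmoothVertical Z) {x₀ : M} {p : E × E} (hp : p ∈ slitLoc E x₀)
    (h : nablaMetric F D X Y Z ((tchart x₀).symm p)
      = nablaMetric F D' X Y Z ((tchart x₀).symm p)) :
    locMetric (locEnergy x₀ F) p ((loc x₀ (D X Y) p).2 - (loc x₀ (D' X Y) p).2) (loc x₀ Z p).2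
      + locMetric (locEnergy x₀ F) p ((loc x₀ (D X Z) p).2 - (loc x₀ (D' X Z) p).2)
        (loc x₀ Y p).2 = 0 := by
  have hL := contDiffAt_locEnergy hF x₀ hp
  have hv : ∀ {D : Field E M → Field E M → Field E M}, IsLinearConnection D → ∀ {Y : Field E M},
      SmoothVertical Y → (loc x₀ (D X Y) p).1 = 0 := fun hD _ hY => (hD.smooth _ _ hX hY).loc_fst hp
  unfold nablaMetric at h
  rw [vertMetric_eq hF hp (hv hD hY) (hZ.loc_fst hp),
    vertMetric_eq hF hp (hv hD' hY) (hZ.loc_fst hp),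
    vertMetric_eq hF hp (hY.loc_fst hp) (hv hD hZ),
    vertMetric_eq hF hp (hY.loc_fst hp) (hv hD' hZ),
    locMetric_symm hL (loc x₀ Y p).2, locMetric_symm hL (loc x₀ Y p).2] at h
  have hsub : ∀ a b u, locMetric (locEnergy x₀ F) p (a - b) u
      = locMetric (locEnergy x₀ F) p a u - locMetric (locEnergy x₀ F) p b u := by
    intro a b u
    rw [← locFlat_apply, ← locFlat_apply, ← locFlat_apply, map_sub, sub_apply]
  rw [hsub, hsub]
  linarith

omit [CompleteSpace E] in
theorem exists_smoothField_loc_eq {x₀ : M} {p : E × E} (hp : p ∈ slitLoc E x₀) (ξ : E × E) :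
    ∃ Z : Field E M, SmoothField Z ∧ loc x₀ Z p = ξ := by
  obtain ⟨Z, hZ, hZw⟩ := exists_smoothField _ (ofLoc x₀ ((tchart (M := M) x₀).symm p) ξ)
  exact ⟨Z, smoothField_iff.2 fun w _ => hZ w,
    by rw [loc, hZw, toLoc_ofLoc (tchart_symm_mem (slitLoc_subset x₀ hp))]⟩

omit [CompleteSpace E] in
-- Base components of global smooth fields take every value at the point, so nondegeneracy of `g`
-- applies.
theorem eq_of_locMetric_almostTangent (hF : IsFinslerMetric F) {Y Y' : Field E M}
    (hY : SmoothVertical Y) (hY' : SmoothVertical Y') {x₀ : M} {p : E × E}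
    (hp : p ∈ slitLoc E x₀)
    (h : ∀ Z : Field E M, SmoothField Z → locMetric (locEnergy x₀ F) p
      ((loc x₀ Y p).2 - (loc x₀ Y' p).2) (loc x₀ Z p).1 = 0) :
    Y ((tchart x₀).symm p) = Y' ((tchart x₀).symm p) := by
  refine eq_of_loc_eq hp ?_
  rw [hY.loc_eq hp, hY'.loc_eq hp]
  refine Prod.ext rfl (sub_eq_zero.1 ?_)
  refine (isLocalLagrangian hF x₀).eq_of_locMetric_eq hp fun u => ?_
  obtain ⟨Z, hZ, hZp⟩ := exists_smoothField_loc_eq (M := M) hp (u, 0)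
  have h0 : locMetric (locEnergy x₀ F) p 0 u = 0 := by
    rw [← locFlat_apply, map_zero, zero_apply]
  have h1 := h Z hZ
  rw [hZp] at h1
  exact h1.trans h0.symm

/-- The torsion and metric conditions determine the connection along horizontal vectors: a trilinear
form which is symmetric in two arguments and skew in two others vanishes. -/
theorem eq_on_horizontal (hF : IsFinslerMetric F) (hS : IsGeodesicSpray F S)
    (hD : IsLinearConnection D) (hD' : IsLinearConnection D') (hT : T2 S D) (hT' : T2 S D')
    (hM : ∀ X Y Z, SmoothField X → SmoothVertical Y → SmoothVertical Z → ∀ w ∈ slit E M,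
      nablaMetric F D X Y Z w = nablaMetric F D' X Y Z w)
    (X Y : Field E M) (hX : SmoothField X) (hY : SmoothField Y) : ∀ w ∈ slit E M,
      D (hproj S X) (almostTangent Y) w = D' (hproj S X) (almostTangent Y) w := by
  refine forall_slit_of_forall_slitLoc fun x₀ p hp => ?_
  have hws := tchart_symm_mem_slit (M := M) hp
  have hh : ∀ {X : Field E M}, SmoothField X → SmoothField (hproj S X) :=
    fun hX => smoothField_hproj hF hS hX
  have hj : ∀ {X : Field E M}, SmoothField X → SmoothVertical (almostTangent X) :=
    fun hX => smoothVertical_almostTangent hX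
  -- Because `J H = J`, the torsion of `H X` and `H Y` involves only derivatives of the form `∇_{HX}
  -- JY`, and the bracket term is common to both connections.
  have hJH : ∀ X : Field E M, ∀ w ∈ slit E M, almostTangent (hproj S X) w = almostTangent X w := by
    intro X
    refine forall_slit_of_forall_slitLoc fun x₀ p hp => eq_of_loc_eq hp ?_
    rw [loc_almostTangent (slitLoc_subset x₀ hp), loc_almostTangent (slitLoc_subset x₀ hp),
      loc_hproj hF hS hp]
  have hJHD : ∀ {D : Field E M → Field E M → Field E M}, IsLinearConnection D →
      ∀ {X Y : Field E M}, SmoothField X → SmoothField Y →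
      loc x₀ (D (hproj S X) (almostTangent (hproj S Y))) p
        = loc x₀ (D (hproj S X) (almostTangent Y)) p := fun hD X Y hX hY =>
    congrArg (toLoc x₀ _)
      (hD.congr (hh hX) (hh hX) (hj hY) (hj (hh hY)) (fun _ _ => rfl) (hJH Y) _ hws)
  set b : Field E M → Field E M → E := fun X Y =>
    (loc x₀ (D (hproj S X) (almostTangent Y)) p).2
      - (loc x₀ (D' (hproj S X) (almostTangent Y)) p).2 with hb
  have hsymm : ∀ {X Y : Field E M}, SmoothField X → SmoothField Y → b X Y = b Y X := by
    intro X Y hX hY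
    have key : ∀ {D : Field E M → Field E M → Field E M}, IsLinearConnection D → T2 S D →
        loc x₀ (D (hproj S X) (almostTangent Y)) p - loc x₀ (D (hproj S Y) (almostTangent X)) p
          = loc x₀ (almostTangent (bracket (hproj S X) (hproj S Y))) p := by
      intro D hD hT
      have h := congrArg (toLoc x₀ _) (hT X Y hX hY _ hws)
      rw [torsion, map_sub, map_sub, map_zero, sub_eq_zero] at h
      rw [← hJHD hD hX hY, ← hJHD hD hY hX]
      exact h
    have h := congrArg Prod.snd ((key hD hT).trans (key hD' hT').symm)
    simp only [Prod.snd_sub] at h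
    rw [hb]
    rw [sub_eq_sub_iff_add_eq_add] at h
    exact sub_eq_sub_iff_add_eq_add.2 (h.trans (add_comm _ _))
  have hskew : ∀ {X Y Z : Field E M}, SmoothField X → SmoothField Y → SmoothField Z →
      locMetric (locEnergy x₀ F) p (b X Y) (loc x₀ Z p).1
        = - locMetric (locEnergy x₀ F) p (b X Z) (loc x₀ Y p).1 := by
    intro X Y Z hX hY hZ
    have h := vertMetric_sub_add_eq_zero hF hD hD' (hh hX) (hj hY) (hj hZ) hp
      (hM _ _ _ (hh hX) (hj hY) (hj hZ) _ hws)
    rw [loc_almostTangent (slitLoc_subset x₀ hp), loc_almostTangent (slitLoc_subset x₀ hp)] at h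
    exact eq_neg_of_add_eq_zero_left h
  refine eq_of_locMetric_almostTangent hF (hD.smooth _ _ (hh hX) (hj hY))
    (hD'.smooth _ _ (hh hX) (hj hY)) hp fun Z hZ => ?_
  change locMetric (locEnergy x₀ F) p (b X Y) (loc x₀ Z p).1 = 0
  -- Skewness followed by symmetry permutes the three arguments cyclically with a sign; three rounds
  -- return the initial term with the opposite sign.
  have e1 := hskew hX hY hZ
  have e2 := hskew hZ hX hY
  have e3 := hskew hY hZ hX
  rw [hsymm hX hZ] at e1
  rw [hsymm hZ hY] at e2
  rw [hsymm hY hX] at e3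
  linarith

omit [FiniteDimensional ℝ E] [CompleteSpace E] [T2Space M] in
-- As `J² = 0`, the torsion of `J X` and `Y` is `∇_{JX} JY - J[JX, Y]`, so its vanishing prescribes
-- the derivative.
theorem eq_on_vertical_of_t3 (hD : IsLinearConnection D) (hD' : IsLinearConnection D') (hT : T3 D)
    (hT' : T3 D') (X Y : Field E M) (hX : SmoothField X) (hY : SmoothField Y) : ∀ w ∈ slit E M,
      D (almostTangent X) (almostTangent Y) w = D' (almostTangent X) (almostTangent Y) w := by
  intro w hw
  have hJ := smoothVertical_almostTangent hX
  have key : ∀ {D : Field E M → Field E M → Field E M}, IsLinearConnection D → T3 D →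
      D (almostTangent X) (almostTangent Y) w = almostTangent (bracket (almostTangent X) Y) w := by
    intro D hD hT
    have h := hT _ _ hJ.1 hY w hw
    rw [torsion, hD.eq_zero hY (smoothVertical_almostTangent hJ.1)
      (almostTangent_almostTangent X) w hw, sub_zero] at h
    exact sub_eq_zero.1 h
  rw [key hD hT, key hD' hT']

omit [CompleteSpace E] in
-- The bracket terms in `𝒞_♭` are the same for `D` and `D'`, so (M7) makes the difference along `J
-- X` symmetric for `g`. Equal metric derivatives make it skew, hence it is zero.
theorem eq_on_vertical_of_m7 (hF : IsFinslerMetric F) (hD : IsLinearConnection D)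
    (hD' : IsLinearConnection D') (hT : M7 F D) (hT' : M7 F D')
    (hM : ∀ X Y Z, SmoothField X → SmoothVertical Y → SmoothVertical Z → ∀ w ∈ slit E M,
      nablaMetric F D X Y Z w = nablaMetric F D' X Y Z w)
    (X Y : Field E M) (hX : SmoothField X) (hY : SmoothField Y) : ∀ w ∈ slit E M,
      D (almostTangent X) (almostTangent Y) w = D' (almostTangent X) (almostTangent Y) w := by
  refine forall_slit_of_forall_slitLoc fun x₀ p hp => ?_
  have hp' := slitLoc_subset x₀ hp
  have hws := tchart_symm_mem_slit (M := M) hp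
  have hj : ∀ {X : Field E M}, SmoothField X → SmoothVertical (almostTangent X) :=
    fun hX => smoothVertical_almostTangent hX
  have key : ∀ {D : Field E M → Field E M → Field E M}, IsLinearConnection D →
      ∀ {Y Z : Field E M}, SmoothField Y → cFlat F D X Y Z ((tchart x₀).symm p)
        = locMetric (locEnergy x₀ F) p ((loc x₀ (D (almostTangent X) (almostTangent Y)) p).2
          - (loc x₀ (almostTangent (bracket (almostTangent X) Y)) p).2) (loc x₀ Z p).1 := by
    intro D hD Y Z hY
    have ht : loc x₀ (torsion D (almostTangent X) Y) p
        = loc x₀ (D (almostTangent X) (almostTangent Y)) p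
          - loc x₀ (almostTangent (bracket (almostTangent X) Y)) p := by
      rw [loc, torsion, hD.eq_zero hY (smoothVertical_almostTangent (hj hX).1)
        (almostTangent_almostTangent X) _ hws, sub_zero, map_sub]
      rfl
    rw [cFlat, vertMetric_eq hF hp, ht, Prod.snd_sub, loc_almostTangent hp' Z]
    · rw [ht, Prod.fst_sub, (hD.smooth _ _ (hj hX).1 (hj hY)).loc_fst hp, loc_almostTangent hp',
        sub_zero]
    · rw [loc_almostTangent hp']
  have hsub : ∀ a b u, locMetric (locEnergy x₀ F) p (a - b) u
      = locMetric (locEnergy x₀ F) p a u - locMetric (locEnergy x₀ F) p b u := by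
    intro a b u
    rw [← locFlat_apply, ← locFlat_apply, ← locFlat_apply, map_sub, sub_apply]
  refine eq_of_locMetric_almostTangent hF (hD.smooth _ _ (hj hX).1 (hj hY))
    (hD'.smooth _ _ (hj hX).1 (hj hY)) hp fun Z hZ => ?_
  have h := vertMetric_sub_add_eq_zero hF hD hD' (hj hX).1 (hj hY) (hj hZ) hp
    (hM _ _ _ (hj hX).1 (hj hY) (hj hZ) _ hws)
  have h1 := hT X Y Z hX hY hZ _ hws
  have h2 := hT' X Y Z hX hY hZ _ hws
  rw [key hD hY, key hD hZ] at h1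
  rw [key hD' hY, key hD' hZ] at h2
  rw [loc_almostTangent hp' Z, loc_almostTangent hp' Y] at h
  simp only [hsub] at h h1 h2 ⊢
  linarith

/-- `P` stands for a metric condition: for uniqueness it matters only that it determines `∇g`. -/
theorem existsUniqueLift_of_t3 (hF : IsFinslerMetric F) (hS : IsGeodesicSpray F S)
    {P : (Field E M → Field E M → Field E M) → Prop} (hex : ∃ D, IsLift S D ∧ T3 D ∧ P D)
    (hM : ∀ D D', P D → P D' → ∀ X Y Z, SmoothField X → SmoothVertical Y → SmoothVertical Z →
      ∀ w ∈ slit E M, nablaMetric F D X Y Z w = nablaMetric F D' X Y Z w) :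
    ExistsUniqueLift S (fun D => T3 D ∧ P D) := by
  refine ⟨hex, fun D D' hD hP hD' hP' => ?_⟩
  have h2 : ∀ {D : Field E M → Field E M → Field E M}, T3 D → T2 S D := fun h X Y hX hY =>
    h _ _ (smoothField_hproj hF hS hX) (smoothField_hproj hF hS hY)
  exact eq_of_horizontal_of_vertical hF hS hD.1 hD'.1
    (eq_on_horizontal hF hS hD.1 hD'.1 (h2 hP.1) (h2 hP'.1) (hM D D' hP.2 hP'.2))
    (eq_on_vertical_of_t3 hD.1 hD'.1 hP.1 hP'.1)

theorem existsUniqueLift_of_t2_of_m7 (hF : IsFinslerMetric F) (hS : IsGeodesicSpray F S)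
    {P : (Field E M → Field E M → Field E M) → Prop}
    (hex : ∃ D, IsLift S D ∧ T2 S D ∧ P D ∧ M7 F D)
    (hM : ∀ D D', P D → P D' → ∀ X Y Z, SmoothField X → SmoothVertical Y → SmoothVertical Z →
      ∀ w ∈ slit E M, nablaMetric F D X Y Z w = nablaMetric F D' X Y Z w) :
    ExistsUniqueLift S (fun D => T2 S D ∧ P D ∧ M7 F D) := by
  refine ⟨hex, fun D D' hD hP hD' hP' => ?_⟩
  have hMD := hM D D' hP.2.1 hP'.2.1
  exact eq_of_horizontal_of_vertical hF hS hD.1 hD'.1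
    (eq_on_horizontal hF hS hD.1 hD'.1 hP.1 hP'.1 hMD)
    (eq_on_vertical_of_m7 hF hD.1 hD'.1 hP.2.2 hP'.2.2 hMD)

end Uniqueness

/-! ### The four characterisations and the Berwald connection. -/

section Main

variable {E : Type*} [NormedAddCommGroup E] [NormedSpace ℝ E] [FiniteDimensional ℝ E]
  [CompleteSpace E] {M : Type*} [TopologicalSpace M] [T2Space M] [ChartedSpace E M]
  [IsManifold 𝓘(ℝ, E) ∞ M] {F : TM E M → ℝ} {S : Field E M}

theorem existsUniqueLift_t3_m5 (hF : IsFinslerMetric F) (hS : IsGeodesicSpray F S) (ε : ℝ) :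
    ExistsUniqueLift S (fun D => T3 D ∧ M5 ε F S D) := by
  -- Solves `2 - 2κ = 2` and `-(2 + 2μ) = 2ε`.
  refine existsUniqueLift_of_t3 hF hS ⟨finslerConn 0 (-(1 + ε)) F S, isLift_finslerConn _ _ hF hS,
    t3_finslerConn _ hF hS, fun X Y Z hX hY hZ w hw => ?_⟩
    fun D D' h h' X Y Z hX hY hZ w hw => by rw [h X Y Z hX hY hZ w hw, h' X Y Z hX hY hZ w hw]
  rw [nablaMetric_finslerConn _ _ hF hS hX hY hZ w hw]
  ring

theorem existsUniqueLift_t2_m6_m7 (hF : IsFinslerMetric F) (hS : IsGeodesicSpray F S) :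
    ExistsUniqueLift S (fun D => T2 S D ∧ M6 F D ∧ M7 F D) := by
  -- These parameters make both coefficients of `∇g` vanish.
  refine existsUniqueLift_of_t2_of_m7 hF hS ⟨finslerConn 1 (-1) F S, isLift_finslerConn _ _ hF hS,
    t2_finslerConn _ _ hF hS, fun X Y Z hX hY hZ w hw => ?_, m7_finslerConn _ _ hF hS⟩
    fun D D' h h' X Y Z hX hY hZ w hw => by rw [h X Y Z hX hY hZ w hw, h' X Y Z hX hY hZ w hw]
  rw [nablaMetric_finslerConn _ _ hF hS hX hY hZ w hw]
  ring

theorem existsUniqueLift_t3_m3 (hF : IsFinslerMetric F) (hS : IsGeodesicSpray F S) :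
    ExistsUniqueLift S (fun D => T3 D ∧ M3 F S D) := by
  -- Here `μ = -1` removes `C'` from `∇g`, while `κ = 0` keeps `2 C` and the vanishing torsion.
  refine existsUniqueLift_of_t3 hF hS ⟨finslerConn 0 (-1) F S, isLift_finslerConn _ _ hF hS,
    t3_finslerConn _ hF hS, fun X Y Z hX hY hZ w hw => ?_⟩
    fun D D' h h' X Y Z hX hY hZ w hw => by rw [h X Y Z hX hY hZ w hw, h' X Y Z hX hY hZ w hw]
  rw [nablaMetric_finslerConn _ _ hF hS hX hY hZ w hw]
  ring

theorem existsUniqueLift_t2_m4_m7 (hF : IsFinslerMetric F) (hS : IsGeodesicSpray F S) (ε : ℝ) :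
    ExistsUniqueLift S (fun D => T2 S D ∧ M4 ε F S D ∧ M7 F D) := by
  -- Here `κ = 1` removes `C` from `∇g`, and `-(2 + 2μ) = 2ε`. For `ε = -1` this is `μ = 0`.
  refine existsUniqueLift_of_t2_of_m7 hF hS ⟨finslerConn 1 (-(1 + ε)) F S,
    isLift_finslerConn _ _ hF hS, t2_finslerConn _ _ hF hS,
    fun X Y Z hX hY hZ w hw => ?_, m7_finslerConn _ _ hF hS⟩
    fun D D' h h' X Y Z hX hY hZ w hw => by rw [h X Y Z hX hY hZ w hw, h' X Y Z hX hY hZ w hw]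
  rw [nablaMetric_finslerConn _ _ hF hS hX hY hZ w hw]
  ring

/-- The Berwald formulas give the derivatives along `J X` and `H X`, so they determine a connection
on `TM \ 0`, namely the member `κ = μ = 0` of the family. That member satisfies the conditions, and
the converse is uniqueness in (1) with `ε = -1`. -/
theorem isBerwald_iff (hF : IsFinslerMetric F) (hS : IsGeodesicSpray F S)
    {D : Field E M → Field E M → Field E M} (hD : IsLinearConnection D) :
    IsBerwald S D ↔ IsLift S D ∧ T3 D ∧ M5 (-1) F S D := by
  have hB := isBerwald_finslerConn hF hS
  have hL := isLift_finslerConn 0 0 hF hS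
  have hT := t3_finslerConn 0 hF hS
  have hM : M5 (-1) F S (finslerConn 0 0 F S) := fun X Y Z hX hY hZ w hw => by
    rw [nablaMetric_finslerConn _ _ hF hS hX hY hZ w hw]
    ring
  have hj : ∀ {X : Field E M}, SmoothField X → SmoothVertical (almostTangent X) :=
    fun hX => smoothVertical_almostTangent hX
  constructor
  · intro h
    have heq := eq_of_horizontal_of_vertical hF hS hD hL.1
      (fun X Y hX hY w hw => (h X Y hX hY w hw).2.trans (hB X Y hX hY w hw).2.symm)
      (fun X Y hX hY w hw => (h X Y hX hY w hw).1.trans (hB X Y hX hY w hw).1.symm)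
    refine ⟨⟨hD, fun X hX w hw => ?_, fun X hX w hw => ?_⟩, fun X Y hX hY w hw => ?_,
      fun X Y Z hX hY hZ w hw => ?_⟩
    · rw [heq X _ hX.1 smoothVertical_canonicalField w hw]
      exact hL.almostProjectable X hX w hw
    · rw [heq X _ hX smoothVertical_canonicalField w hw]
      exact hL.ker_eq X hX w hw
    · rw [← hT X Y hX hY w hw, torsion, torsion, heq _ _ hX (hj hY) w hw, heq _ _ hY (hj hX) w hw]
    · rw [← hM X Y Z hX hY hZ w hw, nablaMetric, nablaMetric]
      simp only [vertMetric]
      rw [heq _ _ hX hY w hw, heq _ _ hX hZ w hw]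
  · rintro ⟨hDL, hDT⟩ X Y hX hY w hw
    have heq := (existsUniqueLift_t3_m5 hF hS (-1)).2 D _ hDL hDT hL ⟨hT, hM⟩
    rw [heq _ _ (hj hX).1 (hj hY) w hw, heq _ _ (smoothField_hproj hF hS hX) (hj hY) w hw]
    exact hB X Y hX hY w hw

end Main

end FinslerLifts

end

theorem mainTheorem6
    {E : Type*} [NormedAddCommGroup E] [NormedSpace ℝ E] [FiniteDimensional ℝ E]
    {M : Type*} [TopologicalSpace M] [T2Space M] [ChartedSpace E M]
    [IsManifold 𝓘(ℝ, E) ∞ M]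
    (F : FinslerLifts.TM E M → ℝ) (hF : FinslerLifts.IsFinslerMetric F)
    (S : FinslerLifts.Field E M) (hS : FinslerLifts.IsGeodesicSpray F S) :
    (∀ ε : ℝ, ε = 1 ∨ ε = -1 →
      FinslerLifts.ExistsUniqueLift S
        (fun D => FinslerLifts.T3 D ∧ FinslerLifts.M5 ε F S D)) ∧
    FinslerLifts.ExistsUniqueLift S
      (fun D => FinslerLifts.T2 S D ∧ FinslerLifts.M6 F D ∧ FinslerLifts.M7 F D) ∧
    FinslerLifts.ExistsUniqueLift S
      (fun D => FinslerLifts.T3 D ∧ FinslerLifts.M3 F S D) ∧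
    (∀ ε : ℝ, ε = 1 ∨ ε = -1 →
      FinslerLifts.ExistsUniqueLift S
        (fun D => FinslerLifts.T2 S D ∧ FinslerLifts.M4 ε F S D ∧ FinslerLifts.M7 F D)) ∧
    (∀ D, FinslerLifts.IsLinearConnection D →
      (FinslerLifts.IsBerwald S D ↔
        FinslerLifts.IsLift S D ∧ FinslerLifts.T3 D ∧ FinslerLifts.M5 (-1) F S D)) := by
  have : CompleteSpace E := FiniteDimensional.complete ℝ E
  exact ⟨fun ε _ => FinslerLifts.existsUniqueLift_t3_m5 hF hS ε,
    FinslerLifts.existsUniqueLift_t2_m6_m7 hF hS, FinslerLifts.existsUniqueLift_t3_m3 hF hS,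
    fun ε _ => FinslerLifts.existsUniqueLift_t2_m4_m7 hF hS ε,
    fun _ hD => FinslerLifts.isBerwald_iff hF hS hD⟩
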